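/- In $\mathbb{C}^{8+8}$ with coordinates $(z_1,\dots,z_8,w_1,\dots,w_8)$, let $M$ be the real quadric defined by $$\begin{aligned} \Re w_1&=\Re(z_1\bar z_4+z_2\bar z_3),&\Re w_2&=\Re(z_1\bar z_6+z_2\bar z_5),\\ \Im w_3&=\Im(z_1\bar z_7+z_5\bar z_3),&\Im w_4&=\Im(z_2\bar z_7+z_3\bar z_6-z_5\bar z_4-z_8\bar z_1),\\ \Re w_5&=\Re(z_2\bar z_7+z_3\bar z_6-z_5\bar z_4-z_8\bar z_1),&\Im w_6&=\Im(z_2\bar z_8+z_6\bar z_4),\\ \Re w_7&=\Re(z_3\bar z_8+z_4\bar z_7),&\Re w_8&=\Re(z_5\bar z_8+z_6\bar z_7). \end{aligned}$$ Then $M=M^{24}$ is a CR-generic submanifold of real dimension $24$ (codimension $8$) and CR dimension $8$: the eight defining functions have linearly independent differentials along $M$, and $T_pM+J\,T_pM=T_p\mathbb{C}^{16}$ for all $p\in M$. Let $U\subset\mathbb{C}^{8+8}$ be any connected open set that meets $M$ (for instance $U=\mathbb{C}^{8+8}$, or a small ball around a point of $M$), and let $\mathfrak{hol}(M)$ be the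 real Lie algebra of all holomorphic vector fields $L=\sum_{a=1}^{8} Z_a(z,w)\,\partial_{z_a}+\sum_{b=1}^{8} W_b(z,w)\,\partial_{w_b}$ on $U$ for which $L+\overline{L}$ is tangent to $M$ along $M\cap U$. Give $z_a,w_b,\partial_{z_a},\partial_{w_b}$ the weights $1,2,-1,-2$, and let $\mathfrak{g}_k\subset\mathfrak{hol}(M)$ be the subspace of those fields whose coefficients are polynomials and which have only terms of weight $k$. Then: (a) $\mathfrak{hol}(M)=\bigoplus_{k\in\mathbb{Z}}\mathfrak{g}_k$, $[\mathfrak{g}_k,\mathfrak{g}_l]\subset\mathfrak{g}_{k+l}$, and $\mathfrak{g}_k=0$ for $|k|\ge 3$, so that $\mathfrak{hol}(M)=\mathfrak{g}_{-2}\oplus\mathfrak{g}_{-1}\oplus\mathfrak{g}_0\oplus\mathfrak{g}_1\oplus\mathfrak{g}_2$; the real dimensions of these five pieces are $8,16,30,16,8$. (b) The $78$ vector fields listed below (restricted to $U$) form a basis of the real vector space $\mathfrak{hol}(M)$, and those listed under weight $k$ form a basis of $\mathfrak{g}_k$, for $k=-2,-1,0,1,2$. (c) $\mathfrak{hol}(M)$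 is the real exceptional simple Lie algebra $E_{II}$ (also written $\mathfrak{e}_{6(2)}$), that is, the real form of the complex simple Lie algebra of type $E_6$ whose Killing form has signature $(40,38)$ ($40$ positive and $38$ negative squares). Here is the list, with $i=\sqrt{-1}$. The $8$ vector fields of weight $-2$: 1. $\partial_{w_3}$ 2. $\partial_{w_4}$ 3. $\partial_{w_6}$ 4. $i\,\partial_{w_1}$ 5. $i\,\partial_{w_2}$ 6. $i\,\partial_{w_5}$ 7. $i\,\partial_{w_7}$ 8. $i\,\partial_{w_8}$ The $16$ vector fields of weight $-1$: 9. $\partial_{z_1} + z_4 \partial_{w_1} + z_6 \partial_{w_2} - z_7 \partial_{w_3} - z_8 \partial_{w_4} - z_8 \partial_{w_5}$ 10. $\partial_{z_2} + z_3 \partial_{w_1} + z_5 \partial_{w_2} - z_7 \partial_{w_4} + z_7 \partial_{w_5} - z_8 \partial_{w_6}$ 11. $\partial_{z_3} + z_2 \partial_{w_1} + z_5 \partial_{w_3} - z_6 \partial_{w_4} + z_6 \partial_{w_5} + z_8 \partial_{w_7}$ 12. $\partial_{z_4} + z_1 \partial_{w_1} - z_5 \partial_{w_4} - z_5 \partial_{w_5}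 + z_6 \partial_{w_6} + z_7 \partial_{w_7}$ 13. $\partial_{z_5} + z_2 \partial_{w_2} - z_3 \partial_{w_3} + z_4 \partial_{w_4} - z_4 \partial_{w_5} + z_8 \partial_{w_8}$ 14. $\partial_{z_6} + z_1 \partial_{w_2} + z_3 \partial_{w_4} + z_3 \partial_{w_5} - z_4 \partial_{w_6} + z_7 \partial_{w_8}$ 15. $\partial_{z_7} + z_1 \partial_{w_3} + z_2 \partial_{w_4} + z_2 \partial_{w_5} + z_4 \partial_{w_7} + z_6 \partial_{w_8}$ 16. $\partial_{z_8} + z_1 \partial_{w_4} - z_1 \partial_{w_5} + z_2 \partial_{w_6} + z_3 \partial_{w_7} + z_5 \partial_{w_8}$ 17. $i\,(\partial_{z_1} - z_4 \partial_{w_1} - z_6 \partial_{w_2} + z_7 \partial_{w_3} + z_8 \partial_{w_4} + z_8 \partial_{w_5})$ 18. $i\,(\partial_{z_2} - z_3 \partial_{w_1} - z_5 \partial_{w_2} + z_7 \partial_{w_4} - z_7 \partial_{w_5} + z_8 \partial_{w_6})$ 19. $i\,(\partial_{z_3} - z_2 \partial_{w_1} - z_5 \partial_{w_3} + z_6 \partial_{w_4}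 - z_6 \partial_{w_5} - z_8 \partial_{w_7})$ 20. $i\,(\partial_{z_4} - z_1 \partial_{w_1} + z_5 \partial_{w_4} + z_5 \partial_{w_5} - z_6 \partial_{w_6} - z_7 \partial_{w_7})$ 21. $i\,(\partial_{z_5} - z_2 \partial_{w_2} + z_3 \partial_{w_3} - z_4 \partial_{w_4} + z_4 \partial_{w_5} - z_8 \partial_{w_8})$ 22. $i\,(\partial_{z_6} - z_1 \partial_{w_2} - z_3 \partial_{w_4} - z_3 \partial_{w_5} + z_4 \partial_{w_6} - z_7 \partial_{w_8})$ 23. $i\,(\partial_{z_7} - z_1 \partial_{w_3} - z_2 \partial_{w_4} - z_2 \partial_{w_5} - z_4 \partial_{w_7} - z_6 \partial_{w_8})$ 24. $i\,(\partial_{z_8} - z_1 \partial_{w_4} + z_1 \partial_{w_5} - z_2 \partial_{w_6} - z_3 \partial_{w_7} - z_5 \partial_{w_8})$ The $30$ vector fields of weight $0$: 25. $-z_5 \partial_{z_1} +z_6 \partial_{z_2} +z_7 \partial_{z_3} -z_8 \partial_{z_4} +w_5 \partial_{w_1} +2 w_8 \partial_{w_5}$ 26. $z_3 \partial_{z_1}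 -z_4 \partial_{z_2} +z_7 \partial_{z_5} -z_8 \partial_{z_6} +w_5 \partial_{w_2} -2 w_7 \partial_{w_5}$ 27. $z_2 \partial_{z_1} -z_4 \partial_{z_3} -z_6 \partial_{z_5} +z_8 \partial_{z_7} +w_4 \partial_{w_3} +2 w_6 \partial_{w_4}$ 28. $z_2 \partial_{z_2} +z_4 \partial_{z_4} +z_6 \partial_{z_6} +z_8 \partial_{z_8} +w_1 \partial_{w_1} +w_2 \partial_{w_2} +w_4 \partial_{w_4} +w_5 \partial_{w_5} +2 w_6 \partial_{w_6} +w_7 \partial_{w_7} +w_8 \partial_{w_8}$ 29. $z_1 \partial_{z_2} -z_3 \partial_{z_4} -z_5 \partial_{z_6} +z_7 \partial_{z_8} +2 w_3 \partial_{w_4} +w_4 \partial_{w_6}$ 30. $-z_1 \partial_{z_3} +z_2 \partial_{z_4} -z_5 \partial_{z_7} +z_6 \partial_{z_8} -2 w_2 \partial_{w_5} +w_5 \partial_{w_7}$ 31. $-z_1 \partial_{z_5} +z_2 \partial_{z_6} +z_3 \partial_{z_7} -z_4 \partial_{z_8} +2 w_1 \partial_{w_5} +w_5 \partial_{w_8}$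 32. $z_1 \partial_{z_1} +z_2 \partial_{z_2} -z_7 \partial_{z_7} -z_8 \partial_{z_8} +w_1 \partial_{w_1} +w_2 \partial_{w_2} -w_7 \partial_{w_7} -w_8 \partial_{w_8}$ 33. $z_7 \partial_{z_1} +z_8 \partial_{z_2} +w_7 \partial_{w_1} +w_8 \partial_{w_2}$ 34. $-z_2 \partial_{z_2} +z_3 \partial_{z_3} -z_6 \partial_{z_6} +z_7 \partial_{z_7} -w_2 \partial_{w_2} +w_3 \partial_{w_3} -w_6 \partial_{w_6} +w_7 \partial_{w_7}$ 35. $z_5 \partial_{z_3} +z_6 \partial_{z_4} +w_2 \partial_{w_1} +w_8 \partial_{w_7}$ 36. $-z_2 \partial_{z_2} -z_4 \partial_{z_4} +z_5 \partial_{z_5} +z_7 \partial_{z_7} -w_1 \partial_{w_1} +w_3 \partial_{w_3} -w_6 \partial_{w_6} +w_8 \partial_{w_8}$ 37. $z_3 \partial_{z_5} +z_4 \partial_{z_6} +w_1 \partial_{w_2} +w_7 \partial_{w_8}$ 38. $z_1 \partial_{z_7} +z_2 \partial_{z_8} +w_1 \partial_{w_7} +w_2 \partial_{w_8}$ 39.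 $i\,(z_5 \partial_{z_1} +z_6 \partial_{z_2} +z_7 \partial_{z_3} +z_8 \partial_{z_4} -w_4 \partial_{w_1} +2 w_8 \partial_{w_4})$ 40. $i\,(z_3 \partial_{z_1} +z_4 \partial_{z_2} -z_7 \partial_{z_5} -z_8 \partial_{z_6} +w_4 \partial_{w_2} +2 w_7 \partial_{w_4})$ 41. $i\,(z_1 \partial_{z_3} +z_2 \partial_{z_4} -z_5 \partial_{z_7} -z_6 \partial_{z_8} +2 w_2 \partial_{w_4} +w_4 \partial_{w_7})$ 42. $i\,(z_1 \partial_{z_5} +z_2 \partial_{z_6} +z_3 \partial_{z_7} +z_4 \partial_{z_8} -2 w_1 \partial_{w_4} +w_4 \partial_{w_8})$ 43. $i\,(z_6 \partial_{z_1} -z_8 \partial_{z_3} +w_6 \partial_{w_1} +w_8 \partial_{w_3})$ 44. $i\,(z_5 \partial_{z_2} -z_7 \partial_{z_4} +w_3 \partial_{w_1} +w_8 \partial_{w_6})$ 45. $i\,(z_2 \partial_{z_2} +z_3 \partial_{z_3} +z_5 \partial_{z_5} +z_8 \partial_{z_8} +w_5 \partial_{w_4} +w_4 \partial_{w_5})$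 46. $i\,(z_4 \partial_{z_1} +z_8 \partial_{z_5} -w_6 \partial_{w_2} +w_7 \partial_{w_3})$ 47. $i\,(z_1 \partial_{z_1} +z_4 \partial_{z_4} +z_6 \partial_{z_6} +z_7 \partial_{z_7} -w_5 \partial_{w_4} -w_4 \partial_{w_5})$ 48. $i\,(z_3 \partial_{z_2} +z_7 \partial_{z_6} -w_3 \partial_{w_2} +w_7 \partial_{w_6})$ 49. $i\,(z_2 \partial_{z_5} -z_4 \partial_{z_7} +w_1 \partial_{w_3} +w_6 \partial_{w_8})$ 50. $i\,(z_2 \partial_{z_3} +z_6 \partial_{z_7} -w_2 \partial_{w_3} +w_6 \partial_{w_7})$ 51. $i\,(z_2 \partial_{z_1} +z_4 \partial_{z_3} +z_6 \partial_{z_5} +z_8 \partial_{z_7} +w_5 \partial_{w_3} -2 w_6 \partial_{w_5})$ 52. $i\,(z_1 \partial_{z_6} -z_3 \partial_{z_8} +w_1 \partial_{w_6} +w_3 \partial_{w_8})$ 53. $i\,(z_1 \partial_{z_4} +z_5 \partial_{z_8} -w_2 \partial_{w_6} +w_3 \partial_{w_7})$ 54. $i\,(z_1 \partial_{z_2} +z_3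 \partial_{z_4} +z_5 \partial_{z_6} +z_7 \partial_{z_8} +2 w_3 \partial_{w_5} -w_5 \partial_{w_6})$ The $16$ vector fields of weight $1$: 55. $2 z_1^2 \partial_{z_1} +2 z_1 z_2 \partial_{z_2} +2 z_1 z_3 \partial_{z_3} -(-2 z_1 z_4 +2 w_1) \partial_{z_4} +2 z_1 z_5 \partial_{z_5} -(-2 z_1 z_6 +2 w_2) \partial_{z_6} +(2 z_1 z_7 +2 w_3) \partial_{z_7} +(2 z_2 z_7 -2 z_3 z_6 +2 z_4 z_5 +w_4 +w_5) \partial_{z_8} +2 w_1 z_1 \partial_{w_1} +2 w_2 z_1 \partial_{w_2} +2 w_3 z_1 \partial_{w_3} -(2 w_1 z_5 -2 w_2 z_3 -2 w_3 z_2 -w_4 z_1 +w_5 z_1) \partial_{w_4} -(2 w_1 z_5 -2 w_2 z_3 -2 w_3 z_2 +w_4 z_1 -w_5 z_1) \partial_{w_5} +(2 w_1 z_6 -2 w_2 z_4 +w_4 z_2 -w_5 z_2) \partial_{w_6} +(2 w_1 z_7 +2 w_3 z_4 +w_4 z_3 -w_5 z_3) \partial_{w_7} +(2 w_2 z_7 +2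 w_3 z_6 +w_4 z_5 -w_5 z_5) \partial_{w_8}$ 56. $-2 z_1 z_2 \partial_{z_1} -2 z_2^2 \partial_{z_2} +(-2 z_2 z_3 +2 w_1) \partial_{z_3} -2 z_2 z_4 \partial_{z_4} +(-2 z_2 z_5 +2 w_2) \partial_{z_5} -2 z_2 z_6 \partial_{z_6} -(2 z_1 z_8 +2 z_3 z_6 -2 z_4 z_5 +w_4 -w_5) \partial_{z_7} -(2 z_2 z_8 +2 w_6) \partial_{z_8} -2 w_1 z_2 \partial_{w_1} -2 w_2 z_2 \partial_{w_2} -(2 w_1 z_5 -2 w_2 z_3 +w_4 z_1 +w_5 z_1) \partial_{w_3} +(2 w_1 z_6 -2 w_2 z_4 -w_4 z_2 -w_5 z_2 -2 w_6 z_1) \partial_{w_4} -(2 w_1 z_6 -2 w_2 z_4 +w_4 z_2 +w_5 z_2 -2 w_6 z_1) \partial_{w_5} -2 w_6 z_2 \partial_{w_6} -(2 w_1 z_8 +w_4 z_4 +w_5 z_4 +2 w_6 z_3) \partial_{w_7} -(2 w_2 z_8 +w_4 z_6 +w_5 z_6 +2 w_6 z_5) \partial_{w_8}$ 57. $-2 z_1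 z_3 \partial_{z_1} +(-2 z_2 z_3 +2 w_1) \partial_{z_2} -2 z_3^2 \partial_{z_3} -2 z_3 z_4 \partial_{z_4} +(-2 z_3 z_5 +2 w_3) \partial_{z_5} -(-2 z_1 z_8 +2 z_2 z_7 +2 z_4 z_5 +w_4 -w_5) \partial_{z_6} -2 z_3 z_7 \partial_{z_7} +(-2 z_3 z_8 +2 w_7) \partial_{z_8} -2 w_1 z_3 \partial_{w_1} -(2 w_1 z_5 -2 w_3 z_2 +w_4 z_1 +w_5 z_1) \partial_{w_2} -2 w_3 z_3 \partial_{w_3} +(2 w_1 z_7 +2 w_3 z_4 -w_4 z_3 -w_5 z_3 -2 w_7 z_1) \partial_{w_4} -(2 w_1 z_7 +2 w_3 z_4 +w_4 z_3 +w_5 z_3 -2 w_7 z_1) \partial_{w_5} +(2 w_1 z_8 +w_4 z_4 +w_5 z_4 -2 w_7 z_2) \partial_{w_6} -2 w_7 z_3 \partial_{w_7} +(2 w_3 z_8 -w_4 z_7 -w_5 z_7 -2 w_7 z_5) \partial_{w_8}$ 58. $-(-2 z_1 z_4 +2 w_1) \partial_{z_1} +2 z_2 z_4 \partial_{z_2}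 +2 z_3 z_4 \partial_{z_3} +2 z_4^2 \partial_{z_4} +(2 z_1 z_8 -2 z_2 z_7 +2 z_3 z_6 +w_4 +w_5) \partial_{z_5} -(-2 z_4 z_6 +2 w_6) \partial_{z_6} -(-2 z_4 z_7 +2 w_7) \partial_{z_7} +2 z_4 z_8 \partial_{z_8} +2 w_1 z_4 \partial_{w_1} +(2 w_1 z_6 +w_4 z_2 -w_5 z_2 -2 w_6 z_1) \partial_{w_2} -(2 w_1 z_7 +w_4 z_3 -w_5 z_3 -2 w_7 z_1) \partial_{w_3} -(2 w_1 z_8 -w_4 z_4 +w_5 z_4 +2 w_6 z_3 -2 w_7 z_2) \partial_{w_4} -(2 w_1 z_8 +w_4 z_4 -w_5 z_4 +2 w_6 z_3 -2 w_7 z_2) \partial_{w_5} +2 w_6 z_4 \partial_{w_6} +2 w_7 z_4 \partial_{w_7} +(w_4 z_8 -w_5 z_8 -2 w_6 z_7 +2 w_7 z_6) \partial_{w_8}$ 59. $2 z_1 z_5 \partial_{z_1} -(-2 z_2 z_5 +2 w_2) \partial_{z_2} +(2 z_3 z_5 +2 w_3) \partial_{z_3} -(-2 z_1 z_8 +2 z_2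 z_7 -2 z_3 z_6 +w_4 -w_5) \partial_{z_4} +2 z_5^2 \partial_{z_5} +2 z_5 z_6 \partial_{z_6} +2 z_5 z_7 \partial_{z_7} -(-2 z_5 z_8 +2 w_8) \partial_{z_8} +(2 w_2 z_3 +2 w_3 z_2 -w_4 z_1 -w_5 z_1) \partial_{w_1} +2 w_2 z_5 \partial_{w_2} +2 w_3 z_5 \partial_{w_3} -(2 w_2 z_7 +2 w_3 z_6 -w_4 z_5 -w_5 z_5 -2 w_8 z_1) \partial_{w_4} +(2 w_2 z_7 +2 w_3 z_6 +w_4 z_5 +w_5 z_5 -2 w_8 z_1) \partial_{w_5} -(2 w_2 z_8 +w_4 z_6 +w_5 z_6 -2 w_8 z_2) \partial_{w_6} +(2 w_3 z_8 -w_4 z_7 -w_5 z_7 +2 w_8 z_3) \partial_{w_7} +2 w_8 z_5 \partial_{w_8}$ 60. $(-2 z_1 z_6 +2 w_2) \partial_{z_1} -2 z_2 z_6 \partial_{z_2} +(2 z_1 z_8 -2 z_2 z_7 -2 z_4 z_5 +w_4 +w_5) \partial_{z_3} -(2 z_4 z_6 +2 w_6) \partial_{z_4} -2 z_5 z_6 \partial_{z_5}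 -2 z_6^2 \partial_{z_6} +(-2 z_6 z_7 +2 w_8) \partial_{z_7} -2 z_6 z_8 \partial_{z_8} -(2 w_2 z_4 -w_4 z_2 +w_5 z_2 +2 w_6 z_1) \partial_{w_1} -2 w_2 z_6 \partial_{w_2} +(2 w_2 z_7 +w_4 z_5 -w_5 z_5 -2 w_8 z_1) \partial_{w_3} +(2 w_2 z_8 -w_4 z_6 +w_5 z_6 +2 w_6 z_5 -2 w_8 z_2) \partial_{w_4} +(2 w_2 z_8 +w_4 z_6 -w_5 z_6 +2 w_6 z_5 -2 w_8 z_2) \partial_{w_5} -2 w_6 z_6 \partial_{w_6} +(w_4 z_8 -w_5 z_8 -2 w_6 z_7 -2 w_8 z_4) \partial_{w_7} -2 w_8 z_6 \partial_{w_8}$ 61. $(-2 z_1 z_7 +2 w_3) \partial_{z_1} +(-2 z_1 z_8 -2 z_3 z_6 +2 z_4 z_5 +w_4 +w_5) \partial_{z_2} -2 z_3 z_7 \partial_{z_3} +(-2 z_4 z_7 +2 w_7) \partial_{z_4} -2 z_5 z_7 \partial_{z_5} +(-2 z_6 z_7 +2 w_8) \partial_{z_6} -2 z_7^2 \partial_{z_7}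 -2 z_7 z_8 \partial_{z_8} +(2 w_3 z_4 +w_4 z_3 -w_5 z_3 -2 w_7 z_1) \partial_{w_1} +(2 w_3 z_6 +w_4 z_5 -w_5 z_5 -2 w_8 z_1) \partial_{w_2} -2 w_3 z_7 \partial_{w_3} -(2 w_3 z_8 +w_4 z_7 -w_5 z_7 -2 w_7 z_5 +2 w_8 z_3) \partial_{w_4} -(2 w_3 z_8 -w_4 z_7 +w_5 z_7 -2 w_7 z_5 +2 w_8 z_3) \partial_{w_5} -(w_4 z_8 -w_5 z_8 +2 w_7 z_6 -2 w_8 z_4) \partial_{w_6} -2 w_7 z_7 \partial_{w_7} -2 w_8 z_7 \partial_{w_8}$ 62. $-(-2 z_2 z_7 +2 z_3 z_6 -2 z_4 z_5 +w_4 -w_5) \partial_{z_1} -(-2 z_2 z_8 +2 w_6) \partial_{z_2} -(-2 z_3 z_8 +2 w_7) \partial_{z_3} +2 z_4 z_8 \partial_{z_4} -(-2 z_5 z_8 +2 w_8) \partial_{z_5} +2 z_6 z_8 \partial_{z_6} +2 z_7 z_8 \partial_{z_7} +2 z_8^2 \partial_{z_8} -(w_4 z_4 +w_5 z_4 +2 w_6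 z_3 -2 w_7 z_2) \partial_{w_1} -(w_4 z_6 +w_5 z_6 +2 w_6 z_5 -2 w_8 z_2) \partial_{w_2} +(w_4 z_7 +w_5 z_7 +2 w_7 z_5 -2 w_8 z_3) \partial_{w_3} +(w_4 z_8 +w_5 z_8 +2 w_6 z_7 -2 w_7 z_6 +2 w_8 z_4) \partial_{w_4} +(w_4 z_8 +w_5 z_8 -2 w_6 z_7 +2 w_7 z_6 -2 w_8 z_4) \partial_{w_5} +2 w_6 z_8 \partial_{w_6} +2 w_7 z_8 \partial_{w_7} +2 w_8 z_8 \partial_{w_8}$ 63. $i\,(2 z_1^2 \partial_{z_1} +2 z_1 z_2 \partial_{z_2} +2 z_1 z_3 \partial_{z_3} +(2 z_1 z_4 +2 w_1) \partial_{z_4} +2 z_1 z_5 \partial_{z_5} +(2 z_1 z_6 +2 w_2) \partial_{z_6} -(-2 z_1 z_7 +2 w_3) \partial_{z_7} -(-2 z_2 z_7 +2 z_3 z_6 -2 z_4 z_5 +w_4 +w_5) \partial_{z_8} +2 w_1 z_1 \partial_{w_1} +2 w_2 z_1 \partial_{w_2} +2 w_3 z_1 \partial_{w_3} -(2 w_1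 z_5 -2 w_2 z_3 -2 w_3 z_2 -w_4 z_1 +w_5 z_1) \partial_{w_4} -(2 w_1 z_5 -2 w_2 z_3 -2 w_3 z_2 +w_4 z_1 -w_5 z_1) \partial_{w_5} +(2 w_1 z_6 -2 w_2 z_4 +w_4 z_2 -w_5 z_2) \partial_{w_6} +(2 w_1 z_7 +2 w_3 z_4 +w_4 z_3 -w_5 z_3) \partial_{w_7} +(2 w_2 z_7 +2 w_3 z_6 +w_4 z_5 -w_5 z_5) \partial_{w_8})$ 64. $i\,(2 z_1 z_2 \partial_{z_1} +2 z_2^2 \partial_{z_2} +(2 z_2 z_3 +2 w_1) \partial_{z_3} +2 z_2 z_4 \partial_{z_4} +(2 z_2 z_5 +2 w_2) \partial_{z_5} +2 z_2 z_6 \partial_{z_6} -(-2 z_1 z_8 -2 z_3 z_6 +2 z_4 z_5 +w_4 -w_5) \partial_{z_7} -(-2 z_2 z_8 +2 w_6) \partial_{z_8} +2 w_1 z_2 \partial_{w_1} +2 w_2 z_2 \partial_{w_2} +(2 w_1 z_5 -2 w_2 z_3 +w_4 z_1 +w_5 z_1) \partial_{w_3} -(2 w_1 z_6 -2 w_2 z_4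 -w_4 z_2 -w_5 z_2 -2 w_6 z_1) \partial_{w_4} +(2 w_1 z_6 -2 w_2 z_4 +w_4 z_2 +w_5 z_2 -2 w_6 z_1) \partial_{w_5} +2 w_6 z_2 \partial_{w_6} +(2 w_1 z_8 +w_4 z_4 +w_5 z_4 +2 w_6 z_3) \partial_{w_7} +(2 w_2 z_8 +w_4 z_6 +w_5 z_6 +2 w_6 z_5) \partial_{w_8})$ 65. $i\,(2 z_1 z_3 \partial_{z_1} +(2 z_2 z_3 +2 w_1) \partial_{z_2} +2 z_3^2 \partial_{z_3} +2 z_3 z_4 \partial_{z_4} +(2 z_3 z_5 +2 w_3) \partial_{z_5} -(2 z_1 z_8 -2 z_2 z_7 -2 z_4 z_5 +w_4 -w_5) \partial_{z_6} +2 z_3 z_7 \partial_{z_7} +(2 z_3 z_8 +2 w_7) \partial_{z_8} +2 w_1 z_3 \partial_{w_1} +(2 w_1 z_5 -2 w_3 z_2 +w_4 z_1 +w_5 z_1) \partial_{w_2} +2 w_3 z_3 \partial_{w_3} -(2 w_1 z_7 +2 w_3 z_4 -w_4 z_3 -w_5 z_3 -2 w_7 z_1) \partial_{w_4} +(2 w_1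 z_7 +2 w_3 z_4 +w_4 z_3 +w_5 z_3 -2 w_7 z_1) \partial_{w_5} -(2 w_1 z_8 +w_4 z_4 +w_5 z_4 -2 w_7 z_2) \partial_{w_6} +2 w_7 z_3 \partial_{w_7} -(2 w_3 z_8 -w_4 z_7 -w_5 z_7 -2 w_7 z_5) \partial_{w_8})$ 66. $i\,((2 z_1 z_4 +2 w_1) \partial_{z_1} +2 z_2 z_4 \partial_{z_2} +2 z_3 z_4 \partial_{z_3} +2 z_4^2 \partial_{z_4} -(-2 z_1 z_8 +2 z_2 z_7 -2 z_3 z_6 +w_4 +w_5) \partial_{z_5} +(2 z_4 z_6 +2 w_6) \partial_{z_6} +(2 z_4 z_7 +2 w_7) \partial_{z_7} +2 z_4 z_8 \partial_{z_8} +2 w_1 z_4 \partial_{w_1} +(2 w_1 z_6 +w_4 z_2 -w_5 z_2 -2 w_6 z_1) \partial_{w_2} -(2 w_1 z_7 +w_4 z_3 -w_5 z_3 -2 w_7 z_1) \partial_{w_3} -(2 w_1 z_8 -w_4 z_4 +w_5 z_4 +2 w_6 z_3 -2 w_7 z_2) \partial_{w_4} -(2 w_1 z_8 +w_4 z_4 -w_5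 z_4 +2 w_6 z_3 -2 w_7 z_2) \partial_{w_5} +2 w_6 z_4 \partial_{w_6} +2 w_7 z_4 \partial_{w_7} +(w_4 z_8 -w_5 z_8 -2 w_6 z_7 +2 w_7 z_6) \partial_{w_8})$ 67. $i\,(2 z_1 z_5 \partial_{z_1} +(2 z_2 z_5 +2 w_2) \partial_{z_2} -(-2 z_3 z_5 +2 w_3) \partial_{z_3} +(2 z_1 z_8 -2 z_2 z_7 +2 z_3 z_6 +w_4 -w_5) \partial_{z_4} +2 z_5^2 \partial_{z_5} +2 z_5 z_6 \partial_{z_6} +2 z_5 z_7 \partial_{z_7} +(2 z_5 z_8 +2 w_8) \partial_{z_8} +(2 w_2 z_3 +2 w_3 z_2 -w_4 z_1 -w_5 z_1) \partial_{w_1} +2 w_2 z_5 \partial_{w_2} +2 w_3 z_5 \partial_{w_3} -(2 w_2 z_7 +2 w_3 z_6 -w_4 z_5 -w_5 z_5 -2 w_8 z_1) \partial_{w_4} +(2 w_2 z_7 +2 w_3 z_6 +w_4 z_5 +w_5 z_5 -2 w_8 z_1) \partial_{w_5} -(2 w_2 z_8 +w_4 z_6 +w_5 z_6 -2 w_8 z_2)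 \partial_{w_6} +(2 w_3 z_8 -w_4 z_7 -w_5 z_7 +2 w_8 z_3) \partial_{w_7} +2 w_8 z_5 \partial_{w_8})$ 68. $i\,((2 z_1 z_6 +2 w_2) \partial_{z_1} +2 z_2 z_6 \partial_{z_2} +(-2 z_1 z_8 +2 z_2 z_7 +2 z_4 z_5 +w_4 +w_5) \partial_{z_3} -(-2 z_4 z_6 +2 w_6) \partial_{z_4} +2 z_5 z_6 \partial_{z_5} +2 z_6^2 \partial_{z_6} +(2 z_6 z_7 +2 w_8) \partial_{z_7} +2 z_6 z_8 \partial_{z_8} +(2 w_2 z_4 -w_4 z_2 +w_5 z_2 +2 w_6 z_1) \partial_{w_1} +2 w_2 z_6 \partial_{w_2} -(2 w_2 z_7 +w_4 z_5 -w_5 z_5 -2 w_8 z_1) \partial_{w_3} -(2 w_2 z_8 -w_4 z_6 +w_5 z_6 +2 w_6 z_5 -2 w_8 z_2) \partial_{w_4} -(2 w_2 z_8 +w_4 z_6 -w_5 z_6 +2 w_6 z_5 -2 w_8 z_2) \partial_{w_5} +2 w_6 z_6 \partial_{w_6} -(w_4 z_8 -w_5 z_8 -2 w_6 z_7 -2 w_8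 z_4) \partial_{w_7} +2 w_8 z_6 \partial_{w_8})$ 69. $i\,((2 z_1 z_7 +2 w_3) \partial_{z_1} +(2 z_1 z_8 +2 z_3 z_6 -2 z_4 z_5 +w_4 +w_5) \partial_{z_2} +2 z_3 z_7 \partial_{z_3} +(2 z_4 z_7 +2 w_7) \partial_{z_4} +2 z_5 z_7 \partial_{z_5} +(2 z_6 z_7 +2 w_8) \partial_{z_6} +2 z_7^2 \partial_{z_7} +2 z_7 z_8 \partial_{z_8} -(2 w_3 z_4 +w_4 z_3 -w_5 z_3 -2 w_7 z_1) \partial_{w_1} -(2 w_3 z_6 +w_4 z_5 -w_5 z_5 -2 w_8 z_1) \partial_{w_2} +2 w_3 z_7 \partial_{w_3} +(2 w_3 z_8 +w_4 z_7 -w_5 z_7 -2 w_7 z_5 +2 w_8 z_3) \partial_{w_4} +(2 w_3 z_8 -w_4 z_7 +w_5 z_7 -2 w_7 z_5 +2 w_8 z_3) \partial_{w_5} +(w_4 z_8 -w_5 z_8 +2 w_7 z_6 -2 w_8 z_4) \partial_{w_6} +2 w_7 z_7 \partial_{w_7} +2 w_8 z_7 \partial_{w_8})$ 70. $i\,((2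 z_2 z_7 -2 z_3 z_6 +2 z_4 z_5 +w_4 -w_5) \partial_{z_1} +(2 z_2 z_8 +2 w_6) \partial_{z_2} +(2 z_3 z_8 +2 w_7) \partial_{z_3} +2 z_4 z_8 \partial_{z_4} +(2 z_5 z_8 +2 w_8) \partial_{z_5} +2 z_6 z_8 \partial_{z_6} +2 z_7 z_8 \partial_{z_7} +2 z_8^2 \partial_{z_8} -(w_4 z_4 +w_5 z_4 +2 w_6 z_3 -2 w_7 z_2) \partial_{w_1} -(w_4 z_6 +w_5 z_6 +2 w_6 z_5 -2 w_8 z_2) \partial_{w_2} +(w_4 z_7 +w_5 z_7 +2 w_7 z_5 -2 w_8 z_3) \partial_{w_3} +(w_4 z_8 +w_5 z_8 +2 w_6 z_7 -2 w_7 z_6 +2 w_8 z_4) \partial_{w_4} +(w_4 z_8 +w_5 z_8 -2 w_6 z_7 +2 w_7 z_6 -2 w_8 z_4) \partial_{w_5} +2 w_6 z_8 \partial_{w_6} +2 w_7 z_8 \partial_{w_7} +2 w_8 z_8 \partial_{w_8})$ The $8$ vector fields of weight $2$: 71. $4 z_1 w_3 \partial_{z_1} +(4 w_1 z_5 -4 w_2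 z_3 +2 w_4 z_1 +2 w_5 z_1) \partial_{z_2} +4 z_3 w_3 \partial_{z_3} -(4 w_1 z_7 +2 w_4 z_3 -2 w_5 z_3 -4 w_7 z_1) \partial_{z_4} +4 z_5 w_3 \partial_{z_5} -(4 w_2 z_7 +2 w_4 z_5 -2 w_5 z_5 -4 w_8 z_1) \partial_{z_6} +4 z_7 w_3 \partial_{z_7} +(2 w_4 z_7 +2 w_5 z_7 +4 w_7 z_5 -4 w_8 z_3) \partial_{z_8} +4 w_1 w_3 \partial_{w_1} +4 w_2 w_3 \partial_{w_2} +4 w_3^2 \partial_{w_3} +4 w_3 w_4 \partial_{w_4} +4 w_3 w_5 \partial_{w_5} +(4 w_1 w_8 -4 w_2 w_7 +w_4^2-w_5^2) \partial_{w_6} +4 w_3 w_7 \partial_{w_7} +4 w_3 w_8 \partial_{w_8}$ 72. $(2 w_1 z_5 -2 w_2 z_3 -2 w_3 z_2 -w_4 z_1 +w_5 z_1) \partial_{z_1} +(2 w_1 z_6 -2 w_2 z_4 -w_4 z_2 -w_5 z_2 -2 w_6 z_1) \partial_{z_2} +(2 w_1 z_7 +2 w_3 z_4 -w_4 z_3 -w_5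 z_3 -2 w_7 z_1) \partial_{z_3} +(2 w_1 z_8 -w_4 z_4 +w_5 z_4 +2 w_6 z_3 -2 w_7 z_2) \partial_{z_4} +(2 w_2 z_7 +2 w_3 z_6 -w_4 z_5 -w_5 z_5 -2 w_8 z_1) \partial_{z_5} +(2 w_2 z_8 -w_4 z_6 +w_5 z_6 +2 w_6 z_5 -2 w_8 z_2) \partial_{z_6} -(2 w_3 z_8 +w_4 z_7 -w_5 z_7 -2 w_7 z_5 +2 w_8 z_3) \partial_{z_7} -(w_4 z_8 +w_5 z_8 +2 w_6 z_7 -2 w_7 z_6 +2 w_8 z_4) \partial_{z_8} -2 w_1 w_4 \partial_{w_1} -2 w_2 w_4 \partial_{w_2} -2 w_3 w_4 \partial_{w_3} +(4 w_1 w_8 -4 w_2 w_7 -4 w_3 w_6 -w_4^2-w_5^2) \partial_{w_4} -2 w_4 w_5 \partial_{w_5} -2 w_4 w_6 \partial_{w_6} -2 w_4 w_7 \partial_{w_7} -2 w_4 w_8 \partial_{w_8}$ 73. $(4 w_1 z_6 -4 w_2 z_4 +2 w_4 z_2 -2 w_5 z_2) \partial_{z_1} +4 z_2 w_6 \partial_{z_2}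 -(4 w_1 z_8 +2 w_4 z_4 +2 w_5 z_4 -4 w_7 z_2) \partial_{z_3} +4 z_4 w_6 \partial_{z_4} -(4 w_2 z_8 +2 w_4 z_6 +2 w_5 z_6 -4 w_8 z_2) \partial_{z_5} +4 z_6 w_6 \partial_{z_6} +(2 w_4 z_8 -2 w_5 z_8 +4 w_7 z_6 -4 w_8 z_4) \partial_{z_7} +4 z_8 w_6 \partial_{z_8} +4 w_1 w_6 \partial_{w_1} +4 w_2 w_6 \partial_{w_2} +(4 w_1 w_8 -4 w_2 w_7 +w_4^2-w_5^2) \partial_{w_3} +4 w_4 w_6 \partial_{w_4} +4 w_5 w_6 \partial_{w_5} +4 w_6^2 \partial_{w_6} +4 w_6 w_7 \partial_{w_7} +4 w_6 w_8 \partial_{w_8}$ 74. $i\,(4 z_1 w_1 \partial_{z_1} +4 z_2 w_1 \partial_{z_2} +4 z_3 w_1 \partial_{z_3} +4 z_4 w_1 \partial_{z_4} +(4 w_2 z_3 +4 w_3 z_2 -2 w_4 z_1 -2 w_5 z_1) \partial_{z_5} +(4 w_2 z_4 -2 w_4 z_2 +2 w_5 z_2 +4 w_6 z_1) \partial_{z_6}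 -(4 w_3 z_4 +2 w_4 z_3 -2 w_5 z_3 -4 w_7 z_1) \partial_{z_7} -(2 w_4 z_4 +2 w_5 z_4 +4 w_6 z_3 -4 w_7 z_2) \partial_{z_8} +4 w_1^2 \partial_{w_1} +4 w_1 w_2 \partial_{w_2} +4 w_1 w_3 \partial_{w_3} +4 w_1 w_4 \partial_{w_4} +4 w_1 w_5 \partial_{w_5} +4 w_1 w_6 \partial_{w_6} +4 w_1 w_7 \partial_{w_7} +(4 w_2 w_7 +4 w_3 w_6 -w_4^2+w_5^2) \partial_{w_8})$ 75. $i\,(4 z_1 w_2 \partial_{z_1} +4 z_2 w_2 \partial_{z_2} +(4 w_1 z_5 -4 w_3 z_2 +2 w_4 z_1 +2 w_5 z_1) \partial_{z_3} +(4 w_1 z_6 +2 w_4 z_2 -2 w_5 z_2 -4 w_6 z_1) \partial_{z_4} +4 z_5 w_2 \partial_{z_5} +4 z_6 w_2 \partial_{z_6} -(4 w_3 z_6 +2 w_4 z_5 -2 w_5 z_5 -4 w_8 z_1) \partial_{z_7} -(2 w_4 z_6 +2 w_5 z_6 +4 w_6 z_5 -4 w_8 z_2) \partial_{z_8} +4 w_1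 w_2 \partial_{w_1} +4 w_2^2 \partial_{w_2} +4 w_2 w_3 \partial_{w_3} +4 w_2 w_4 \partial_{w_4} +4 w_2 w_5 \partial_{w_5} +4 w_2 w_6 \partial_{w_6} +(4 w_1 w_8 -4 w_3 w_6 +w_4^2-w_5^2) \partial_{w_7} +4 w_2 w_8 \partial_{w_8})$ 76. $i\,((2 w_1 z_5 -2 w_2 z_3 -2 w_3 z_2 +w_4 z_1 -w_5 z_1) \partial_{z_1} -(2 w_1 z_6 -2 w_2 z_4 +w_4 z_2 +w_5 z_2 -2 w_6 z_1) \partial_{z_2} -(2 w_1 z_7 +2 w_3 z_4 +w_4 z_3 +w_5 z_3 -2 w_7 z_1) \partial_{z_3} +(2 w_1 z_8 +w_4 z_4 -w_5 z_4 +2 w_6 z_3 -2 w_7 z_2) \partial_{z_4} -(2 w_2 z_7 +2 w_3 z_6 +w_4 z_5 +w_5 z_5 -2 w_8 z_1) \partial_{z_5} +(2 w_2 z_8 +w_4 z_6 -w_5 z_6 +2 w_6 z_5 -2 w_8 z_2) \partial_{z_6} -(2 w_3 z_8 -w_4 z_7 +w_5 z_7 -2 w_7 z_5 +2 w_8 z_3)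 \partial_{z_7} -(w_4 z_8 +w_5 z_8 -2 w_6 z_7 +2 w_7 z_6 -2 w_8 z_4) \partial_{z_8} -2 w_1 w_5 \partial_{w_1} -2 w_2 w_5 \partial_{w_2} -2 w_3 w_5 \partial_{w_3} -2 w_4 w_5 \partial_{w_4} -(4 w_1 w_8 -4 w_2 w_7 -4 w_3 w_6 +w_4^2+w_5^2) \partial_{w_5} -2 w_5 w_6 \partial_{w_6} -2 w_5 w_7 \partial_{w_7} -2 w_5 w_8 \partial_{w_8})$ 77. $i\,((4 w_1 z_7 +4 w_3 z_4 +2 w_4 z_3 -2 w_5 z_3) \partial_{z_1} +(4 w_1 z_8 +2 w_4 z_4 +2 w_5 z_4 +4 w_6 z_3) \partial_{z_2} +4 z_3 w_7 \partial_{z_3} +4 z_4 w_7 \partial_{z_4} +(4 w_3 z_8 -2 w_4 z_7 -2 w_5 z_7 +4 w_8 z_3) \partial_{z_5} -(2 w_4 z_8 -2 w_5 z_8 -4 w_6 z_7 -4 w_8 z_4) \partial_{z_6} +4 z_7 w_7 \partial_{z_7} +4 z_8 w_7 \partial_{z_8} +4 w_1 w_7 \partial_{w_1} +(4 w_1 w_8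 -4 w_3 w_6 +w_4^2-w_5^2) \partial_{w_2} +4 w_3 w_7 \partial_{w_3} +4 w_4 w_7 \partial_{w_4} +4 w_5 w_7 \partial_{w_5} +4 w_6 w_7 \partial_{w_6} +4 w_7^2 \partial_{w_7} +4 w_7 w_8 \partial_{w_8})$ 78. $i\,((4 w_2 z_7 +4 w_3 z_6 +2 w_4 z_5 -2 w_5 z_5) \partial_{z_1} +(4 w_2 z_8 +2 w_4 z_6 +2 w_5 z_6 +4 w_6 z_5) \partial_{z_2} -(4 w_3 z_8 -2 w_4 z_7 -2 w_5 z_7 -4 w_7 z_5) \partial_{z_3} +(2 w_4 z_8 -2 w_5 z_8 -4 w_6 z_7 +4 w_7 z_6) \partial_{z_4} +4 z_5 w_8 \partial_{z_5} +4 z_6 w_8 \partial_{z_6} +4 z_7 w_8 \partial_{z_7} +4 z_8 w_8 \partial_{z_8} +(4 w_2 w_7 +4 w_3 w_6 -w_4^2+w_5^2) \partial_{w_1} +4 w_2 w_8 \partial_{w_2} +4 w_3 w_8 \partial_{w_3} +4 w_4 w_8 \partial_{w_4} +4 w_5 w_8 \partial_{w_5} +4 w_6 w_8 \partial_{w_6}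 +4 w_7 w_8 \partial_{w_7} +4 w_8^2 \partial_{w_8})$ -/

import Mathlib

open Set Module TensorProduct

noncomputable section

namespace CREII

/-! ### The ambient space and the quadric -/

/-- Indices of the coordinates of `ℂ^{8+8}`: `inl j` is the index of `z_j`, `inr j` that of `w_j`.
The labels `1, …, 8` are numerals of `Fin 8`; the numeral `8` is the element `0` of `Fin 8`. -/
abbrev Coord := Fin 8 ⊕ Fin 8

/-- `ℂ^{8+8}` -/
abbrev Space := Coord → ℂ

/-- The map `ℂ^{8+8} → ℝ^8` whose zero set is the quadric. -/
def defining (p : Space) : Fin 8 → ℝ :=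
  let z (j : Fin 8) : ℂ := p (.inl j)
  let w (j : Fin 8) : ℂ := p (.inr j)
  let zbar (j : Fin 8) : ℂ := starRingEnd ℂ (p (.inl j))
  ![(w 1).re - (z 1 * zbar 4 + z 2 * zbar 3).re,
    (w 2).re - (z 1 * zbar 6 + z 2 * zbar 5).re,
    (w 3).im - (z 1 * zbar 7 + z 5 * zbar 3).im,
    (w 4).im - (z 2 * zbar 7 + z 3 * zbar 6 - z 5 * zbar 4 - z 8 * zbar 1).im,
    (w 5).re - (z 2 * zbar 7 + z 3 * zbar 6 - z 5 * zbar 4 - z 8 * zbar 1).re,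
    (w 6).im - (z 2 * zbar 8 + z 6 * zbar 4).im,
    (w 7).re - (z 3 * zbar 8 + z 4 * zbar 7).re,
    (w 8).re - (z 5 * zbar 8 + z 6 * zbar 7).re]

/-- The quadric `M` in `ℂ^{8+8}`. -/
def quadric : Set Space := {p | defining p = 0}

/-- The tangent space `T_p M = ker dρ_p` (for `p ∈ M`) as a real subspace of `ℂ^{8+8} = ℝ^{32}`. -/
def tangent (p : Space) : Submodule ℝ Space := LinearMap.ker (fderiv ℝ defining p).toLinearMap

/-- The complex structure `J` of `ℂ^{8+8}`, as a real linear map. -/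
def J : Space →ₗ[ℝ] Space := (LinearMap.lsmul ℂ Space Complex.I).restrictScalars ℝ

/-! ### Holomorphic vector fields -/

/-- Holomorphic vector fields on the open set `U`. The field `∑ a_i ∂_i` is given by its
coefficient vector `a : U → ℂ^{8+8}`, which is extended by zero outside `U`. -/
def HolField (U : TopologicalSpace.Opens Space) : Submodule ℂ (Space → Space) where
  carrier := {X | AnalyticOnNhd ℂ X U ∧ ∀ p ∉ U, X p = 0}
  add_mem' := fun hX hY => ⟨hX.1.add hY.1, fun p hp => by simp [hX.2 p hp, hY.2 p hp]⟩
  zero_mem' := ⟨analyticOnNhd_const, fun _ _ => rfl⟩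
  smul_mem' := fun c _ hX => ⟨hX.1.const_smul (c := c), fun p hp => by simp [hX.2 p hp]⟩

variable {U : TopologicalSpace.Opens Space}

lemma HolField.analyticAt (X : HolField U) {p : Space} (hp : p ∈ U) :
    AnalyticAt ℂ (X : Space → Space) p := X.2.1 p hp

lemma HolField.eq_zero (X : HolField U) {p : Space} (hp : p ∉ U) :
    (X : Space → Space) p = 0 := X.2.2 p hp

/-- The bracket of vector fields, `[X, Y] = DY(X) - DX(Y)` in coordinates. -/
instance : Bracket (HolField U) (HolField U) where
  bracket X Y := ⟨VectorField.lieBracket ℂ (X : Space → Space) (Y : Space → Space), by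
    refine ⟨fun p hp => ?_, fun p hp => ?_⟩
    · have hX := HolField.analyticAt X hp
      have hY := HolField.analyticAt Y hp
      unfold VectorField.lieBracket
      have happ : ∀ {f g : Space → Space}, AnalyticAt ℂ f p → AnalyticAt ℂ g p →
        AnalyticAt ℂ (fun q => fderiv ℂ f q (g q)) p := fun hf hg =>
        (ContinuousLinearMap.analyticAt_bilinear (ContinuousLinearMap.id ℂ (Space →L[ℂ] Space))
          _).comp₂ hf.fderiv hg
      exact (happ hY hX).sub (happ hX hY)
    · simp [VectorField.lieBracket, HolField.eq_zero X hp, HolField.eq_zero Y hp]⟩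

lemma coe_bracket (X Y : HolField U) :
    ((⁅X, Y⁆ : HolField U) : Space → Space) =
      VectorField.lieBracket ℂ (X : Space → Space) (Y : Space → Space) := rfl

lemma HolField.ext' {X Y : HolField U}
    (h : ∀ p ∈ U, (X : Space → Space) p = (Y : Space → Space) p) : X = Y := by
  apply Subtype.ext
  funext p
  by_cases hp : p ∈ U
  · exact h p hp
  · rw [HolField.eq_zero X hp, HolField.eq_zero Y hp]

instance : LieRing (HolField U) where
  add_lie X Y Z := HolField.ext' fun p hp => by
    have hX := (HolField.analyticAt X hp).differentiableAt
    have hY := (HolField.analyticAt Y hp).differentiableAt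
    simpa [coe_bracket] using VectorField.lieBracket_add_left (W := (Z : Space → Space)) hX hY
  lie_add X Y Z := HolField.ext' fun p hp => by
    have hY := (HolField.analyticAt Y hp).differentiableAt
    have hZ := (HolField.analyticAt Z hp).differentiableAt
    simpa [coe_bracket] using VectorField.lieBracket_add_right (V := (X : Space → Space)) hY hZ
  lie_self X := HolField.ext' fun p hp => by simp [coe_bracket]
  leibniz_lie X Y Z := HolField.ext' fun p hp => by
    simpa [coe_bracket] using VectorField.leibniz_identity_lieBracket (𝕜 := ℂ)
      (n := minSmoothness ℂ 2) le_rfl (HolField.analyticAt X hp).contDiffAt (HolField.analyticAt Y hp).contDiffAt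
      (HolField.analyticAt Z hp).contDiffAt

instance : LieAlgebra ℂ (HolField U) where
  lie_smul c X Y := HolField.ext' fun p hp => by
    simpa [coe_bracket] using VectorField.lieBracket_const_smul_right (V := (X : Space → Space))
      (c := c) (HolField.analyticAt Y hp).differentiableAt

instance : LieAlgebra ℝ (HolField U) where
  lie_smul c X Y := by
    have h : ∀ V : HolField U, c • V = (c : ℂ) • V := fun V => rfl
    rw [h, h, lie_smul]

/-! ### Infinitesimal CR symmetries -/

/-- Moving `p` in the `w`-directions so as to change `defining p` by `s`. -/
def shift : (Fin 8 → ℝ) →ₗ[ℝ] Space where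
  toFun s := Sum.elim 0 ![(s 7 : ℂ), s 0, s 1, s 2 * Complex.I, s 3 * Complex.I, s 4,
    s 5 * Complex.I, s 6]
  map_add' s t := by
    funext i
    rcases i with i | i
    · simp
    · fin_cases i <;> simp [add_mul]
  map_smul' c s := by
    funext i
    rcases i with i | i
    · simp
    · fin_cases i <;> simp [mul_assoc]

lemma defining_add_shift (p : Space) (s : Fin 8 → ℝ) :
    defining (p + shift s) = defining p + s := by
  funext i
  fin_cases i <;> simp [defining, shift] <;> ring

lemma contDiff_defining {n : WithTop ℕ∞} : ContDiff ℝ n defining := by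
  have hre : ∀ f : Space → ℂ, ContDiff ℝ n f → ContDiff ℝ n fun p => (f p).re :=
    fun f hf => Complex.reCLM.contDiff.comp hf
  have him : ∀ f : Space → ℂ, ContDiff ℝ n f → ContDiff ℝ n fun p => (f p).im :=
    fun f hf => Complex.imCLM.contDiff.comp hf
  have hconj : ∀ f : Space → ℂ, ContDiff ℝ n f →
      ContDiff ℝ n fun p => starRingEnd ℂ (f p) :=
    fun f hf => Complex.conjCLE.contDiff.comp hf
  have hc : ∀ i : Coord, ContDiff ℝ n fun p : Space => p i := fun i => contDiff_apply ℝ ℂ i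
  rw [contDiff_pi]
  intro i
  fin_cases i <;>
  simp only [defining] <;>
  (first
    | refine (hre _ (hc _)).sub (hre _ ?_)
    | refine (him _ (hc _)).sub (him _ ?_)) <;>
  first
    | exact ((hc _).mul (hconj _ (hc _))).add ((hc _).mul (hconj _ (hc _)))
    | exact ((((hc _).mul (hconj _ (hc _))).add ((hc _).mul (hconj _ (hc _)))).sub
        ((hc _).mul (hconj _ (hc _)))).sub ((hc _).mul (hconj _ (hc _)))

/-- A function that vanishes on `M` near `p` has zero derivative along `T_p M`. -/
lemma fderiv_eq_zero_of_tangent {f : Space → Fin 8 → ℝ} {p v : Space}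
    (hp : p ∈ quadric) (hpU : p ∈ U) (hf : DifferentiableAt ℝ f p)
    (h0 : ∀ q ∈ quadric, q ∈ U → f q = 0) (hv : v ∈ tangent p) : fderiv ℝ f p v = 0 := by
  let E : (Fin 8 → ℝ) →L[ℝ] Space := LinearMap.toContinuousLinearMap shift
  have hp0 : defining p = 0 := hp
  let r : Space → Space := fun q => q - E (defining q)
  have hrM : ∀ q, r q ∈ quadric := fun q => by
    have h := defining_add_shift q (-defining q)
    have h2 : q + shift (-defining q) = r q := by
      rw [map_neg, ← sub_eq_add_neg]; rfl
    rw [h2] at h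
    simpa [quadric] using h
  have hrp : r p = p := by simp [r, hp0]
  have hdef : HasFDerivAt defining (fderiv ℝ defining p) p :=
    (contDiff_defining (n := 1)).differentiable (by simp) p |>.hasFDerivAt
  have hr : HasFDerivAt r (ContinuousLinearMap.id ℝ Space - E.comp (fderiv ℝ defining p)) p :=
    (hasFDerivAt_id p).sub (E.hasFDerivAt.comp p hdef)
  have hcomp : HasFDerivAt (f ∘ r)
      ((fderiv ℝ f p).comp (ContinuousLinearMap.id ℝ Space - E.comp (fderiv ℝ defining p))) p := by
    refine HasFDerivAt.comp p ?_ hr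
    rw [hrp]
    exact hf.hasFDerivAt
  have hev : (f ∘ r) =ᶠ[nhds p] fun _ => 0 := by
    have hU : r ⁻¹' U ∈ nhds p := hr.continuousAt.preimage_mem_nhds (by
      rw [hrp]; exact U.isOpen.mem_nhds hpU)
    filter_upwards [hU] with q hq using h0 _ (hrM q) hq
  have hz : HasFDerivAt (f ∘ r) (0 : Space →L[ℝ] (Fin 8 → ℝ)) p :=
    (hasFDerivAt_const _ p).congr_of_eventuallyEq hev
  have key := congrArg (fun L : Space →L[ℝ] (Fin 8 → ℝ) => L v) (hcomp.unique hz)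
  have hv' : fderiv ℝ defining p v = 0 := hv
  simpa [hv'] using key

lemma lieBracket_mem_tangent {X Y : HolField U}
    (hX : ∀ p ∈ quadric, p ∈ U → (X : Space → Space) p ∈ tangent p)
    (hY : ∀ p ∈ quadric, p ∈ U → (Y : Space → Space) p ∈ tangent p)
    {p : Space} (hp : p ∈ quadric) (hpU : p ∈ U) :
    ((⁅X, Y⁆ : HolField U) : Space → Space) p ∈ tangent p := by
  have hXd := (HolField.analyticAt X hpU).differentiableAt
  have hYd := (HolField.analyticAt Y hpU).differentiableAt
  have hXr := hXd.restrictScalars ℝ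
  have hYr := hYd.restrictScalars ℝ
  have hb : ((⁅X, Y⁆ : HolField U) : Space → Space) p =
      VectorField.lieBracket ℝ (X : Space → Space) (Y : Space → Space) p := by
    rw [coe_bracket, VectorField.lieBracket, VectorField.lieBracket,
      hXd.fderiv_restrictScalars ℝ, hYd.fderiv_restrictScalars ℝ]
    rfl
  have hD : DifferentiableAt ℝ (fderiv ℝ defining) p :=
    ((contDiff_defining (n := 2)).fderiv_right (m := 1) (by norm_num)).differentiable (by simp) p
  have e := VectorField.fderiv_apply_lieBracket (𝕜 := ℝ) (n := 2) (f := defining)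
    (contDiff_defining (n := 2)).contDiffAt (by simp) hYr hXr
  have e1 := fderiv_eq_zero_of_tangent hp hpU (hD.clm_apply hYr)
    (fun q hq hqU => hY q hq hqU) (hX p hp hpU)
  have e2 := fderiv_eq_zero_of_tangent hp hpU (hD.clm_apply hXr)
    (fun q hq hqU => hX q hq hqU) (hY p hp hpU)
  rw [hb]
  change fderiv ℝ defining p _ = 0
  simp_all

/-- `hol(M ∩ U)`: the real Lie algebra of holomorphic vector fields `L` on `U` such that `L + L̄`
is tangent to `M` along `M ∩ U`. As a vector field on `ℝ^{32}`, the field `L + L̄` with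
`L = ∑ a_i ∂_i` is given by the vector `a ∈ ℂ^{8+8} = ℝ^{32}`. -/
def hol (U : TopologicalSpace.Opens Space) : LieSubalgebra ℝ (HolField U) where
  carrier := {X | ∀ p ∈ quadric, p ∈ U → (X : Space → Space) p ∈ tangent p}
  add_mem' := fun hX hY p hp hpU => (tangent p).add_mem (hX p hp hpU) (hY p hp hpU)
  zero_mem' := fun p _ _ => (tangent p).zero_mem
  smul_mem' := fun c _ hX p hp hpU => (tangent p).smul_mem c (hX p hp hpU)
  lie_mem' := fun hX hY _ hp hpU => lieBracket_mem_tangent hX hY hp hpU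

/-! ### Polynomial vector fields and weights -/

/-- Polynomial vector fields on `ℂ^{8+8}`, given by their coefficients. -/
abbrev PolyField := Coord → MvPolynomial Coord ℂ

/-- The restriction to `U` of a polynomial vector field. -/
def PolyField.restrict (U : TopologicalSpace.Opens Space) : PolyField →ₗ[ℂ] HolField U where
  toFun P := ⟨(U : Set Space).indicator fun p i => MvPolynomial.eval p (P i), by
    refine ⟨fun p hp => ?_, fun p hp => Set.indicator_of_notMem hp _⟩
    have h : AnalyticAt ℂ (fun (p : Space) (i : Coord) => MvPolynomial.eval p (P i)) p :=
      AnalyticAt.pi fun i => AnalyticOnNhd.eval_mvPolynomial (P i) p trivial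
    refine h.congr ?_
    filter_upwards [U.isOpen.mem_nhds hp] with q hq
    have hq' : q ∈ (U : Set Space) := hq
    simp [hq']⟩
  map_add' P Q := HolField.ext' fun p hp => by
    have hp' : p ∈ (U : Set Space) := hp
    funext i
    simp [hp']
  map_smul' c P := HolField.ext' fun p hp => by
    have hp' : p ∈ (U : Set Space) := hp
    funext i
    simp [hp']

/-- `z_j` has weight `1` and `w_j` has weight `2`. -/
def weight : Coord → ℤ := Sum.elim (fun _ => 1) fun _ => 2

/-- Polynomial vector fields that are weighted homogeneous of weight `k`, where `∂_{z_j}` has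
weight `-1` and `∂_{w_j}` has weight `-2`. -/
def PolyField.ofWeight (k : ℤ) : Submodule ℂ PolyField :=
  Submodule.pi univ fun i => MvPolynomial.weightedHomogeneousSubmodule ℂ weight (k + weight i)

/-- The piece `𝔤_k` of `hol(M ∩ U)`: the fields that have only terms of weight `k`. -/
def graded (U : TopologicalSpace.Opens Space) (k : ℤ) : Submodule ℝ (HolField U) :=
  (hol U).toSubmodule ⊓
    ((PolyField.ofWeight k).map (PolyField.restrict U)).restrictScalars ℝ

/-! ### The real Lie algebra `E_II` -/

/-- `L` is a complex semisimple Lie algebra of type `E₆`: its Killing form is nondegenerate, and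
for some Cartan subalgebra the root system has Cartan matrix `E₆`. -/
structure IsTypeE6 (L : Type*) [LieRing L] [LieAlgebra ℂ L] : Prop where
  finite : FiniteDimensional ℂ L
  killing : LieAlgebra.IsKilling ℂ L
  cartan : ∃ (H : LieSubalgebra ℂ L) (_ : H.IsCartanSubalgebra)
    (b : (LieAlgebra.IsKilling.rootSystem H).Base) (e : b.support ≃ Fin 6),
    Matrix.reindex e e b.cartanMatrix = CartanMatrix.E₆

/-- `𝔤` is the real form `E_II` (also written `𝔢₆₍₂₎`) of `E₆`: the complexification is of type
`E₆`, and the Killing form of `𝔤` has signature `(40, 38)`. Since `40 - 38 = 2`, this is the real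
form of `E₆` of character `2`; the other ones have character `6`, `-14`, `-26`, `-78`. -/
structure IsEII (𝔤 : Type*) [LieRing 𝔤] [LieAlgebra ℝ 𝔤] : Prop where
  complexification : IsTypeE6 (ℂ ⊗[ℝ] 𝔤)
  finite : FiniteDimensional ℝ 𝔤
  posIndex : _root_.sigPos (killingForm ℝ 𝔤).toQuadraticMap = 40
  negIndex : _root_.sigNeg (killingForm ℝ 𝔤).toQuadraticMap = 38

/-! ### The list of generators -/

/-- the coordinate function `z_j` -/
def z (j : Fin 8) : MvPolynomial Coord ℂ := .X (.inl j)

/-- the coordinate function `w_j` -/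
def w (j : Fin 8) : MvPolynomial Coord ℂ := .X (.inr j)

/-- the vector field `∂_{z_j}` -/
def dz (j : Fin 8) : PolyField := Pi.single (.inl j) 1

/-- the vector field `∂_{w_j}` -/
def dw (j : Fin 8) : PolyField := Pi.single (.inr j) 1

open Complex (I)

/-- The 8 generators of weight `-2`. -/
def genNegTwo : Fin 8 → PolyField :=
  ![
  dw 3,
  dw 4,
  dw 6,
  I • dw 1,
  I • dw 2,
  I • dw 5,
  I • dw 7,
  I • dw 8]

/-- The 16 generators of weight `-1`. -/
def genNegOne : Fin 16 → PolyField :=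
  ![
  dz 1 + z 4 • dw 1 + z 6 • dw 2 - z 7 • dw 3 - z 8 • dw 4 - z 8 • dw 5,
  dz 2 + z 3 • dw 1 + z 5 • dw 2 - z 7 • dw 4 + z 7 • dw 5 - z 8 • dw 6,
  dz 3 + z 2 • dw 1 + z 5 • dw 3 - z 6 • dw 4 + z 6 • dw 5 + z 8 • dw 7,
  dz 4 + z 1 • dw 1 - z 5 • dw 4 - z 5 • dw 5 + z 6 • dw 6 + z 7 • dw 7,
  dz 5 + z 2 • dw 2 - z 3 • dw 3 + z 4 • dw 4 - z 4 • dw 5 + z 8 • dw 8,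
  dz 6 + z 1 • dw 2 + z 3 • dw 4 + z 3 • dw 5 - z 4 • dw 6 + z 7 • dw 8,
  dz 7 + z 1 • dw 3 + z 2 • dw 4 + z 2 • dw 5 + z 4 • dw 7 + z 6 • dw 8,
  dz 8 + z 1 • dw 4 - z 1 • dw 5 + z 2 • dw 6 + z 3 • dw 7 + z 5 • dw 8,
  I • (dz 1 - z 4 • dw 1 - z 6 • dw 2 + z 7 • dw 3 + z 8 • dw 4 + z 8 • dw 5),
  I • (dz 2 - z 3 • dw 1 - z 5 • dw 2 + z 7 • dw 4 - z 7 • dw 5 + z 8 • dw 6),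
  I • (dz 3 - z 2 • dw 1 - z 5 • dw 3 + z 6 • dw 4 - z 6 • dw 5 - z 8 • dw 7),
  I • (dz 4 - z 1 • dw 1 + z 5 • dw 4 + z 5 • dw 5 - z 6 • dw 6 - z 7 • dw 7),
  I • (dz 5 - z 2 • dw 2 + z 3 • dw 3 - z 4 • dw 4 + z 4 • dw 5 - z 8 • dw 8),
  I • (dz 6 - z 1 • dw 2 - z 3 • dw 4 - z 3 • dw 5 + z 4 • dw 6 - z 7 • dw 8),
  I • (dz 7 - z 1 • dw 3 - z 2 • dw 4 - z 2 • dw 5 - z 4 • dw 7 - z 6 • dw 8),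
  I • (dz 8 - z 1 • dw 4 + z 1 • dw 5 - z 2 • dw 6 - z 3 • dw 7 - z 5 • dw 8)]

/-- The 30 generators of weight `0`. -/
def genZero : Fin 30 → PolyField :=
  ![
  -z 5 • dz 1 + z 6 • dz 2 + z 7 • dz 3 - z 8 • dz 4 + w 5 • dw 1 + (2 * w 8) • dw 5,
  z 3 • dz 1 - z 4 • dz 2 + z 7 • dz 5 - z 8 • dz 6 + w 5 • dw 2 - (2 * w 7) • dw 5,
  z 2 • dz 1 - z 4 • dz 3 - z 6 • dz 5 + z 8 • dz 7 + w 4 • dw 3 + (2 * w 6) • dw 4,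
  z 2 • dz 2 + z 4 • dz 4 + z 6 • dz 6 + z 8 • dz 8 + w 1 • dw 1 + w 2 • dw 2 + w 4 • dw 4 +
    w 5 • dw 5 + (2 * w 6) • dw 6 + w 7 • dw 7 + w 8 • dw 8,
  z 1 • dz 2 - z 3 • dz 4 - z 5 • dz 6 + z 7 • dz 8 + (2 * w 3) • dw 4 + w 4 • dw 6,
  -z 1 • dz 3 + z 2 • dz 4 - z 5 • dz 7 + z 6 • dz 8 - (2 * w 2) • dw 5 + w 5 • dw 7,
  -z 1 • dz 5 + z 2 • dz 6 + z 3 • dz 7 - z 4 • dz 8 + (2 * w 1) • dw 5 + w 5 • dw 8,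
  z 1 • dz 1 + z 2 • dz 2 - z 7 • dz 7 - z 8 • dz 8 + w 1 • dw 1 + w 2 • dw 2 - w 7 • dw 7 -
    w 8 • dw 8,
  z 7 • dz 1 + z 8 • dz 2 + w 7 • dw 1 + w 8 • dw 2,
  -z 2 • dz 2 + z 3 • dz 3 - z 6 • dz 6 + z 7 • dz 7 - w 2 • dw 2 + w 3 • dw 3 - w 6 • dw 6 +
    w 7 • dw 7,
  z 5 • dz 3 + z 6 • dz 4 + w 2 • dw 1 + w 8 • dw 7,
  -z 2 • dz 2 - z 4 • dz 4 + z 5 • dz 5 + z 7 • dz 7 - w 1 • dw 1 + w 3 • dw 3 - w 6 • dw 6 +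
    w 8 • dw 8,
  z 3 • dz 5 + z 4 • dz 6 + w 1 • dw 2 + w 7 • dw 8,
  z 1 • dz 7 + z 2 • dz 8 + w 1 • dw 7 + w 2 • dw 8,
  I • (z 5 • dz 1 + z 6 • dz 2 + z 7 • dz 3 + z 8 • dz 4 - w 4 • dw 1 + (2 * w 8) • dw 4),
  I • (z 3 • dz 1 + z 4 • dz 2 - z 7 • dz 5 - z 8 • dz 6 + w 4 • dw 2 + (2 * w 7) • dw 4),
  I • (z 1 • dz 3 + z 2 • dz 4 - z 5 • dz 7 - z 6 • dz 8 + (2 * w 2) • dw 4 + w 4 • dw 7),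
  I • (z 1 • dz 5 + z 2 • dz 6 + z 3 • dz 7 + z 4 • dz 8 - (2 * w 1) • dw 4 + w 4 • dw 8),
  I • (z 6 • dz 1 - z 8 • dz 3 + w 6 • dw 1 + w 8 • dw 3),
  I • (z 5 • dz 2 - z 7 • dz 4 + w 3 • dw 1 + w 8 • dw 6),
  I • (z 2 • dz 2 + z 3 • dz 3 + z 5 • dz 5 + z 8 • dz 8 + w 5 • dw 4 + w 4 • dw 5),
  I • (z 4 • dz 1 + z 8 • dz 5 - w 6 • dw 2 + w 7 • dw 3),
  I • (z 1 • dz 1 + z 4 • dz 4 + z 6 • dz 6 + z 7 • dz 7 - w 5 • dw 4 - w 4 • dw 5),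
  I • (z 3 • dz 2 + z 7 • dz 6 - w 3 • dw 2 + w 7 • dw 6),
  I • (z 2 • dz 5 - z 4 • dz 7 + w 1 • dw 3 + w 6 • dw 8),
  I • (z 2 • dz 3 + z 6 • dz 7 - w 2 • dw 3 + w 6 • dw 7),
  I • (z 2 • dz 1 + z 4 • dz 3 + z 6 • dz 5 + z 8 • dz 7 + w 5 • dw 3 - (2 * w 6) • dw 5),
  I • (z 1 • dz 6 - z 3 • dz 8 + w 1 • dw 6 + w 3 • dw 8),
  I • (z 1 • dz 4 + z 5 • dz 8 - w 2 • dw 6 + w 3 • dw 7),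
  I • (z 1 • dz 2 + z 3 • dz 4 + z 5 • dz 6 + z 7 • dz 8 + (2 * w 3) • dw 5 - w 5 • dw 6)]

/-- The 16 generators of weight `1`. -/
def genOne : Fin 16 → PolyField :=
  ![
  (2 * z 1 ^ 2) • dz 1 + (2 * z 1 * z 2) • dz 2 + (2 * z 1 * z 3) • dz 3 - (-2 * z 1 * z 4 + 2 *
    w 1) • dz 4 + (2 * z 1 * z 5) • dz 5 - (-2 * z 1 * z 6 + 2 * w 2) • dz 6 + (2 * z 1 * z 7 + 2
    * w 3) • dz 7 + (2 * z 2 * z 7 - 2 * z 3 * z 6 + 2 * z 4 * z 5 + w 4 + w 5) • dz 8 + (2 * w 1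
    * z 1) • dw 1 + (2 * w 2 * z 1) • dw 2 + (2 * w 3 * z 1) • dw 3 - (2 * w 1 * z 5 - 2 * w 2 *
    z 3 - 2 * w 3 * z 2 - w 4 * z 1 + w 5 * z 1) • dw 4 - (2 * w 1 * z 5 - 2 * w 2 * z 3 - 2 * w 3
    * z 2 + w 4 * z 1 - w 5 * z 1) • dw 5 + (2 * w 1 * z 6 - 2 * w 2 * z 4 + w 4 * z 2 - w 5 *
    z 2) • dw 6 + (2 * w 1 * z 7 + 2 * w 3 * z 4 + w 4 * z 3 - w 5 * z 3) • dw 7 + (2 * w 2 * z 7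
    + 2 * w 3 * z 6 + w 4 * z 5 - w 5 * z 5) • dw 8,
  -(2 * z 1 * z 2) • dz 1 - (2 * z 2 ^ 2) • dz 2 + (-2 * z 2 * z 3 + 2 * w 1) • dz 3 - (2 * z 2 *
    z 4) • dz 4 + (-2 * z 2 * z 5 + 2 * w 2) • dz 5 - (2 * z 2 * z 6) • dz 6 - (2 * z 1 * z 8 + 2
    * z 3 * z 6 - 2 * z 4 * z 5 + w 4 - w 5) • dz 7 - (2 * z 2 * z 8 + 2 * w 6) • dz 8 - (2 * w 1
    * z 2) • dw 1 - (2 * w 2 * z 2) • dw 2 - (2 * w 1 * z 5 - 2 * w 2 * z 3 + w 4 * z 1 + w 5 *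
    z 1) • dw 3 + (2 * w 1 * z 6 - 2 * w 2 * z 4 - w 4 * z 2 - w 5 * z 2 - 2 * w 6 * z 1) • dw 4 -
    (2 * w 1 * z 6 - 2 * w 2 * z 4 + w 4 * z 2 + w 5 * z 2 - 2 * w 6 * z 1) • dw 5 - (2 * w 6 *
    z 2) • dw 6 - (2 * w 1 * z 8 + w 4 * z 4 + w 5 * z 4 + 2 * w 6 * z 3) • dw 7 - (2 * w 2 * z 8
    + w 4 * z 6 + w 5 * z 6 + 2 * w 6 * z 5) • dw 8,
  -(2 * z 1 * z 3) • dz 1 + (-2 * z 2 * z 3 + 2 * w 1) • dz 2 - (2 * z 3 ^ 2) • dz 3 - (2 * z 3 *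
    z 4) • dz 4 + (-2 * z 3 * z 5 + 2 * w 3) • dz 5 - (-2 * z 1 * z 8 + 2 * z 2 * z 7 + 2 * z 4 *
    z 5 + w 4 - w 5) • dz 6 - (2 * z 3 * z 7) • dz 7 + (-2 * z 3 * z 8 + 2 * w 7) • dz 8 - (2 *
    w 1 * z 3) • dw 1 - (2 * w 1 * z 5 - 2 * w 3 * z 2 + w 4 * z 1 + w 5 * z 1) • dw 2 - (2 * w 3
    * z 3) • dw 3 + (2 * w 1 * z 7 + 2 * w 3 * z 4 - w 4 * z 3 - w 5 * z 3 - 2 * w 7 * z 1) • dw 4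
    - (2 * w 1 * z 7 + 2 * w 3 * z 4 + w 4 * z 3 + w 5 * z 3 - 2 * w 7 * z 1) • dw 5 + (2 * w 1 *
    z 8 + w 4 * z 4 + w 5 * z 4 - 2 * w 7 * z 2) • dw 6 - (2 * w 7 * z 3) • dw 7 + (2 * w 3 * z 8
    - w 4 * z 7 - w 5 * z 7 - 2 * w 7 * z 5) • dw 8,
  -(-2 * z 1 * z 4 + 2 * w 1) • dz 1 + (2 * z 2 * z 4) • dz 2 + (2 * z 3 * z 4) • dz 3 + (2 * z 4
    ^ 2) • dz 4 + (2 * z 1 * z 8 - 2 * z 2 * z 7 + 2 * z 3 * z 6 + w 4 + w 5) • dz 5 - (-2 * z 4 *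
    z 6 + 2 * w 6) • dz 6 - (-2 * z 4 * z 7 + 2 * w 7) • dz 7 + (2 * z 4 * z 8) • dz 8 + (2 * w 1
    * z 4) • dw 1 + (2 * w 1 * z 6 + w 4 * z 2 - w 5 * z 2 - 2 * w 6 * z 1) • dw 2 - (2 * w 1 *
    z 7 + w 4 * z 3 - w 5 * z 3 - 2 * w 7 * z 1) • dw 3 - (2 * w 1 * z 8 - w 4 * z 4 + w 5 * z 4 +
    2 * w 6 * z 3 - 2 * w 7 * z 2) • dw 4 - (2 * w 1 * z 8 + w 4 * z 4 - w 5 * z 4 + 2 * w 6 * z 3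
    - 2 * w 7 * z 2) • dw 5 + (2 * w 6 * z 4) • dw 6 + (2 * w 7 * z 4) • dw 7 + (w 4 * z 8 - w 5 *
    z 8 - 2 * w 6 * z 7 + 2 * w 7 * z 6) • dw 8,
  (2 * z 1 * z 5) • dz 1 - (-2 * z 2 * z 5 + 2 * w 2) • dz 2 + (2 * z 3 * z 5 + 2 * w 3) • dz 3 -
    (-2 * z 1 * z 8 + 2 * z 2 * z 7 - 2 * z 3 * z 6 + w 4 - w 5) • dz 4 + (2 * z 5 ^ 2) • dz 5 +
    (2 * z 5 * z 6) • dz 6 + (2 * z 5 * z 7) • dz 7 - (-2 * z 5 * z 8 + 2 * w 8) • dz 8 + (2 * w 2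
    * z 3 + 2 * w 3 * z 2 - w 4 * z 1 - w 5 * z 1) • dw 1 + (2 * w 2 * z 5) • dw 2 + (2 * w 3 *
    z 5) • dw 3 - (2 * w 2 * z 7 + 2 * w 3 * z 6 - w 4 * z 5 - w 5 * z 5 - 2 * w 8 * z 1) • dw 4 +
    (2 * w 2 * z 7 + 2 * w 3 * z 6 + w 4 * z 5 + w 5 * z 5 - 2 * w 8 * z 1) • dw 5 - (2 * w 2 *
    z 8 + w 4 * z 6 + w 5 * z 6 - 2 * w 8 * z 2) • dw 6 + (2 * w 3 * z 8 - w 4 * z 7 - w 5 * z 7 +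
    2 * w 8 * z 3) • dw 7 + (2 * w 8 * z 5) • dw 8,
  (-2 * z 1 * z 6 + 2 * w 2) • dz 1 - (2 * z 2 * z 6) • dz 2 + (2 * z 1 * z 8 - 2 * z 2 * z 7 - 2
    * z 4 * z 5 + w 4 + w 5) • dz 3 - (2 * z 4 * z 6 + 2 * w 6) • dz 4 - (2 * z 5 * z 6) • dz 5 -
    (2 * z 6 ^ 2) • dz 6 + (-2 * z 6 * z 7 + 2 * w 8) • dz 7 - (2 * z 6 * z 8) • dz 8 - (2 * w 2 *
    z 4 - w 4 * z 2 + w 5 * z 2 + 2 * w 6 * z 1) • dw 1 - (2 * w 2 * z 6) • dw 2 + (2 * w 2 * z 7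
    + w 4 * z 5 - w 5 * z 5 - 2 * w 8 * z 1) • dw 3 + (2 * w 2 * z 8 - w 4 * z 6 + w 5 * z 6 + 2 *
    w 6 * z 5 - 2 * w 8 * z 2) • dw 4 + (2 * w 2 * z 8 + w 4 * z 6 - w 5 * z 6 + 2 * w 6 * z 5 - 2
    * w 8 * z 2) • dw 5 - (2 * w 6 * z 6) • dw 6 + (w 4 * z 8 - w 5 * z 8 - 2 * w 6 * z 7 - 2 *
    w 8 * z 4) • dw 7 - (2 * w 8 * z 6) • dw 8,
  (-2 * z 1 * z 7 + 2 * w 3) • dz 1 + (-2 * z 1 * z 8 - 2 * z 3 * z 6 + 2 * z 4 * z 5 + w 4 +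
    w 5) • dz 2 - (2 * z 3 * z 7) • dz 3 + (-2 * z 4 * z 7 + 2 * w 7) • dz 4 - (2 * z 5 *
    z 7) • dz 5 + (-2 * z 6 * z 7 + 2 * w 8) • dz 6 - (2 * z 7 ^ 2) • dz 7 - (2 * z 7 *
    z 8) • dz 8 + (2 * w 3 * z 4 + w 4 * z 3 - w 5 * z 3 - 2 * w 7 * z 1) • dw 1 + (2 * w 3 * z 6
    + w 4 * z 5 - w 5 * z 5 - 2 * w 8 * z 1) • dw 2 - (2 * w 3 * z 7) • dw 3 - (2 * w 3 * z 8 +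
    w 4 * z 7 - w 5 * z 7 - 2 * w 7 * z 5 + 2 * w 8 * z 3) • dw 4 - (2 * w 3 * z 8 - w 4 * z 7 +
    w 5 * z 7 - 2 * w 7 * z 5 + 2 * w 8 * z 3) • dw 5 - (w 4 * z 8 - w 5 * z 8 + 2 * w 7 * z 6 - 2
    * w 8 * z 4) • dw 6 - (2 * w 7 * z 7) • dw 7 - (2 * w 8 * z 7) • dw 8,
  -(-2 * z 2 * z 7 + 2 * z 3 * z 6 - 2 * z 4 * z 5 + w 4 - w 5) • dz 1 - (-2 * z 2 * z 8 + 2 *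
    w 6) • dz 2 - (-2 * z 3 * z 8 + 2 * w 7) • dz 3 + (2 * z 4 * z 8) • dz 4 - (-2 * z 5 * z 8 + 2
    * w 8) • dz 5 + (2 * z 6 * z 8) • dz 6 + (2 * z 7 * z 8) • dz 7 + (2 * z 8 ^ 2) • dz 8 - (w 4
    * z 4 + w 5 * z 4 + 2 * w 6 * z 3 - 2 * w 7 * z 2) • dw 1 - (w 4 * z 6 + w 5 * z 6 + 2 * w 6 *
    z 5 - 2 * w 8 * z 2) • dw 2 + (w 4 * z 7 + w 5 * z 7 + 2 * w 7 * z 5 - 2 * w 8 * z 3) • dw 3 +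
    (w 4 * z 8 + w 5 * z 8 + 2 * w 6 * z 7 - 2 * w 7 * z 6 + 2 * w 8 * z 4) • dw 4 + (w 4 * z 8 +
    w 5 * z 8 - 2 * w 6 * z 7 + 2 * w 7 * z 6 - 2 * w 8 * z 4) • dw 5 + (2 * w 6 * z 8) • dw 6 +
    (2 * w 7 * z 8) • dw 7 + (2 * w 8 * z 8) • dw 8,
  I • ((2 * z 1 ^ 2) • dz 1 + (2 * z 1 * z 2) • dz 2 + (2 * z 1 * z 3) • dz 3 + (2 * z 1 * z 4 + 2
    * w 1) • dz 4 + (2 * z 1 * z 5) • dz 5 + (2 * z 1 * z 6 + 2 * w 2) • dz 6 - (-2 * z 1 * z 7 +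
    2 * w 3) • dz 7 - (-2 * z 2 * z 7 + 2 * z 3 * z 6 - 2 * z 4 * z 5 + w 4 + w 5) • dz 8 + (2 *
    w 1 * z 1) • dw 1 + (2 * w 2 * z 1) • dw 2 + (2 * w 3 * z 1) • dw 3 - (2 * w 1 * z 5 - 2 * w 2
    * z 3 - 2 * w 3 * z 2 - w 4 * z 1 + w 5 * z 1) • dw 4 - (2 * w 1 * z 5 - 2 * w 2 * z 3 - 2 *
    w 3 * z 2 + w 4 * z 1 - w 5 * z 1) • dw 5 + (2 * w 1 * z 6 - 2 * w 2 * z 4 + w 4 * z 2 - w 5 *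
    z 2) • dw 6 + (2 * w 1 * z 7 + 2 * w 3 * z 4 + w 4 * z 3 - w 5 * z 3) • dw 7 + (2 * w 2 * z 7
    + 2 * w 3 * z 6 + w 4 * z 5 - w 5 * z 5) • dw 8),
  I • ((2 * z 1 * z 2) • dz 1 + (2 * z 2 ^ 2) • dz 2 + (2 * z 2 * z 3 + 2 * w 1) • dz 3 + (2 * z 2
    * z 4) • dz 4 + (2 * z 2 * z 5 + 2 * w 2) • dz 5 + (2 * z 2 * z 6) • dz 6 - (-2 * z 1 * z 8 -
    2 * z 3 * z 6 + 2 * z 4 * z 5 + w 4 - w 5) • dz 7 - (-2 * z 2 * z 8 + 2 * w 6) • dz 8 + (2 *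
    w 1 * z 2) • dw 1 + (2 * w 2 * z 2) • dw 2 + (2 * w 1 * z 5 - 2 * w 2 * z 3 + w 4 * z 1 + w 5
    * z 1) • dw 3 - (2 * w 1 * z 6 - 2 * w 2 * z 4 - w 4 * z 2 - w 5 * z 2 - 2 * w 6 * z 1) • dw 4
    + (2 * w 1 * z 6 - 2 * w 2 * z 4 + w 4 * z 2 + w 5 * z 2 - 2 * w 6 * z 1) • dw 5 + (2 * w 6 *
    z 2) • dw 6 + (2 * w 1 * z 8 + w 4 * z 4 + w 5 * z 4 + 2 * w 6 * z 3) • dw 7 + (2 * w 2 * z 8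
    + w 4 * z 6 + w 5 * z 6 + 2 * w 6 * z 5) • dw 8),
  I • ((2 * z 1 * z 3) • dz 1 + (2 * z 2 * z 3 + 2 * w 1) • dz 2 + (2 * z 3 ^ 2) • dz 3 + (2 * z 3
    * z 4) • dz 4 + (2 * z 3 * z 5 + 2 * w 3) • dz 5 - (2 * z 1 * z 8 - 2 * z 2 * z 7 - 2 * z 4 *
    z 5 + w 4 - w 5) • dz 6 + (2 * z 3 * z 7) • dz 7 + (2 * z 3 * z 8 + 2 * w 7) • dz 8 + (2 * w 1
    * z 3) • dw 1 + (2 * w 1 * z 5 - 2 * w 3 * z 2 + w 4 * z 1 + w 5 * z 1) • dw 2 + (2 * w 3 *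
    z 3) • dw 3 - (2 * w 1 * z 7 + 2 * w 3 * z 4 - w 4 * z 3 - w 5 * z 3 - 2 * w 7 * z 1) • dw 4 +
    (2 * w 1 * z 7 + 2 * w 3 * z 4 + w 4 * z 3 + w 5 * z 3 - 2 * w 7 * z 1) • dw 5 - (2 * w 1 *
    z 8 + w 4 * z 4 + w 5 * z 4 - 2 * w 7 * z 2) • dw 6 + (2 * w 7 * z 3) • dw 7 - (2 * w 3 * z 8
    - w 4 * z 7 - w 5 * z 7 - 2 * w 7 * z 5) • dw 8),
  I • ((2 * z 1 * z 4 + 2 * w 1) • dz 1 + (2 * z 2 * z 4) • dz 2 + (2 * z 3 * z 4) • dz 3 + (2 *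
    z 4 ^ 2) • dz 4 - (-2 * z 1 * z 8 + 2 * z 2 * z 7 - 2 * z 3 * z 6 + w 4 + w 5) • dz 5 + (2 *
    z 4 * z 6 + 2 * w 6) • dz 6 + (2 * z 4 * z 7 + 2 * w 7) • dz 7 + (2 * z 4 * z 8) • dz 8 + (2 *
    w 1 * z 4) • dw 1 + (2 * w 1 * z 6 + w 4 * z 2 - w 5 * z 2 - 2 * w 6 * z 1) • dw 2 - (2 * w 1
    * z 7 + w 4 * z 3 - w 5 * z 3 - 2 * w 7 * z 1) • dw 3 - (2 * w 1 * z 8 - w 4 * z 4 + w 5 * z 4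
    + 2 * w 6 * z 3 - 2 * w 7 * z 2) • dw 4 - (2 * w 1 * z 8 + w 4 * z 4 - w 5 * z 4 + 2 * w 6 *
    z 3 - 2 * w 7 * z 2) • dw 5 + (2 * w 6 * z 4) • dw 6 + (2 * w 7 * z 4) • dw 7 + (w 4 * z 8 -
    w 5 * z 8 - 2 * w 6 * z 7 + 2 * w 7 * z 6) • dw 8),
  I • ((2 * z 1 * z 5) • dz 1 + (2 * z 2 * z 5 + 2 * w 2) • dz 2 - (-2 * z 3 * z 5 + 2 *
    w 3) • dz 3 + (2 * z 1 * z 8 - 2 * z 2 * z 7 + 2 * z 3 * z 6 + w 4 - w 5) • dz 4 + (2 * z 5 ^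
    2) • dz 5 + (2 * z 5 * z 6) • dz 6 + (2 * z 5 * z 7) • dz 7 + (2 * z 5 * z 8 + 2 * w 8) • dz 8
    + (2 * w 2 * z 3 + 2 * w 3 * z 2 - w 4 * z 1 - w 5 * z 1) • dw 1 + (2 * w 2 * z 5) • dw 2 + (2
    * w 3 * z 5) • dw 3 - (2 * w 2 * z 7 + 2 * w 3 * z 6 - w 4 * z 5 - w 5 * z 5 - 2 * w 8 *
    z 1) • dw 4 + (2 * w 2 * z 7 + 2 * w 3 * z 6 + w 4 * z 5 + w 5 * z 5 - 2 * w 8 * z 1) • dw 5 -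
    (2 * w 2 * z 8 + w 4 * z 6 + w 5 * z 6 - 2 * w 8 * z 2) • dw 6 + (2 * w 3 * z 8 - w 4 * z 7 -
    w 5 * z 7 + 2 * w 8 * z 3) • dw 7 + (2 * w 8 * z 5) • dw 8),
  I • ((2 * z 1 * z 6 + 2 * w 2) • dz 1 + (2 * z 2 * z 6) • dz 2 + (-2 * z 1 * z 8 + 2 * z 2 * z 7
    + 2 * z 4 * z 5 + w 4 + w 5) • dz 3 - (-2 * z 4 * z 6 + 2 * w 6) • dz 4 + (2 * z 5 *
    z 6) • dz 5 + (2 * z 6 ^ 2) • dz 6 + (2 * z 6 * z 7 + 2 * w 8) • dz 7 + (2 * z 6 * z 8) • dz 8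
    + (2 * w 2 * z 4 - w 4 * z 2 + w 5 * z 2 + 2 * w 6 * z 1) • dw 1 + (2 * w 2 * z 6) • dw 2 - (2
    * w 2 * z 7 + w 4 * z 5 - w 5 * z 5 - 2 * w 8 * z 1) • dw 3 - (2 * w 2 * z 8 - w 4 * z 6 + w 5
    * z 6 + 2 * w 6 * z 5 - 2 * w 8 * z 2) • dw 4 - (2 * w 2 * z 8 + w 4 * z 6 - w 5 * z 6 + 2 *
    w 6 * z 5 - 2 * w 8 * z 2) • dw 5 + (2 * w 6 * z 6) • dw 6 - (w 4 * z 8 - w 5 * z 8 - 2 * w 6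
    * z 7 - 2 * w 8 * z 4) • dw 7 + (2 * w 8 * z 6) • dw 8),
  I • ((2 * z 1 * z 7 + 2 * w 3) • dz 1 + (2 * z 1 * z 8 + 2 * z 3 * z 6 - 2 * z 4 * z 5 + w 4 +
    w 5) • dz 2 + (2 * z 3 * z 7) • dz 3 + (2 * z 4 * z 7 + 2 * w 7) • dz 4 + (2 * z 5 *
    z 7) • dz 5 + (2 * z 6 * z 7 + 2 * w 8) • dz 6 + (2 * z 7 ^ 2) • dz 7 + (2 * z 7 * z 8) • dz 8
    - (2 * w 3 * z 4 + w 4 * z 3 - w 5 * z 3 - 2 * w 7 * z 1) • dw 1 - (2 * w 3 * z 6 + w 4 * z 5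
    - w 5 * z 5 - 2 * w 8 * z 1) • dw 2 + (2 * w 3 * z 7) • dw 3 + (2 * w 3 * z 8 + w 4 * z 7 -
    w 5 * z 7 - 2 * w 7 * z 5 + 2 * w 8 * z 3) • dw 4 + (2 * w 3 * z 8 - w 4 * z 7 + w 5 * z 7 - 2
    * w 7 * z 5 + 2 * w 8 * z 3) • dw 5 + (w 4 * z 8 - w 5 * z 8 + 2 * w 7 * z 6 - 2 * w 8 *
    z 4) • dw 6 + (2 * w 7 * z 7) • dw 7 + (2 * w 8 * z 7) • dw 8),
  I • ((2 * z 2 * z 7 - 2 * z 3 * z 6 + 2 * z 4 * z 5 + w 4 - w 5) • dz 1 + (2 * z 2 * z 8 + 2 *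
    w 6) • dz 2 + (2 * z 3 * z 8 + 2 * w 7) • dz 3 + (2 * z 4 * z 8) • dz 4 + (2 * z 5 * z 8 + 2 *
    w 8) • dz 5 + (2 * z 6 * z 8) • dz 6 + (2 * z 7 * z 8) • dz 7 + (2 * z 8 ^ 2) • dz 8 - (w 4 *
    z 4 + w 5 * z 4 + 2 * w 6 * z 3 - 2 * w 7 * z 2) • dw 1 - (w 4 * z 6 + w 5 * z 6 + 2 * w 6 *
    z 5 - 2 * w 8 * z 2) • dw 2 + (w 4 * z 7 + w 5 * z 7 + 2 * w 7 * z 5 - 2 * w 8 * z 3) • dw 3 +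
    (w 4 * z 8 + w 5 * z 8 + 2 * w 6 * z 7 - 2 * w 7 * z 6 + 2 * w 8 * z 4) • dw 4 + (w 4 * z 8 +
    w 5 * z 8 - 2 * w 6 * z 7 + 2 * w 7 * z 6 - 2 * w 8 * z 4) • dw 5 + (2 * w 6 * z 8) • dw 6 +
    (2 * w 7 * z 8) • dw 7 + (2 * w 8 * z 8) • dw 8)]

/-- The 8 generators of weight `2`. -/
def genTwo : Fin 8 → PolyField :=
  ![
  (4 * z 1 * w 3) • dz 1 + (4 * w 1 * z 5 - 4 * w 2 * z 3 + 2 * w 4 * z 1 + 2 * w 5 * z 1) • dz 2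
    + (4 * z 3 * w 3) • dz 3 - (4 * w 1 * z 7 + 2 * w 4 * z 3 - 2 * w 5 * z 3 - 4 * w 7 *
    z 1) • dz 4 + (4 * z 5 * w 3) • dz 5 - (4 * w 2 * z 7 + 2 * w 4 * z 5 - 2 * w 5 * z 5 - 4 *
    w 8 * z 1) • dz 6 + (4 * z 7 * w 3) • dz 7 + (2 * w 4 * z 7 + 2 * w 5 * z 7 + 4 * w 7 * z 5 -
    4 * w 8 * z 3) • dz 8 + (4 * w 1 * w 3) • dw 1 + (4 * w 2 * w 3) • dw 2 + (4 * w 3 ^ 2) • dw 3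
    + (4 * w 3 * w 4) • dw 4 + (4 * w 3 * w 5) • dw 5 + (4 * w 1 * w 8 - 4 * w 2 * w 7 + w 4 ^ 2 -
    w 5 ^ 2) • dw 6 + (4 * w 3 * w 7) • dw 7 + (4 * w 3 * w 8) • dw 8,
  (2 * w 1 * z 5 - 2 * w 2 * z 3 - 2 * w 3 * z 2 - w 4 * z 1 + w 5 * z 1) • dz 1 + (2 * w 1 * z 6
    - 2 * w 2 * z 4 - w 4 * z 2 - w 5 * z 2 - 2 * w 6 * z 1) • dz 2 + (2 * w 1 * z 7 + 2 * w 3 *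
    z 4 - w 4 * z 3 - w 5 * z 3 - 2 * w 7 * z 1) • dz 3 + (2 * w 1 * z 8 - w 4 * z 4 + w 5 * z 4 +
    2 * w 6 * z 3 - 2 * w 7 * z 2) • dz 4 + (2 * w 2 * z 7 + 2 * w 3 * z 6 - w 4 * z 5 - w 5 * z 5
    - 2 * w 8 * z 1) • dz 5 + (2 * w 2 * z 8 - w 4 * z 6 + w 5 * z 6 + 2 * w 6 * z 5 - 2 * w 8 *
    z 2) • dz 6 - (2 * w 3 * z 8 + w 4 * z 7 - w 5 * z 7 - 2 * w 7 * z 5 + 2 * w 8 * z 3) • dz 7 -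
    (w 4 * z 8 + w 5 * z 8 + 2 * w 6 * z 7 - 2 * w 7 * z 6 + 2 * w 8 * z 4) • dz 8 - (2 * w 1 *
    w 4) • dw 1 - (2 * w 2 * w 4) • dw 2 - (2 * w 3 * w 4) • dw 3 + (4 * w 1 * w 8 - 4 * w 2 * w 7
    - 4 * w 3 * w 6 - w 4 ^ 2 - w 5 ^ 2) • dw 4 - (2 * w 4 * w 5) • dw 5 - (2 * w 4 * w 6) • dw 6
    - (2 * w 4 * w 7) • dw 7 - (2 * w 4 * w 8) • dw 8,
  (4 * w 1 * z 6 - 4 * w 2 * z 4 + 2 * w 4 * z 2 - 2 * w 5 * z 2) • dz 1 + (4 * z 2 * w 6) • dz 2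
    - (4 * w 1 * z 8 + 2 * w 4 * z 4 + 2 * w 5 * z 4 - 4 * w 7 * z 2) • dz 3 + (4 * z 4 *
    w 6) • dz 4 - (4 * w 2 * z 8 + 2 * w 4 * z 6 + 2 * w 5 * z 6 - 4 * w 8 * z 2) • dz 5 + (4 *
    z 6 * w 6) • dz 6 + (2 * w 4 * z 8 - 2 * w 5 * z 8 + 4 * w 7 * z 6 - 4 * w 8 * z 4) • dz 7 +
    (4 * z 8 * w 6) • dz 8 + (4 * w 1 * w 6) • dw 1 + (4 * w 2 * w 6) • dw 2 + (4 * w 1 * w 8 - 4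
    * w 2 * w 7 + w 4 ^ 2 - w 5 ^ 2) • dw 3 + (4 * w 4 * w 6) • dw 4 + (4 * w 5 * w 6) • dw 5 + (4
    * w 6 ^ 2) • dw 6 + (4 * w 6 * w 7) • dw 7 + (4 * w 6 * w 8) • dw 8,
  I • ((4 * z 1 * w 1) • dz 1 + (4 * z 2 * w 1) • dz 2 + (4 * z 3 * w 1) • dz 3 + (4 * z 4 *
    w 1) • dz 4 + (4 * w 2 * z 3 + 4 * w 3 * z 2 - 2 * w 4 * z 1 - 2 * w 5 * z 1) • dz 5 + (4 *
    w 2 * z 4 - 2 * w 4 * z 2 + 2 * w 5 * z 2 + 4 * w 6 * z 1) • dz 6 - (4 * w 3 * z 4 + 2 * w 4 *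
    z 3 - 2 * w 5 * z 3 - 4 * w 7 * z 1) • dz 7 - (2 * w 4 * z 4 + 2 * w 5 * z 4 + 4 * w 6 * z 3 -
    4 * w 7 * z 2) • dz 8 + (4 * w 1 ^ 2) • dw 1 + (4 * w 1 * w 2) • dw 2 + (4 * w 1 * w 3) • dw 3
    + (4 * w 1 * w 4) • dw 4 + (4 * w 1 * w 5) • dw 5 + (4 * w 1 * w 6) • dw 6 + (4 * w 1 *
    w 7) • dw 7 + (4 * w 2 * w 7 + 4 * w 3 * w 6 - w 4 ^ 2 + w 5 ^ 2) • dw 8),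
  I • ((4 * z 1 * w 2) • dz 1 + (4 * z 2 * w 2) • dz 2 + (4 * w 1 * z 5 - 4 * w 3 * z 2 + 2 * w 4
    * z 1 + 2 * w 5 * z 1) • dz 3 + (4 * w 1 * z 6 + 2 * w 4 * z 2 - 2 * w 5 * z 2 - 4 * w 6 *
    z 1) • dz 4 + (4 * z 5 * w 2) • dz 5 + (4 * z 6 * w 2) • dz 6 - (4 * w 3 * z 6 + 2 * w 4 * z 5
    - 2 * w 5 * z 5 - 4 * w 8 * z 1) • dz 7 - (2 * w 4 * z 6 + 2 * w 5 * z 6 + 4 * w 6 * z 5 - 4 *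
    w 8 * z 2) • dz 8 + (4 * w 1 * w 2) • dw 1 + (4 * w 2 ^ 2) • dw 2 + (4 * w 2 * w 3) • dw 3 +
    (4 * w 2 * w 4) • dw 4 + (4 * w 2 * w 5) • dw 5 + (4 * w 2 * w 6) • dw 6 + (4 * w 1 * w 8 - 4
    * w 3 * w 6 + w 4 ^ 2 - w 5 ^ 2) • dw 7 + (4 * w 2 * w 8) • dw 8),
  I • ((2 * w 1 * z 5 - 2 * w 2 * z 3 - 2 * w 3 * z 2 + w 4 * z 1 - w 5 * z 1) • dz 1 - (2 * w 1 *
    z 6 - 2 * w 2 * z 4 + w 4 * z 2 + w 5 * z 2 - 2 * w 6 * z 1) • dz 2 - (2 * w 1 * z 7 + 2 * w 3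
    * z 4 + w 4 * z 3 + w 5 * z 3 - 2 * w 7 * z 1) • dz 3 + (2 * w 1 * z 8 + w 4 * z 4 - w 5 * z 4
    + 2 * w 6 * z 3 - 2 * w 7 * z 2) • dz 4 - (2 * w 2 * z 7 + 2 * w 3 * z 6 + w 4 * z 5 + w 5 *
    z 5 - 2 * w 8 * z 1) • dz 5 + (2 * w 2 * z 8 + w 4 * z 6 - w 5 * z 6 + 2 * w 6 * z 5 - 2 * w 8
    * z 2) • dz 6 - (2 * w 3 * z 8 - w 4 * z 7 + w 5 * z 7 - 2 * w 7 * z 5 + 2 * w 8 * z 3) • dz 7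
    - (w 4 * z 8 + w 5 * z 8 - 2 * w 6 * z 7 + 2 * w 7 * z 6 - 2 * w 8 * z 4) • dz 8 - (2 * w 1 *
    w 5) • dw 1 - (2 * w 2 * w 5) • dw 2 - (2 * w 3 * w 5) • dw 3 - (2 * w 4 * w 5) • dw 4 - (4 *
    w 1 * w 8 - 4 * w 2 * w 7 - 4 * w 3 * w 6 + w 4 ^ 2 + w 5 ^ 2) • dw 5 - (2 * w 5 * w 6) • dw 6
    - (2 * w 5 * w 7) • dw 7 - (2 * w 5 * w 8) • dw 8),
  I • ((4 * w 1 * z 7 + 4 * w 3 * z 4 + 2 * w 4 * z 3 - 2 * w 5 * z 3) • dz 1 + (4 * w 1 * z 8 + 2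
    * w 4 * z 4 + 2 * w 5 * z 4 + 4 * w 6 * z 3) • dz 2 + (4 * z 3 * w 7) • dz 3 + (4 * z 4 *
    w 7) • dz 4 + (4 * w 3 * z 8 - 2 * w 4 * z 7 - 2 * w 5 * z 7 + 4 * w 8 * z 3) • dz 5 - (2 *
    w 4 * z 8 - 2 * w 5 * z 8 - 4 * w 6 * z 7 - 4 * w 8 * z 4) • dz 6 + (4 * z 7 * w 7) • dz 7 +
    (4 * z 8 * w 7) • dz 8 + (4 * w 1 * w 7) • dw 1 + (4 * w 1 * w 8 - 4 * w 3 * w 6 + w 4 ^ 2 -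
    w 5 ^ 2) • dw 2 + (4 * w 3 * w 7) • dw 3 + (4 * w 4 * w 7) • dw 4 + (4 * w 5 * w 7) • dw 5 +
    (4 * w 6 * w 7) • dw 6 + (4 * w 7 ^ 2) • dw 7 + (4 * w 7 * w 8) • dw 8),
  I • ((4 * w 2 * z 7 + 4 * w 3 * z 6 + 2 * w 4 * z 5 - 2 * w 5 * z 5) • dz 1 + (4 * w 2 * z 8 + 2
    * w 4 * z 6 + 2 * w 5 * z 6 + 4 * w 6 * z 5) • dz 2 - (4 * w 3 * z 8 - 2 * w 4 * z 7 - 2 * w 5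
    * z 7 - 4 * w 7 * z 5) • dz 3 + (2 * w 4 * z 8 - 2 * w 5 * z 8 - 4 * w 6 * z 7 + 4 * w 7 *
    z 6) • dz 4 + (4 * z 5 * w 8) • dz 5 + (4 * z 6 * w 8) • dz 6 + (4 * z 7 * w 8) • dz 7 + (4 *
    z 8 * w 8) • dz 8 + (4 * w 2 * w 7 + 4 * w 3 * w 6 - w 4 ^ 2 + w 5 ^ 2) • dw 1 + (4 * w 2 *
    w 8) • dw 2 + (4 * w 3 * w 8) • dw 3 + (4 * w 4 * w 8) • dw 4 + (4 * w 5 * w 8) • dw 5 + (4 *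
    w 6 * w 8) • dw 6 + (4 * w 7 * w 8) • dw 7 + (4 * w 8 ^ 2) • dw 8)]

/-- All 78 generators. -/
def generator : Fin 8 ⊕ Fin 16 ⊕ Fin 30 ⊕ Fin 16 ⊕ Fin 8 → PolyField :=
  Sum.elim genNegTwo (Sum.elim genNegOne (Sum.elim genZero (Sum.elim genOne genTwo)))

end CREII

end

/-!
Put `w_j ± w̄_j = Q_j(z, z̄)` for the equations of the quadric `M`, with complex bilinear forms `Q_j`
(`segre`). The left hand sides alone have surjective real differential, and its kernel is totally
real in the `w`-directions; this gives the first assertion, that `M` is generic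
(`surjective_fderiv_defining`, `tangent_sup_J`).

**The listed fields are symmetries.** Tangency of a polynomial field becomes, after `w̄` is
eliminated, the vanishing of polynomials in `z`, `w`, `z̄`. The polynomial fields of the list are
represented by sparse data with Gaussian integer coefficients, found by instance resolution along
their syntax, and identities between them are evaluated by the kernel. Only the fields of weight at
most `0` and one of weight `1` are tested; all others are brackets (`restrict_gen_mem_hol`). The 78
fields are independent over `ℂ` (`linearIndependent_gen`).

**There are no other symmetries.** If a holomorphic field `X` is tangent to `M`, differentiate the
tangency condition along the CR directions `(v, Q(v, z̄))`, for `v` and for `i v`. For the derivative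
`A` of `X` at a point of `M` this yields `(A V)_w - Q((A V)_z, z̄) = Q(v, ā)`, where
`V = (v, Q(v, z̄))` and `a` is the `z`-part of `X` (`cr_equation`). As the fourth form is
nondegenerate, `ā` can be eliminated. The resulting relations are holomorphic in the point `p` and in
`ζ = z̄`, and `{(p, z̄) : p ∈ M}` is a maximal totally real set and hence a set of uniqueness
(`eventually_eq_zero_of_quadric`). So the derivative of `X` at *every* nearby point lies in a fixed
space `crSpace` of matrices, an algebra of type `D₅` with centre in its 16-dimensional
representation, whose elements are determined by 46 of their entries (`eq_zero_of_crCoords`). The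
second derivatives of `X` then lie in the first prolongation of `crSpace`, whose elements are
determined by 16 numbers (`IsProlonged.eq_zero`), and the third derivatives in the second
prolongation, which is zero (`second_prolongation_eq_zero`). In a basis of weight vectors both facts
follow from the weights and from the symmetry of the derivatives.

Hence the fields with derivatives in `crSpace` form a complex space of dimension at most
`16 + 46 + 16 = 78` (`jetMap_injective`), which the listed fields span (`mem_span_gen`). The
coefficients of a symmetry are real, because no nonzero field `X` has both `X` and `i X` tangent to
`M` (`eq_zero_of_I_smul_mem`); so the listed fields are a real basis (`span_gen_eq_hol`). Each of
them is homogeneous, and projection to the parts of given weight yields the statements about the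
grading (`graded_eq_span`, `graded_basis`).

**The type of the algebra.** The complexification is identified with the complex span of the listed
fields (`realRealizes_of_complex`). There the table `rootTab` gives a torus of dimension 6 with 72
roots and root vectors, and the kernel verifies the brackets that matter. The Killing form is
nondegenerate, since it pairs opposite root spaces and since the sum of the squares of the roots is
nondegenerate on the torus (`isKilling_of_root_basis`); the Chevalley generators for the six simple
roots satisfy the relations of the Cartan matrix of type `E₆` and generate (`Realizes.isTypeE6`). The
signature comes from a real element of the torus whose eigenvectors are the listed fields, with
positive eigenvalue on 36 of them, negative on 36, and a Cartan subalgebra as its zero space. The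
Killing form vanishes on the positive part; on the Cartan subalgebra it is positive on a subspace of
dimension 4 and negative on one of dimension 2. So it is nonnegative on a space of dimension 40 and
nonpositive on one of dimension 38, which together with nondegeneracy gives `(40, 38)`
(`RealRealizes.isEII`).
-/

namespace CREII

/-! ### Sparse linear combinations with Gaussian integer coefficients -/

/-- Gaussian integers `a + b i`, as bare pairs so that the kernel can compute with them. -/
abbrev GInt := ℤ × ℤ

namespace GInt

/-- The complex number represented by a pair. -/
noncomputable def toC (a : GInt) : ℂ := (a.1 : ℂ) + (a.2 : ℂ) * Complex.I

/-- Sum of Gaussian integers. -/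
def add (a b : GInt) : GInt := (a.1 + b.1, a.2 + b.2)

/-- Product of Gaussian integers. -/
def mul (a b : GInt) : GInt := (a.1 * b.1 - a.2 * b.2, a.1 * b.2 + a.2 * b.1)

/-- Negative of a Gaussian integer. -/
def neg (a : GInt) : GInt := (-a.1, -a.2)

/-- Test for the Gaussian integer zero. -/
def isZero (a : GInt) : Bool := a.1 == 0 && a.2 == 0

lemma toC_add (a b : GInt) : toC (add a b) = toC a + toC b := by
  simp only [toC, add]; push_cast; ring

lemma toC_mul (a b : GInt) : toC (mul a b) = toC a * toC b := by
  simp only [toC, mul]; push_cast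
  linear_combination (-(a.2 : ℂ) * b.2) * Complex.I_sq

lemma toC_neg (a : GInt) : toC (neg a) = - toC a := by
  simp only [toC, neg]; push_cast; ring

lemma toC_isZero {a : GInt} (h : isZero a = true) : toC a = 0 := by
  simp only [isZero, Bool.and_eq_true, beq_iff_eq] at h
  simp [toC, h.1, h.2]

end GInt

/-- A Boolean equality test on keys that the kernel evaluates quickly. -/
class Key (κ : Type) where
  beq : κ → κ → Bool
  eq_of_beq : ∀ {a b : κ}, beq a b = true → a = b

/-- Formal linear combinations of keys. -/
abbrev Lin (κ : Type) := List (GInt × κ)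

namespace Lin

variable {κ : Type} {A : Type*} [AddCommGroup A] [Module ℂ A]

/-- The value of a formal linear combination when the keys are interpreted in a vector space. -/
noncomputable def eval (f : κ → A) : Lin κ → A
  | [] => 0
  | t :: l => GInt.toC t.1 • f t.2 + eval f l

/-- Add a term, merging it with the term of the same key. -/
def ins [Key κ] (c : GInt) (k : κ) : Lin κ → Lin κ
  | [] => bif GInt.isZero c then [] else [(c, k)]
  | t :: l => bif Key.beq k t.2 then
      (bif GInt.isZero (GInt.add c t.1) then l else (GInt.add c t.1, k) :: l)
    else t :: ins c k l

/-- Collect terms. -/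
def norm [Key κ] : Lin κ → Lin κ
  | [] => []
  | t :: l => ins t.1 t.2 (norm l)

/-- Scalar multiple. -/
def scale (c : GInt) (l : Lin κ) : Lin κ := l.map fun t => (GInt.mul c t.1, t.2)

@[simp] lemma eval_nil (f : κ → A) : eval f [] = 0 := rfl
@[simp] lemma eval_cons (f : κ → A) (t : GInt × κ) (l : Lin κ) :
    eval f (t :: l) = GInt.toC t.1 • f t.2 + eval f l := rfl

@[simp] lemma eval_append (f : κ → A) (l m : Lin κ) : eval f (l ++ m) = eval f l + eval f m := by
  induction l with
  | nil => simp
  | cons t l ih => simp [ih, add_assoc]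

@[simp] lemma eval_scale (f : κ → A) (c : GInt) (l : Lin κ) :
    eval f (scale c l) = GInt.toC c • eval f l := by
  induction l with
  | nil => simp [scale]
  | cons t l ih =>
    simp only [scale, List.map_cons, eval_cons] at ih ⊢
    rw [ih, GInt.toC_mul, smul_add, mul_smul]

lemma eval_ins [Key κ] (f : κ → A) (c : GInt) (k : κ) (l : Lin κ) :
    eval f (ins c k l) = GInt.toC c • f k + eval f l := by
  induction l with
  | nil =>
    cases hz : GInt.isZero c
    · simp [ins, hz]
    · simp [ins, hz, GInt.toC_isZero hz]
  | cons t l ih =>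
    simp only [ins]
    cases h' : Key.beq k t.2
    · simp only [cond_false, eval_cons, ih]
      abel
    · have h := Key.eq_of_beq h'
      rw [cond_true]
      cases hz : GInt.isZero (GInt.add c t.1)
      · simp [GInt.toC_add, add_smul, add_assoc, h]
      · have h0 := GInt.toC_isZero hz
        rw [GInt.toC_add] at h0
        simp only [cond_true, eval_cons, h, ← add_assoc, ← add_smul, h0, zero_smul, zero_add]

lemma eval_norm [Key κ] (f : κ → A) (l : Lin κ) : eval f (norm l) = eval f l := by
  induction l with
  | nil => rfl
  | cons t l ih => simp [norm, eval_ins, ih]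

lemma eval_flatMap {β : Type} (f : κ → A) (g : β → Lin κ) (l : List β) :
    eval f (l.flatMap g) = (l.map fun b => eval f (g b)).sum := by
  induction l with
  | nil => rfl
  | cons t l ih => simp [ih]

lemma eval_eq_sum (f : κ → A) (l : Lin κ) :
    eval f l = (l.map fun t => GInt.toC t.1 • f t.2).sum := by
  induction l with
  | nil => rfl
  | cons t l ih => simp [ih]

lemma map_eval {B : Type*} [AddCommGroup B] [Module ℂ B] (φ : A →ₗ[ℂ] B) (f : κ → A) (l : Lin κ) :
    φ (eval f l) = eval (fun k => φ (f k)) l := by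
  induction l with
  | nil => simp
  | cons t l ih => simp [ih]

/-- Two formal combinations that agree after collecting terms. -/
def eqv [Key κ] (l m : Lin κ) : Bool := (norm (l ++ scale (-1, 0) m)).isEmpty

lemma eval_eq_of_eqv [Key κ] (f : κ → A) {l m : Lin κ} (h : eqv l m = true) :
    eval f l = eval f m := by
  have h1 := eval_norm f (l ++ scale (-1, 0) m)
  rw [List.isEmpty_iff.mp h] at h1
  simp only [eval_nil, eval_append, eval_scale] at h1
  have : GInt.toC (-1, 0) = -1 := by simp [GInt.toC]
  rw [this, neg_one_smul, ← sub_eq_add_neg] at h1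
  exact (sub_eq_zero.mp h1.symm)

end Lin

/-! ### Sparse polynomials and polynomial vector fields -/

/-- A monomial: the sorted list of the numbers of its variables. -/
abbrev Mono := List ℕ

namespace Mono

variable {R : Type*} [CommRing R]

/-- Equality test. -/
def beq : Mono → Mono → Bool
  | [], [] => true
  | u :: m, v :: k => bif Nat.beq u v then beq m k else false
  | [], _ :: _ => false
  | _ :: _, [] => false

lemma eq_of_beq : ∀ {m k : Mono}, beq m k = true → m = k
  | [], [], _ => rfl
  | u :: m, v :: k, h => by
    simp only [beq] at h
    cases huv : Nat.beq u v
    · simp [huv] at h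
    · rw [huv, cond_true] at h
      rw [eq_of_beq h, Nat.eq_of_beq_eq_true huv]
  | [], _ :: _, h => by simp [beq] at h
  | _ :: _, [], h => by simp [beq] at h

instance : Key Mono := ⟨beq, eq_of_beq⟩

instance : Key (Mono × ℕ) :=
  ⟨fun a b => bif Nat.beq a.2 b.2 then beq a.1 b.1 else false, fun {a b} h => by
    cases h2 : Nat.beq a.2 b.2
    · simp [h2] at h
    · rw [h2, cond_true] at h
      exact Prod.ext (eq_of_beq h) (Nat.eq_of_beq_eq_true h2)⟩

/-- Insert a variable in order. -/
def ins (v : ℕ) : Mono → Mono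
  | [] => [v]
  | u :: m => bif Nat.ble v u then v :: u :: m else u :: ins v m

/-- Product of monomials. -/
def mul (m k : Mono) : Mono := m.foldr ins k

/-- Value of a monomial. -/
def val (ν : ℕ → R) (m : Mono) : R := (m.map ν).prod

lemma val_ins (ν : ℕ → R) (v : ℕ) (m : Mono) : val ν (ins v m) = ν v * val ν m := by
  induction m with
  | nil => simp [ins, val]
  | cons u m ih =>
    simp only [ins]
    cases Nat.ble v u
    · simp only [val, cond_false, List.map_cons, List.prod_cons] at ih ⊢
      rw [ih]; ring
    · simp [val]

lemma val_mul (ν : ℕ → R) (m k : Mono) : val ν (mul m k) = val ν m * val ν k := by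
  induction m with
  | nil => simp [mul, val]
  | cons u m ih =>
    have : mul (u :: m) k = ins u (mul m k) := rfl
    rw [this, val_ins, ih]
    simp [val, mul_assoc]

/-- All ways to delete one occurrence of a variable. -/
def erasures (i : ℕ) : Mono → List (Mono)
  | [] => []
  | u :: m => bif Nat.beq (i % 16) (u % 16) then m :: (erasures i m).map (u :: ·)
      else (erasures i m).map (u :: ·)

end Mono

/-- Sparse polynomials. -/
abbrev SPoly := Lin (Mono)

namespace SPoly

variable {R : Type*} [CommRing R] [Algebra ℂ R]

/-- Value of a sparse polynomial. -/
noncomputable def val (ν : ℕ → R) (p : SPoly) : R := Lin.eval (Mono.val ν) p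

/-- Product of sparse polynomials. -/
def mul (p q : SPoly) : SPoly :=
  p.flatMap fun s => q.map fun t => (GInt.mul s.1 t.1, Mono.mul s.2 t.2)

lemma val_mul (ν : ℕ → R) (p q : SPoly) : val ν (mul p q) = val ν p * val ν q := by
  have key : ∀ s : GInt × Mono, Lin.eval (Mono.val ν)
      (q.map fun t => (GInt.mul s.1 t.1, Mono.mul s.2 t.2)) =
      (GInt.toC s.1 • Mono.val ν s.2) * val ν q := by
    intro s
    induction q with
    | nil => simp [val]
    | cons t q ih =>
      simp only [val, List.map_cons, Lin.eval_cons] at ih ⊢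
      rw [ih, Mono.val_mul, GInt.toC_mul]
      simp only [Algebra.smul_def, map_mul]; ring
  simp only [val, mul, Lin.eval_flatMap] at key ⊢
  simp only [key]
  induction p with
  | nil => simp
  | cons s p ih => rw [List.map_cons, List.sum_cons, ih, Lin.eval_cons, add_mul]

lemma val_add (ν : ℕ → R) (p q : SPoly) : val ν (p ++ q) = val ν p + val ν q :=
  Lin.eval_append _ _ _

lemma val_scale (ν : ℕ → R) (c : GInt) (p : SPoly) :
    val ν (Lin.scale c p) = GInt.toC c • val ν p := Lin.eval_scale _ _ _

end SPoly

/-- The coordinates numbered `0, …, 15`: first `z_8, z_1, …, z_7`, then `w_8, w_1, …, w_7`. -/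
def coord (n : ℕ) : Coord :=
  if h : n % 16 < 8 then .inl ⟨n % 16, h⟩ else .inr ⟨n % 16 - 8, by omega⟩

lemma coord_eq_iff {m n : ℕ} : coord m = coord n ↔ m % 16 = n % 16 := by
  unfold coord
  split_ifs with h h' h' <;> simp <;> omega

/-- The number of `z_j`. -/
def zi (j : Fin 8) : ℕ := j.val

/-- The number of `w_j`. -/
def wi (j : Fin 8) : ℕ := j.val + 8

lemma coord_zi (j : Fin 8) : coord (zi j) = .inl j := by revert j; decide
lemma coord_wi (j : Fin 8) : coord (wi j) = .inr j := by revert j; decide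

/-- Sparse polynomial vector fields; the key `(m, i)` stands for the monomial `m` times the
`i`-th coordinate field. -/
abbrev SField := Lin (Mono × ℕ)

/-- The polynomial variables in the numbering `coord`. -/
noncomputable def var (v : ℕ) : MvPolynomial Coord ℂ := .X (coord v)

namespace SField

/-- The vector field of a key. -/
noncomputable def keyField (k : Mono × ℕ) : PolyField :=
  Pi.single (coord k.2) (Mono.val var k.1)

/-- The vector field represented by the data. -/
noncomputable def val (F : SField) : PolyField := Lin.eval keyField F

/-- A polynomial multiple of a coordinate field. -/
def ofPoly (p : SPoly) (i : ℕ) : SField := p.map fun t => (t.1, (t.2, i))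

lemma val_ofPoly (p : SPoly) (i : ℕ) :
    val (ofPoly p i) = SPoly.val var p • Pi.single (coord i) 1 := by
  induction p with
  | nil => simp [val, ofPoly, SPoly.val]
  | cons t p ih =>
    simp only [val, ofPoly, SPoly.val, List.map_cons, Lin.eval_cons] at ih ⊢
    rw [ih, add_smul]
    congr 1
    simp only [keyField, ← Pi.single_smul, smul_eq_mul, mul_one]

/-- A component of a sparse vector field. -/
def comp (F : SField) (i : ℕ) : SPoly :=
  F.filterMap fun t => bif Nat.beq (t.2.2 % 16) (i % 16) then some (t.1, t.2.1) else none

lemma val_comp (F : SField) (i : ℕ) : SPoly.val var (comp F i) = val F (coord i) := by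
  induction F with
  | nil => simp [comp, val, SPoly.val]
  | cons t F ih =>
    simp only [val, Lin.eval_cons, SPoly.val, comp, List.filterMap_cons] at ih ⊢
    rcases h : Nat.beq (t.2.2 % 16) (i % 16) with _ | _
    · have hne : coord i ≠ coord t.2.2 := fun e => by
        have := coord_eq_iff.mp e
        simp [this] at h
      simp [ih, keyField, Pi.single_eq_of_ne hne]
    · have he : coord t.2.2 = coord i := coord_eq_iff.mpr (Nat.eq_of_beq_eq_true h)
      simp [ih, keyField, he]

end SField

/-! ### The bracket of polynomial vector fields -/

open MvPolynomial in
/-- The bracket of vector fields with polynomial coefficients. -/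
noncomputable def polyBracket (F G : PolyField) : PolyField := fun i =>
  ∑ j, (F j * pderiv j (G i) - G j * pderiv j (F i))

lemma polyBracket_add_left (F F' G : PolyField) :
    polyBracket (F + F') G = polyBracket F G + polyBracket F' G := by
  funext i
  simp only [polyBracket, Pi.add_apply, ← Finset.sum_add_distrib, map_add]
  refine Finset.sum_congr rfl fun j _ => by ring

lemma polyBracket_add_right (F G G' : PolyField) :
    polyBracket F (G + G') = polyBracket F G + polyBracket F G' := by
  funext i
  simp only [polyBracket, Pi.add_apply, ← Finset.sum_add_distrib, map_add]
  refine Finset.sum_congr rfl fun j _ => by ring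

lemma polyBracket_smul_left (c : ℂ) (F G : PolyField) :
    polyBracket (c • F) G = c • polyBracket F G := by
  funext i
  simp only [polyBracket, Pi.smul_apply, Finset.smul_sum]
  refine Finset.sum_congr rfl fun j _ => by
    rw [Derivation.map_smul]
    simp only [MvPolynomial.smul_eq_C_mul]; ring

lemma polyBracket_smul_right (c : ℂ) (F G : PolyField) :
    polyBracket F (c • G) = c • polyBracket F G := by
  funext i
  simp only [polyBracket, Pi.smul_apply, Finset.smul_sum]
  refine Finset.sum_congr rfl fun j _ => by
    rw [Derivation.map_smul]
    simp only [MvPolynomial.smul_eq_C_mul]; ring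

/-- The bracket as a bilinear map. -/
noncomputable def polyBracketBilin : PolyField →ₗ[ℂ] PolyField →ₗ[ℂ] PolyField :=
  LinearMap.mk₂ ℂ polyBracket polyBracket_add_left polyBracket_smul_left polyBracket_add_right
    polyBracket_smul_right

lemma polyBracket_single (i j : Coord) (p q : MvPolynomial Coord ℂ) :
    polyBracket (Pi.single i p) (Pi.single j q) =
      Pi.single j (p * MvPolynomial.pderiv i q) - Pi.single i (q * MvPolynomial.pderiv j p) := by
  funext k
  simp only [polyBracket, Finset.sum_sub_distrib, Pi.sub_apply]
  congr 1
  · rw [Finset.sum_eq_single i]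
    · by_cases h : k = j
      · subst h; simp
      · simp [Pi.single_eq_of_ne h]
    · intro b _ hb; simp [Pi.single_eq_of_ne hb]
    · simp
  · rw [Finset.sum_eq_single j]
    · by_cases h : k = i
      · subst h; simp
      · simp [Pi.single_eq_of_ne h]
    · intro b _ hb; simp [Pi.single_eq_of_ne hb]
    · simp

lemma pderiv_mono (i : ℕ) (m : Mono) :
    MvPolynomial.pderiv (coord i) (Mono.val var m) =
      ((Mono.erasures i m).map (Mono.val var)).sum := by
  induction m with
  | nil => simp [Mono.val, Mono.erasures]
  | cons u m ih =>
    have h1 : Mono.val var (u :: m) = var u * Mono.val var m := by simp [Mono.val]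
    have h2 : (((Mono.erasures i m).map (u :: ·)).map (Mono.val var)).sum =
        var u * ((Mono.erasures i m).map (Mono.val var)).sum := by
      rw [List.map_map, ← List.sum_map_mul_left]
      simp [Function.comp_def, Mono.val]
    rw [h1, Derivation.leibniz, ih, smul_eq_mul, smul_eq_mul]
    simp only [Mono.erasures]
    rcases h : Nat.beq (i % 16) (u % 16) with _ | _
    · have hne : coord u ≠ coord i := fun e => by
        have := coord_eq_iff.mp e
        simp [this] at h
      simp only [cond_false, h2]
      simp [var, MvPolynomial.pderiv_X_of_ne hne]
    · have he : coord i = coord u := coord_eq_iff.mpr (Nat.eq_of_beq_eq_true h)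
      simp only [cond_true, List.map_cons, List.sum_cons, h2]
      simp [var, he, add_comm]

namespace SField

/-- The bracket of two sparse vector fields. -/
def br (F G : SField) : SField :=
  F.flatMap fun s => G.flatMap fun t =>
    ((Mono.erasures s.2.2 t.2.1).map fun m => (GInt.mul s.1 t.1, (Mono.mul s.2.1 m, t.2.2))) ++
    ((Mono.erasures t.2.2 s.2.1).map fun m =>
      (GInt.neg (GInt.mul s.1 t.1), (Mono.mul t.2.1 m, s.2.2)))

lemma eval_erasures (c : GInt) (m : Mono) (l : List (Mono)) (i : ℕ) :
    Lin.eval keyField (l.map fun k => (c, (Mono.mul m k, i))) =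
      GInt.toC c • Pi.single (coord i) (Mono.val var m * (l.map (Mono.val var)).sum) := by
  induction l with
  | nil => simp
  | cons k l ih =>
    simp only [List.map_cons, Lin.eval_cons, ih, keyField, Mono.val_mul, List.sum_cons, mul_add,
      Pi.single_add, smul_add]

lemma val_br (F G : SField) : val (br F G) = polyBracket (val F) (val G) := by
  have key : ∀ s t : GInt × (Mono × ℕ), Lin.eval keyField
      (((Mono.erasures s.2.2 t.2.1).map fun m => (GInt.mul s.1 t.1, (Mono.mul s.2.1 m, t.2.2))) ++
      ((Mono.erasures t.2.2 s.2.1).map fun m =>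
        (GInt.neg (GInt.mul s.1 t.1), (Mono.mul t.2.1 m, s.2.2)))) =
      polyBracketBilin (GInt.toC s.1 • keyField s.2) (GInt.toC t.1 • keyField t.2) := by
    intro s t
    rw [Lin.eval_append, eval_erasures, eval_erasures, map_smul, map_smul, LinearMap.smul_apply]
    simp only [polyBracketBilin, LinearMap.mk₂_apply, keyField, polyBracket_single, pderiv_mono,
      GInt.toC_neg, GInt.toC_mul, neg_smul, mul_smul]
    rw [smul_comm (GInt.toC s.1), smul_comm (GInt.toC s.1), ← sub_eq_add_neg, ← smul_sub,
      ← smul_sub]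
  change Lin.eval keyField _ = polyBracketBilin (Lin.eval keyField F) (Lin.eval keyField G)
  simp only [br, Lin.eval_flatMap, key]
  induction F with
  | nil => simp
  | cons s F ih =>
    rw [List.map_cons, List.sum_cons, ih, Lin.eval_cons, map_add, LinearMap.add_apply]
    congr 1
    rw [Lin.map_eval, Lin.eval_eq_sum]
    refine congrArg List.sum (List.map_congr_left fun t _ => ?_)
    rw [map_smul]

end SField

end CREII

namespace CREII

/-! ### Sparse data of the listed generators -/

/-- Sparse data for a polynomial, found by instance resolution along its syntax. -/
class PolyData (p : MvPolynomial Coord ℂ) where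
  data : SPoly
  eq : SPoly.val var data = p

namespace PolyData

variable {p q : MvPolynomial Coord ℂ}

instance (j : Fin 8) : PolyData (z j) :=
  ⟨[((1, 0), [zi j])], by simp [SPoly.val, GInt.toC, Mono.val, var, coord_zi, z]⟩

instance (j : Fin 8) : PolyData (w j) :=
  ⟨[((1, 0), [wi j])], by simp [SPoly.val, GInt.toC, Mono.val, var, coord_wi, w]⟩

instance : PolyData 2 := ⟨[((2, 0), [])], by
  simp [SPoly.val, GInt.toC, Mono.val, MvPolynomial.smul_eq_C_mul]; rfl⟩

instance : PolyData 4 := ⟨[((4, 0), [])], by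
  simp [SPoly.val, GInt.toC, Mono.val, MvPolynomial.smul_eq_C_mul]; rfl⟩

lemma toC_neg_one : GInt.toC (-1, 0) = -1 := by simp [GInt.toC]

instance [hp : PolyData p] : PolyData (-p) := ⟨Lin.scale (-1, 0) hp.data, by
  rw [SPoly.val_scale, hp.eq, toC_neg_one, neg_one_smul]⟩

instance [hp : PolyData p] [hq : PolyData q] : PolyData (p + q) := ⟨hp.data ++ hq.data, by
  rw [SPoly.val_add, hp.eq, hq.eq]⟩

instance [hp : PolyData p] [hq : PolyData q] : PolyData (p - q) :=
  ⟨hp.data ++ Lin.scale (-1, 0) hq.data, by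
    rw [SPoly.val_add, SPoly.val_scale, hp.eq, hq.eq, toC_neg_one, neg_one_smul, sub_eq_add_neg]⟩

instance [hp : PolyData p] [hq : PolyData q] : PolyData (p * q) :=
  ⟨SPoly.mul hp.data hq.data, by rw [SPoly.val_mul, hp.eq, hq.eq]⟩

instance [hp : PolyData p] : PolyData (p ^ 2) :=
  ⟨SPoly.mul hp.data hp.data, by rw [SPoly.val_mul, hp.eq, sq]⟩

end PolyData

/-- Sparse data for a polynomial vector field, found by instance resolution along its syntax. -/
class FieldData (F : PolyField) where
  data : SField
  eq : SField.val data = F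

namespace FieldData

variable {p : MvPolynomial Coord ℂ} {F G : PolyField}

instance (j : Fin 8) : FieldData (dz j) :=
  ⟨[((1, 0), ([], zi j))], by simp [SField.val, SField.keyField, GInt.toC, Mono.val, coord_zi, dz]⟩

instance (j : Fin 8) : FieldData (dw j) :=
  ⟨[((1, 0), ([], wi j))], by simp [SField.val, SField.keyField, GInt.toC, Mono.val, coord_wi, dw]⟩

instance (j : Fin 8) [hp : PolyData p] : FieldData (p • dz j) :=
  ⟨SField.ofPoly hp.data (zi j), by rw [SField.val_ofPoly, hp.eq, coord_zi, dz]⟩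

instance (j : Fin 8) [hp : PolyData p] : FieldData (p • dw j) :=
  ⟨SField.ofPoly hp.data (wi j), by rw [SField.val_ofPoly, hp.eq, coord_wi, dw]⟩

instance [hF : FieldData F] : FieldData (Complex.I • F) := ⟨Lin.scale (0, 1) hF.data, by
  rw [SField.val, Lin.eval_scale, ← SField.val, hF.eq]; simp [GInt.toC]⟩

instance [hF : FieldData F] [hG : FieldData G] : FieldData (F + G) := ⟨hF.data ++ hG.data, by
  rw [SField.val, Lin.eval_append, ← SField.val, ← SField.val, hF.eq, hG.eq]⟩

instance [hF : FieldData F] [hG : FieldData G] : FieldData (F - G) :=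
  ⟨hF.data ++ Lin.scale (-1, 0) hG.data, by
    rw [SField.val, Lin.eval_append, Lin.eval_scale, ← SField.val, ← SField.val, hF.eq, hG.eq,
      PolyData.toC_neg_one, neg_one_smul, sub_eq_add_neg]⟩

end FieldData

/-- Sparse data for a finite family of polynomial vector fields. -/
class FamilyData {n : ℕ} (F : Fin n → PolyField) where
  data : List SField
  eq : data.map SField.val = List.ofFn F

namespace FamilyData

instance (F : Fin 0 → PolyField) : FamilyData F := ⟨[], by simp⟩

instance {n : ℕ} (F : PolyField) (Fs : Fin n → PolyField) [hF : FieldData F]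
    [hFs : FamilyData Fs] : FamilyData (Matrix.vecCons F Fs) :=
  ⟨hF.data :: hFs.data, by
    rw [List.map_cons, hF.eq, hFs.eq, List.ofFn_succ]; rfl⟩

set_option synthInstance.maxHeartbeats 400000
set_option synthInstance.maxSize 4000

noncomputable instance : FamilyData genNegTwo := by delta genNegTwo; infer_instance
noncomputable instance : FamilyData genNegOne := by delta genNegOne; infer_instance
noncomputable instance : FamilyData genZero := by delta genZero; infer_instance
noncomputable instance : FamilyData genOne := by delta genOne; infer_instance
noncomputable instance : FamilyData genTwo := by delta genTwo; infer_instance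

end FamilyData

/-- Sparse data of all 78 generators in the listed order. -/
noncomputable def genData : List SField :=
  FamilyData.data genNegTwo ++ FamilyData.data genNegOne ++ FamilyData.data genZero ++
    FamilyData.data genOne ++ FamilyData.data genTwo

end CREII

namespace CREII

/-! ### Polynomial vector fields as holomorphic vector fields -/

open MvPolynomial in
lemma hasFDerivAt_eval (P : MvPolynomial Coord ℂ) (p : Space) :
    HasFDerivAt (fun q : Space => eval q P)
      (∑ j, eval p (pderiv j P) • ContinuousLinearMap.proj (R := ℂ) (φ := fun _ : Coord => ℂ) j) p := by
  induction P using MvPolynomial.induction_on with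
  | C a =>
    simp only [eval_C]
    refine (hasFDerivAt_const (𝕜 := ℂ) a p).congr_fderiv ?_
    refine ContinuousLinearMap.ext fun v => ?_
    simp
  | add P Q hP hQ =>
    simp only [map_add]
    refine (hP.add hQ).congr_fderiv ?_
    refine ContinuousLinearMap.ext fun v => ?_
    simp only [sum_apply, add_apply, smul_apply, ContinuousLinearMap.proj_apply,
      smul_eq_mul, add_mul, Finset.sum_add_distrib]
  | mul_X P i hP =>
    simp only [map_mul, eval_X]
    have hX : HasFDerivAt (fun q : Space => q i)
        (ContinuousLinearMap.proj (R := ℂ) (φ := fun _ : Coord => ℂ) i) p :=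
      (ContinuousLinearMap.proj (R := ℂ) (φ := fun _ : Coord => ℂ) i).hasFDerivAt
    refine (hP.mul hX).congr_fderiv ?_
    refine ContinuousLinearMap.ext fun v => ?_
    simp only [Derivation.leibniz, smul_eq_mul, map_add, map_mul, eval_X, pderiv_X,
      add_apply, smul_apply, sum_apply, ContinuousLinearMap.proj_apply, add_mul,
      Finset.sum_add_distrib, Finset.mul_sum]
    congr 1
    · rw [Finset.sum_eq_single i]
      · simp
      · intro b _ hb
        simp [Pi.single_eq_of_ne hb.symm]
      · simp
    · exact Finset.sum_congr rfl fun j _ => by ring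

namespace PolyField

variable {U : TopologicalSpace.Opens Space}

/-- The derivative of a polynomial map. -/
noncomputable def deriv (F : PolyField) (p : Space) : Space →L[ℂ] Space :=
  ContinuousLinearMap.pi fun i => ∑ j, MvPolynomial.eval p (MvPolynomial.pderiv j (F i)) •
    ContinuousLinearMap.proj (R := ℂ) (φ := fun _ : Coord => ℂ) j

lemma deriv_apply (F : PolyField) (p v : Space) (i : Coord) :
    deriv F p v i = ∑ j, MvPolynomial.eval p (MvPolynomial.pderiv j (F i)) * v j := by
  simp [deriv]

lemma hasFDerivAt (F : PolyField) (p : Space) :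
    HasFDerivAt (fun (q : Space) (i : Coord) => MvPolynomial.eval q (F i)) (deriv F p) p :=
  hasFDerivAt_pi.mpr fun i => hasFDerivAt_eval (F i) p

lemma restrict_apply (F : PolyField) {p : Space} (hp : p ∈ U) :
    (restrict U F : Space → Space) p = fun i => MvPolynomial.eval p (F i) :=
  Set.indicator_of_mem (s := (U : Set Space)) hp
    fun (q : Space) (i : Coord) => MvPolynomial.eval q (F i)

lemma restrict_eventuallyEq (F : PolyField) {p : Space} (hp : p ∈ U) :
    (restrict U F : Space → Space) =ᶠ[nhds p] fun q i => MvPolynomial.eval q (F i) := by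
  filter_upwards [U.isOpen.mem_nhds hp] with q hq using restrict_apply F hq

lemma hasFDerivAt_restrict (F : PolyField) {p : Space} (hp : p ∈ U) :
    HasFDerivAt (restrict U F : Space → Space) (deriv F p) p :=
  (hasFDerivAt F p).congr_of_eventuallyEq (restrict_eventuallyEq F hp)

lemma restrict_bracket (F G : PolyField) :
    restrict U (polyBracket F G) = ⁅restrict U F, restrict U G⁆ := by
  refine HolField.ext' fun p hp => ?_
  rw [coe_bracket, VectorField.lieBracket, (hasFDerivAt_restrict F hp).fderiv,
    (hasFDerivAt_restrict G hp).fderiv, restrict_apply _ hp, restrict_apply _ hp,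
    restrict_apply _ hp]
  funext i
  simp only [polyBracket, Pi.sub_apply, deriv_apply, map_sum, map_sub, map_mul,
    Finset.sum_sub_distrib]
  simp only [mul_comm]

/-- A polynomial vector field is determined by its restriction to a nonempty open set. -/
lemma restrict_injective (hU : (U : Set Space).Nonempty) :
    Function.Injective (restrict U) := by
  rw [injective_iff_map_eq_zero]
  intro F hF
  obtain ⟨p, hp⟩ := hU
  funext i
  have hev : (fun q : Space => MvPolynomial.eval q (F i)) =ᶠ[nhds p] fun _ => 0 := by
    filter_upwards [U.isOpen.mem_nhds hp] with q hq
    have := congrFun (restrict_apply (U := U) F hq) i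
    rw [hF] at this
    simpa using this.symm
  have h0 := AnalyticOnNhd.eq_of_eventuallyEq
    (AnalyticOnNhd.eval_mvPolynomial (F i)) analyticOnNhd_const hev
  refine MvPolynomial.funext fun q => ?_
  simpa using congrFun h0 q

end PolyField

/-- Two holomorphic fields on a connected open set that agree near one of its points are equal. -/
lemma HolField.eq_of_eventuallyEq {U : TopologicalSpace.Opens Space}
    (hU : IsConnected (U : Set Space)) {X Y : HolField U} {p : Space} (hp : p ∈ U)
    (h : (X : Space → Space) =ᶠ[nhds p] (Y : Space → Space)) : X = Y :=
  HolField.ext' fun _ hq => X.2.1.eqOn_of_preconnected_of_eventuallyEq Y.2.1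
    hU.isPreconnected hp h hq

/-! ### The generators as a sequence -/

/-- The position of a generator in the list. -/
def genNum : Fin 8 ⊕ Fin 16 ⊕ Fin 30 ⊕ Fin 16 ⊕ Fin 8 → ℕ :=
  Sum.elim (fun i => i) <| Sum.elim (fun i => 8 + i) <| Sum.elim (fun i => 24 + i) <|
    Sum.elim (fun i => 54 + i) fun i => 70 + i

/-- The `k`-th generator, counted from `0`, and zero for `k ≥ 78`. -/
noncomputable def gen (k : ℕ) : PolyField := SField.val (genData.getD k [])

lemma getD_familyData {n : ℕ} (F : Fin n → PolyField) [hF : FamilyData F] (i : Fin n)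
    (l : List SField) : SField.val ((hF.data ++ l).getD i []) = F i := by
  have hlen : hF.data.length = n := by
    have := congrArg List.length hF.eq
    simpa using this
  have hi : i.val < hF.data.length := by rw [hlen]; exact i.2
  rw [List.getD_append _ _ _ _ hi, List.getD_eq_getElem _ _ hi]
  have h := congrArg (fun l => l[i.val]?) hF.eq
  simp only [List.getElem?_map, List.getElem?_eq_getElem hi, Option.map_some,
    List.getElem?_ofFn, i.2, dite_true, Option.some.injEq] at h
  exact h

lemma length_familyData {n : ℕ} (F : Fin n → PolyField) [hF : FamilyData F] :
    hF.data.length = n := by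
  simpa using congrArg List.length hF.eq

lemma gen_genNum (i : Fin 8 ⊕ Fin 16 ⊕ Fin 30 ⊕ Fin 16 ⊕ Fin 8) :
    gen (genNum i) = generator i := by
  have h1 := length_familyData genNegTwo
  have h2 := length_familyData genNegOne
  have h3 := length_familyData genZero
  have h4 := length_familyData genOne
  have hskip : ∀ (l m : List SField) (n k : ℕ), l.length = n →
      (l ++ m).getD (n + k) [] = m.getD k [] := by
    intro l m n k h
    rw [List.getD_append_right _ _ _ _ (by omega)]
    congr 1; omega
  unfold gen genData
  simp only [List.append_assoc]
  rcases i with i | i | i | i | i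
  · exact getD_familyData genNegTwo i _
  · have : genNum (.inr (.inl i)) = 8 + i := rfl
    rw [this, hskip _ _ _ _ h1]
    exact getD_familyData genNegOne i _
  · have : genNum (.inr (.inr (.inl i))) = 8 + (16 + i) := by
      change 24 + (i : ℕ) = _; omega
    rw [this, hskip _ _ _ _ h1, hskip _ _ _ _ h2]
    exact getD_familyData genZero i _
  · have : genNum (.inr (.inr (.inr (.inl i)))) = 8 + (16 + (30 + i)) := by
      change 54 + (i : ℕ) = _; omega
    rw [this, hskip _ _ _ _ h1, hskip _ _ _ _ h2, hskip _ _ _ _ h3]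
    exact getD_familyData genOne i _
  · have : genNum (.inr (.inr (.inr (.inr i)))) = 8 + (16 + (30 + (16 + i))) := by
      change 70 + (i : ℕ) = _; omega
    rw [this, hskip _ _ _ _ h1, hskip _ _ _ _ h2, hskip _ _ _ _ h3, hskip _ _ _ _ h4]
    change _ = genTwo i
    rw [← getD_familyData genTwo i [], List.append_nil]

lemma genNum_injective : Function.Injective genNum := by
  rintro (i | i | i | i | i) (j | j | j | j | j) h <;>
    simp only [genNum, Sum.elim_inl, Sum.elim_inr] at h <;>
    first
      | (exfalso; omega)
      | (have : i = j := Fin.ext (by omega)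
         rw [this])

lemma exists_genNum {k : ℕ} (hk : k < 78) : ∃ i, genNum i = k := by
  by_cases h1 : k < 8
  · exact ⟨.inl ⟨k, h1⟩, rfl⟩
  by_cases h2 : k < 24
  · exact ⟨.inr (.inl ⟨k - 8, by omega⟩), by simp only [genNum, Sum.elim_inl, Sum.elim_inr]; omega⟩
  by_cases h3 : k < 54
  · exact ⟨.inr (.inr (.inl ⟨k - 24, by omega⟩)), by
      simp only [genNum, Sum.elim_inl, Sum.elim_inr]; omega⟩
  by_cases h4 : k < 70
  · exact ⟨.inr (.inr (.inr (.inl ⟨k - 54, by omega⟩))), by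
      simp only [genNum, Sum.elim_inl, Sum.elim_inr]; omega⟩
  · exact ⟨.inr (.inr (.inr (.inr ⟨k - 70, by omega⟩))), by
      simp only [genNum, Sum.elim_inr]; omega⟩

lemma genNum_lt (i : Fin 8 ⊕ Fin 16 ⊕ Fin 30 ⊕ Fin 16 ⊕ Fin 8) : genNum i < 78 := by
  rcases i with i | i | i | i | i <;> simp only [genNum, Sum.elim_inl, Sum.elim_inr] <;> omega

/-- Formal combinations of generators, as sparse vector fields. -/
noncomputable def combData (c : Lin ℕ) : SField :=
  Lin.norm (c.flatMap fun t => Lin.scale t.1 (genData.getD t.2 []))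

lemma val_combData (c : Lin ℕ) : SField.val (combData c) = Lin.eval gen c := by
  rw [SField.val, combData, Lin.eval_norm, Lin.eval_flatMap, Lin.eval_eq_sum]
  simp only [Lin.eval_scale]
  rfl

lemma polyBracket_eval_gen {a b c : Lin ℕ}
    (h : Lin.eqv (SField.br (combData a) (combData b)) (combData c) = true) :
    polyBracket (Lin.eval gen a) (Lin.eval gen b) = Lin.eval gen c := by
  rw [← val_combData, ← val_combData, ← val_combData, ← SField.val_br]
  exact Lin.eval_eq_of_eqv _ h

end CREII

namespace CREII

/-! ### The root decomposition -/

/-- The roots, as tuples of integers, with root vectors written in the listed generators (numbered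
from `0`). The first six are the simple roots, the first 36 the positive ones, and the negative
of root `r` is root `r + 36`. -/
def rootTab : List (List ℤ × Lin ℕ) := [
  ([0, -1, 0, 0, 0, -1], [((1, 0), 8), ((0, -1), 16)]),
  ([0, 0, 1, 0, -1, 0], [((1, 0), 56), ((0, -1), 64)]),
  ([-1, 1, -1, 0, 0, 0], [((1, 0), 6)]),
  ([1, -1, 0, 1, 0, 0], [((1, 0), 77)]),
  ([0, 0, 1, 0, 1, 0], [((1, 0), 56), ((0, 1), 64)]),
  ([0, -1, 0, 0, 0, 1], [((1, 0), 8), ((0, 1), 16)]),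
  ([0, -1, 1, 0, 1, -1], [((1, 0), 25), ((0, -1), 39)]),
  ([-1, 1, 0, 0, -1, 0], [((1, 0), 15), ((0, -1), 23)]),
  ([0, 0, -1, 1, 0, 0], [((1, 0), 34)]),
  ([-1, 1, 0, 0, 1, 0], [((1, 0), 15), ((0, 1), 23)]),
  ([0, -1, 1, 0, -1, 1], [((1, 0), 25), ((0, 1), 39)]),
  ([-1, 0, 0, 0, 1, -1], [((1, 0), 1), ((0, 1), 5)]),
  ([0, 0, 0, 1, -1, 0], [((1, 0), 58), ((0, 1), 66)]),
  ([-1, 1, 1, 0, 0, 0], [((1, 0), 51)]),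
  ([0, 0, 0, 1, 1, 0], [((1, 0), 58), ((0, -1), 66)]),
  ([-1, 0, 0, 0, -1, 1], [((1, 0), 1), ((0, -1), 5)]),
  ([-1, 0, 1, 0, 0, -1], [((1, 0), 13), ((0, -1), 21)]),
  ([0, -1, 0, 1, 1, -1], [((1, 0), 24), ((0, 1), 38)]),
  ([0, 0, 1, 1, 0, 0], [((1, 0), 70)]),
  ([0, -1, 0, 1, -1, 1], [((1, 0), 24), ((0, -1), 38)]),
  ([-1, 0, 1, 0, 0, 1], [((1, 0), 13), ((0, 1), 21)]),
  ([0, -1, 1, 1, 0, -1], [((1, 0), 60), ((0, -1), 68)]),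
  ([-1, -1, 1, 0, 0, 0], [((1, 0), 4)]),
  ([-1, 1, 0, 1, 0, 0], [((1, 0), 52)]),
  ([0, -1, 1, 1, 0, 1], [((1, 0), 60), ((0, 1), 68)]),
  ([-1, 0, 0, 1, 0, -1], [((1, 0), 11), ((0, -1), 19)]),
  ([0, -2, 1, 1, 0, 0], [((1, 0), 32)]),
  ([-1, 0, 0, 1, 0, 1], [((1, 0), 11), ((0, 1), 19)]),
  ([-1, 0, 1, 1, 1, -1], [((1, 0), 28), ((0, 1), 53)]),
  ([-1, -1, 0, 1, 0, 0], [((1, 0), 3)]),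
  ([-1, 0, 1, 1, -1, 1], [((1, 0), 28), ((0, -1), 53)]),
  ([-1, -1, 1, 1, -1, 0], [((1, 0), 9), ((0, -1), 17)]),
  ([-1, -1, 1, 1, 1, 0], [((1, 0), 9), ((0, 1), 17)]),
  ([-1, -1, 2, 1, 0, 0], [((1, 0), 47)]),
  ([-2, 0, 1, 1, 0, 0], [((1, 0), 2)]),
  ([-1, -1, 1, 2, 0, 0], [((1, 0), 43)]),
  ([0, 1, 0, 0, 0, 1], [((1, 0), 54), ((0, -1), 62)]),
  ([0, 0, -1, 0, 1, 0], [((1, 0), 10), ((0, 1), 18)]),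
  ([1, -1, 1, 0, 0, 0], [((1, 0), 76)]),
  ([-1, 1, 0, -1, 0, 0], [((1, 0), 7)]),
  ([0, 0, -1, 0, -1, 0], [((1, 0), 10), ((0, -1), 18)]),
  ([0, 1, 0, 0, 0, -1], [((1, 0), 54), ((0, 1), 62)]),
  ([0, 1, -1, 0, -1, 1], [((1, 0), 29), ((0, 1), 40)]),
  ([1, -1, 0, 0, 1, 0], [((1, 0), 61), ((0, -1), 69)]),
  ([0, 0, 1, -1, 0, 0], [((1, 0), 36)]),
  ([1, -1, 0, 0, -1, 0], [((1, 0), 61), ((0, 1), 69)]),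
  ([0, 1, -1, 0, 1, -1], [((1, 0), 29), ((0, -1), 40)]),
  ([1, 0, 0, 0, -1, 1], [((1, 0), 71), ((0, 1), 75)]),
  ([0, 0, 0, -1, 1, 0], [((1, 0), 12), ((0, 1), 20)]),
  ([1, -1, -1, 0, 0, 0], [((1, 0), 42)]),
  ([0, 0, 0, -1, -1, 0], [((1, 0), 12), ((0, -1), 20)]),
  ([1, 0, 0, 0, 1, -1], [((1, 0), 71), ((0, -1), 75)]),
  ([1, 0, -1, 0, 0, 1], [((1, 0), 59), ((0, 1), 67)]),
  ([0, 1, 0, -1, -1, 1], [((1, 0), 30), ((0, 1), 41)]),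
  ([0, 0, -1, -1, 0, 0], [((1, 0), 0)]),
  ([0, 1, 0, -1, 1, -1], [((1, 0), 30), ((0, -1), 41)]),
  ([1, 0, -1, 0, 0, -1], [((1, 0), 59), ((0, -1), 67)]),
  ([0, 1, -1, -1, 0, 1], [((1, 0), 14), ((0, 1), 22)]),
  ([1, 1, -1, 0, 0, 0], [((1, 0), 74)]),
  ([1, -1, 0, -1, 0, 0], [((1, 0), 45)]),
  ([0, 1, -1, -1, 0, -1], [((1, 0), 14), ((0, -1), 22)]),
  ([1, 0, 0, -1, 0, 1], [((1, 0), 57), ((0, -1), 65)]),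
  ([0, 2, -1, -1, 0, 0], [((1, 0), 37)]),
  ([1, 0, 0, -1, 0, -1], [((1, 0), 57), ((0, 1), 65)]),
  ([1, 0, -1, -1, -1, 1], [((1, 0), 26), ((0, 1), 50)]),
  ([1, 1, 0, -1, 0, 0], [((1, 0), 73)]),
  ([1, 0, -1, -1, 1, -1], [((1, 0), 26), ((0, -1), 50)]),
  ([1, 1, -1, -1, 1, 0], [((1, 0), 55), ((0, 1), 63)]),
  ([1, 1, -1, -1, -1, 0], [((1, 0), 55), ((0, -1), 63)]),
  ([1, 1, -2, -1, 0, 0], [((1, 0), 49)]),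
  ([2, 0, -1, -1, 0, 0], [((1, 0), 72)]),
  ([1, 1, -1, -2, 0, 0], [((1, 0), 48)])]

/-- The root vectors. -/
def rootVec (r : ℕ) : Lin ℕ := (rootTab.getD r ([], [])).2

/-- The value of root `r` on the `j`-th element of `torusVec`. -/
def rootWt (r j : ℕ) : ℤ := (rootTab.getD r ([], [])).1.getD j 0

/-- A basis of a split Cartan subalgebra of the complexification on which the roots are integral. -/
def torusVec (j : ℕ) : Lin ℕ :=
  [[((1, 0), 27)], [((1, 0), 31)], [((1, 0), 33)], [((1, 0), 35)], [((0, -1), 44)],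
    [((0, -1), 46)]].getD j []

/-- The brackets of opposite root vectors, in the basis `torusVec`. -/
def oppTab : List (List ℤ) := [
  [4, 8, 4, 4, 4, 8],
  [4, 4, 8, 0, -8, -4],
  [-4, 0, -4, 0, 0, 0],
  [4, 0, 0, 4, 0, 0],
  [4, 4, 8, 0, 8, 4],
  [4, 8, 4, 4, -4, -8],
  [0, 2, -2, 2, -2, 2],
  [4, -4, 0, 0, 8, 4],
  [0, 0, -1, 1, 0, 0],
  [4, -4, 0, 0, -8, -4],
  [0, 2, -2, 2, 2, -2],
  [-4, -2, -2, -2, 2, -2],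
  [-4, -4, 0, -8, 8, 4],
  [0, -1, -1, 0, 0, 0],
  [-4, -4, 0, -8, -8, -4],
  [-4, -2, -2, -2, -2, 2],
  [-4, 0, 4, -4, -4, -8],
  [0, -2, -2, 2, 2, -2],
  [-4, -4, -4, -4, 0, 0],
  [0, -2, -2, 2, -2, 2],
  [-4, 0, 4, -4, 4, 8],
  [4, 0, 4, 4, -4, -8],
  [-4, -4, 0, -4, 0, 0],
  [0, -1, 0, -1, 0, 0],
  [4, 0, 4, 4, 4, 8],
  [4, 0, 4, -4, 4, 8],
  [0, -1, 0, 0, 0, 0],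
  [4, 0, 4, -4, -4, -8],
  [0, 2, 2, 2, 2, -2],
  [-4, -4, -4, 0, 0, 0],
  [0, 2, 2, 2, -2, 2],
  [-4, -4, 0, 0, -8, -4],
  [-4, -4, 0, 0, 8, 4],
  [0, 0, -1, 0, 0, 0],
  [4, 0, 0, 0, 0, 0],
  [0, 0, 0, -1, 0, 0]]

/-- The `j`-th coordinate of the bracket of the root vectors numbered `r` and `r + 36`. -/
def oppCoef (r j : ℕ) : ℤ := (oppTab.getD r []).getD j 0

/-- Twice the generators, in the basis `torusVec` and in the root vectors. -/
def genTab : List (Lin ℕ × Lin ℕ) := [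
  ([], [((2, 0), 54)]),
  ([], [((1, 0), 11), ((1, 0), 15)]),
  ([], [((2, 0), 34)]),
  ([], [((2, 0), 29)]),
  ([], [((2, 0), 22)]),
  ([], [((0, -1), 11), ((0, 1), 15)]),
  ([], [((2, 0), 2)]),
  ([], [((2, 0), 39)]),
  ([], [((1, 0), 0), ((1, 0), 5)]),
  ([], [((1, 0), 31), ((1, 0), 32)]),
  ([], [((1, 0), 37), ((1, 0), 40)]),
  ([], [((1, 0), 25), ((1, 0), 27)]),
  ([], [((1, 0), 48), ((1, 0), 50)]),
  ([], [((1, 0), 16), ((1, 0), 20)]),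
  ([], [((1, 0), 57), ((1, 0), 60)]),
  ([], [((1, 0), 7), ((1, 0), 9)]),
  ([], [((0, 1), 0), ((0, -1), 5)]),
  ([], [((0, 1), 31), ((0, -1), 32)]),
  ([], [((0, -1), 37), ((0, 1), 40)]),
  ([], [((0, 1), 25), ((0, -1), 27)]),
  ([], [((0, -1), 48), ((0, 1), 50)]),
  ([], [((0, 1), 16), ((0, -1), 20)]),
  ([], [((0, -1), 57), ((0, 1), 60)]),
  ([], [((0, 1), 7), ((0, -1), 9)]),
  ([], [((1, 0), 17), ((1, 0), 19)]),
  ([], [((1, 0), 6), ((1, 0), 10)]),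
  ([], [((1, 0), 64), ((1, 0), 66)]),
  ([((2, 0), 0)], []),
  ([], [((1, 0), 28), ((1, 0), 30)]),
  ([], [((1, 0), 42), ((1, 0), 46)]),
  ([], [((1, 0), 53), ((1, 0), 55)]),
  ([((2, 0), 1)], []),
  ([], [((2, 0), 26)]),
  ([((2, 0), 2)], []),
  ([], [((2, 0), 8)]),
  ([((2, 0), 3)], []),
  ([], [((2, 0), 44)]),
  ([], [((2, 0), 62)]),
  ([], [((0, -1), 17), ((0, 1), 19)]),
  ([], [((0, 1), 6), ((0, -1), 10)]),
  ([], [((0, -1), 42), ((0, 1), 46)]),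
  ([], [((0, -1), 53), ((0, 1), 55)]),
  ([], [((2, 0), 49)]),
  ([], [((2, 0), 35)]),
  ([((0, 2), 4)], []),
  ([], [((2, 0), 59)]),
  ([((0, 2), 5)], []),
  ([], [((2, 0), 33)]),
  ([], [((2, 0), 71)]),
  ([], [((2, 0), 69)]),
  ([], [((0, -1), 64), ((0, 1), 66)]),
  ([], [((2, 0), 13)]),
  ([], [((2, 0), 23)]),
  ([], [((0, -1), 28), ((0, 1), 30)]),
  ([], [((1, 0), 36), ((1, 0), 41)]),
  ([], [((1, 0), 67), ((1, 0), 68)]),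
  ([], [((1, 0), 1), ((1, 0), 4)]),
  ([], [((1, 0), 61), ((1, 0), 63)]),
  ([], [((1, 0), 12), ((1, 0), 14)]),
  ([], [((1, 0), 52), ((1, 0), 56)]),
  ([], [((1, 0), 21), ((1, 0), 24)]),
  ([], [((1, 0), 43), ((1, 0), 45)]),
  ([], [((0, 1), 36), ((0, -1), 41)]),
  ([], [((0, -1), 67), ((0, 1), 68)]),
  ([], [((0, 1), 1), ((0, -1), 4)]),
  ([], [((0, 1), 61), ((0, -1), 63)]),
  ([], [((0, -1), 12), ((0, 1), 14)]),
  ([], [((0, -1), 52), ((0, 1), 56)]),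
  ([], [((0, 1), 21), ((0, -1), 24)]),
  ([], [((0, 1), 43), ((0, -1), 45)]),
  ([], [((2, 0), 18)]),
  ([], [((1, 0), 47), ((1, 0), 51)]),
  ([], [((2, 0), 70)]),
  ([], [((2, 0), 65)]),
  ([], [((2, 0), 58)]),
  ([], [((0, -1), 47), ((0, 1), 51)]),
  ([], [((2, 0), 38)]),
  ([], [((2, 0), 3)])]

/-- Brackets `⁅E a, E b⁆ = c • E r` as tuples `(r, a, b, c)`, with `a` a simple root for the positive
`r` and the negative of a simple root for the negative `r`. -/
def stepTab : List (ℕ × ℕ × ℕ × GInt) := [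
  (6, 0, 4, (-4, 0)),
  (7, 2, 1, (0, 2)),
  (8, 3, 2, (4, 0)),
  (9, 4, 2, (0, 2)),
  (10, 1, 5, (4, 0)),
  (11, 0, 9, (4, 0)),
  (12, 3, 7, (0, 2)),
  (13, 4, 7, (0, 8)),
  (14, 3, 9, (0, -2)),
  (15, 2, 10, (0, -2)),
  (16, 0, 13, (0, 1)),
  (17, 0, 14, (-4, 0)),
  (18, 3, 13, (1, 0)),
  (19, 3, 15, (0, -2)),
  (20, 4, 15, (2, 0)),
  (21, 0, 18, (2, 0)),
  (22, 0, 20, (0, -4)),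
  (23, 2, 18, (4, 0)),
  (24, 3, 20, (0, 2)),
  (25, 0, 23, (0, 1)),
  (26, 0, 24, (-8, 0)),
  (27, 2, 24, (0, -2)),
  (28, 4, 25, (-4, 0)),
  (29, 0, 27, (0, -4)),
  (30, 1, 27, (-4, 0)),
  (31, 0, 30, (2, 0)),
  (32, 4, 29, (0, 2)),
  (33, 4, 31, (0, -8)),
  (34, 2, 33, (-1, 0)),
  (35, 3, 34, (-4, 0)),
  (42, 36, 40, (4, 0)),
  (43, 38, 37, (0, -2)),
  (44, 39, 38, (-4, 0)),
  (45, 40, 38, (0, -2)),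
  (46, 37, 41, (-4, 0)),
  (47, 36, 45, (-4, 0)),
  (48, 39, 43, (0, 2)),
  (49, 40, 43, (0, 8)),
  (50, 39, 45, (0, -2)),
  (51, 38, 46, (0, 2)),
  (52, 36, 49, (0, 1)),
  (53, 36, 50, (4, 0)),
  (54, 39, 49, (-1, 0)),
  (55, 39, 51, (0, -2)),
  (56, 40, 51, (-2, 0)),
  (57, 36, 54, (-2, 0)),
  (58, 36, 56, (0, 4)),
  (59, 38, 54, (-4, 0)),
  (60, 39, 56, (0, 2)),
  (61, 36, 59, (0, -1)),
  (62, 36, 60, (-8, 0)),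
  (63, 38, 60, (0, 2)),
  (64, 40, 61, (-4, 0)),
  (65, 36, 63, (0, -4)),
  (66, 37, 63, (-4, 0)),
  (67, 36, 66, (2, 0)),
  (68, 40, 65, (0, 2)),
  (69, 40, 67, (0, 8)),
  (70, 38, 69, (1, 0)),
  (71, 39, 70, (4, 0))]

/-- Substitution of formal combinations into a formal combination. -/
def Lin.bind {κ : Type} (c : Lin ℕ) (f : ℕ → Lin κ) : Lin κ :=
  c.flatMap fun t => Lin.scale t.1 (f t.2)

lemma Lin.eval_bind {κ : Type} {A : Type*} [AddCommGroup A] [Module ℂ A] (c : Lin ℕ)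
    (f : ℕ → Lin κ) (g : κ → A) : Lin.eval g (Lin.bind c f) = Lin.eval (fun k => Lin.eval g (f k)) c := by
  rw [Lin.bind, Lin.eval_flatMap, Lin.eval_eq_sum]
  simp only [Lin.eval_scale]

instance : Key ℕ := ⟨Nat.beq, Nat.eq_of_beq_eq_true⟩

/-- Kernel-computable test for a bracket relation between combinations of generators. -/
noncomputable def brTest (a b c : Lin ℕ) : Bool :=
  Lin.eqv (SField.br (combData a) (combData b)) (combData c)

/-- The root vectors are eigenvectors of the torus. -/
lemma torus_root_test : ((List.range 72).all fun r => (List.range 6).all fun j =>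
    brTest (torusVec j) (rootVec r) (Lin.scale (rootWt r j, 0) (rootVec r))) = true := by
  decide +kernel

lemma torus_torus_test : ((List.range 6).all fun i => (List.range 6).all fun j =>
    brTest (torusVec i) (torusVec j) []) = true := by
  decide +kernel

/-- The brackets of opposite root vectors lie in the torus. -/
lemma opp_test : ((List.range 36).all fun r => brTest (rootVec r) (rootVec (r + 36))
    (Lin.bind ((List.range 6).map fun j => ((oppCoef r j, 0), j)) torusVec)) = true := by
  decide +kernel

/-- The difference of two distinct simple roots is not a root. -/
lemma simple_test : ((List.range 6).all fun i => (List.range 6).all fun j =>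
    bif Nat.beq i j then true else brTest (rootVec i) (rootVec (j + 36)) []) = true := by
  decide +kernel

/-- Every root vector is a multiple of a bracket of one for a simple root, or the negative of a
simple root, with another root vector. -/
lemma step_test : (stepTab.all fun s =>
    brTest (rootVec s.2.1) (rootVec s.2.2.1) (Lin.scale s.2.2.2 (rootVec s.1))) = true := by
  decide +kernel

/-- Every generator is a combination of torus elements and root vectors. -/
lemma gen_test : ((List.range 78).all fun k => Lin.eqv [((2, 0), k)]
    (Lin.bind (genTab.getD k ([], [])).1 torusVec ++
      Lin.bind (genTab.getD k ([], [])).2 rootVec)) = true := by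
  decide +kernel

end CREII

namespace CREII

/-! ### Nondegeneracy of the Killing form from a root decomposition -/

section KillingCriterion

variable {K L τ ρ : Type*} [Field K] [LieRing L] [LieAlgebra K L]
  [Fintype τ] [Fintype ρ]

/-- Invariance makes the Killing form vanish on eigenvectors of `ad t` whose eigenvalues do not
cancel. -/
lemma killingForm_eq_zero_of_lie_eq_smul {t x y : L} {a b : K} (hx : ⁅t, x⁆ = a • x)
    (hy : ⁅t, y⁆ = b • y) (hab : a + b ≠ 0) : killingForm K L x y = 0 := by
  have h := LieModule.traceForm_apply_lie_apply K L L x t y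
  rw [← lie_skew, hx, hy, map_smul, map_neg, map_smul, LinearMap.neg_apply,
    LinearMap.smul_apply, smul_eq_mul, smul_eq_mul] at h
  have h2 : (a + b) * killingForm K L x y = 0 := by
    rw [killingForm]
    linear_combination -h
  exact (mul_eq_zero.mp h2).resolve_left hab

/-- The Killing form on simultaneously diagonalised elements is the trace form of their
eigenvalues. -/
lemma killingForm_of_eigenbasis {ι : Type*} [Fintype ι] (B : Basis ι K L) {x y : L} {a b : ι → K}
    (hx : ∀ i, ⁅x, B i⁆ = a i • B i) (hy : ∀ i, ⁅y, B i⁆ = b i • B i) :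
    killingForm K L x y = ∑ i, a i * b i := by
  classical
  rw [killingForm_apply_apply, LinearMap.trace_eq_matrix_trace K B, Matrix.trace]
  refine Finset.sum_congr rfl fun i _ => ?_
  simp [LinearMap.toMatrix_apply, hx, hy, mul_comm]

variable (B : Basis (τ ⊕ ρ) K L) {wt : ρ → τ → K}

lemma killingForm_torus (h_tt : ∀ i j, ⁅B (.inl i), B (.inl j)⁆ = 0)
    (h_te : ∀ j r, ⁅B (.inl j), B (.inr r)⁆ = wt r j • B (.inr r)) (i j : τ) :
    killingForm K L (B (.inl i)) (B (.inl j)) = ∑ r, wt r i * wt r j := by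
  have h : ∀ i k, ⁅B (.inl i), B k⁆ = (Sum.elim (fun _ => 0) (fun r => wt r i) : τ ⊕ ρ → K) k • B k := by
    rintro i (k | k)
    · simp [h_tt]
    · simp [h_te]
  rw [killingForm_of_eigenbasis B (h i) (h j)]
  simp

/-- A Lie algebra with a root decomposition whose opposite root vectors have nonzero bracket, and
for which the sum of the squares of the roots is nondegenerate, has nondegenerate Killing form. -/
lemma isKilling_of_root_basis {neg : ρ → ρ} {c : ρ → τ → K}
    (h_tt : ∀ i j, ⁅B (.inl i), B (.inl j)⁆ = 0)
    (h_te : ∀ j r, ⁅B (.inl j), B (.inr r)⁆ = wt r j • B (.inr r))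
    (h_ne : ∀ r, ∃ j, wt r j ≠ 0) (h_add : ∀ r s, s ≠ neg r → ∃ j, wt s j + wt r j ≠ 0)
    (h_opp : ∀ r, ⁅B (.inr r), B (.inr (neg r))⁆ = ∑ j, c r j • B (.inl j))
    (h_c : ∀ r, c r ≠ 0) (h_neg : ∀ r, neg (neg r) = r)
    (h_gram : ∀ x : τ → K, (∀ j, ∑ i, x i * ∑ r, wt r i * wt r j = 0) → x = 0) :
    LieAlgebra.IsKilling K L := by
  have h_zero : ∀ j r, killingForm K L (B (.inl j)) (B (.inr r)) = 0 := by
    intro j r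
    obtain ⟨i, hi⟩ := h_ne r
    exact killingForm_eq_zero_of_lie_eq_smul (t := B (.inl i)) (a := 0) (b := wt r i)
      (by rw [h_tt, zero_smul]) (h_te i r) (by simpa using hi)
  have h_zero' : ∀ r s, s ≠ neg r → killingForm K L (B (.inr s)) (B (.inr r)) = 0 := by
    intro r s hs
    obtain ⟨i, hi⟩ := h_add r s hs
    exact killingForm_eq_zero_of_lie_eq_smul (h_te i s) (h_te i r) hi
  have h_pair : ∀ r, killingForm K L (B (.inr (neg r))) (B (.inr r)) ≠ 0 := by
    intro r hr
    refine h_c r (h_gram _ fun j => ?_)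
    have h := LieModule.traceForm_apply_lie_apply K L L (B (.inr (neg r))) (B (.inr r)) (B (.inl j))
    have h1 : ⁅B (.inr r), B (.inl j)⁆ = -(wt r j • B (.inr r)) := by rw [← lie_skew, h_te]
    have h2 : ⁅B (.inr (neg r)), B (.inr r)⁆ = -∑ j, c r j • B (.inl j) := by
      rw [← lie_skew, h_opp]
    rw [h1, h2] at h
    have h3 : killingForm K L (∑ j, c r j • B (.inl j)) (B (.inl j)) = 0 := by
      have : LieModule.traceForm K L L = killingForm K L := rfl
      rw [this, map_neg, map_neg, map_smul, hr, smul_zero, neg_zero, LinearMap.neg_apply] at h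
      exact neg_eq_zero.mp h
    rw [map_sum, LinearMap.sum_apply] at h3
    simpa only [map_smul, LinearMap.smul_apply, killingForm_torus B h_tt h_te, smul_eq_mul] using h3
  refine ⟨?_⟩
  rw [eq_bot_iff]
  intro x hx
  rw [LieIdeal.mem_killingCompl] at hx
  have hx' : ∀ y, killingForm K L x y = 0 := fun y => by
    rw [LieModule.traceForm_comm]
    exact hx y trivial
  have hroot : ∀ r, B.repr x (.inr r) = 0 := by
    intro r
    have h := hx' (B (.inr (neg r)))
    rw [← B.sum_repr x, map_sum, LinearMap.sum_apply, Fintype.sum_sum_type] at h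
    simp only [map_smul, LinearMap.smul_apply, h_zero, smul_zero, Finset.sum_const_zero,
      zero_add] at h
    rw [Finset.sum_eq_single r] at h
    · have hp := h_pair (neg r)
      rw [h_neg] at hp
      exact (mul_eq_zero.mp h).resolve_right hp
    · intro s _ hs
      rw [h_zero' _ _ (by rwa [h_neg]), smul_zero]
    · simp
  have htor : (fun j => B.repr x (.inl j)) = 0 := by
    refine h_gram _ fun j => ?_
    have h := hx' (B (.inl j))
    rw [← B.sum_repr x, map_sum, LinearMap.sum_apply, Fintype.sum_sum_type] at h
    simpa [hroot, killingForm_torus B h_tt h_te] using h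
  have : B.repr x = 0 := by
    ext (j | r)
    · exact congrFun htor j
    · exact hroot r
  simpa using this

end KillingCriterion

end CREII

namespace CREII

/-! ### Lie algebras of type `E₆` -/

/-- The family `g` (of which only the first 78 members matter) is a basis of the complex Lie
algebra `L` and satisfies the bracket relations of the listed generators. -/
structure Realizes {L : Type*} [LieRing L] [LieAlgebra ℂ L] (g : ℕ → L) : Prop where
  lie : ∀ a b c : Lin ℕ, polyBracket (Lin.eval gen a) (Lin.eval gen b) = Lin.eval gen c →
    ⁅Lin.eval g a, Lin.eval g b⁆ = Lin.eval g c
  linInd : LinearIndependent ℂ fun k : Fin 78 => g k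
  span : Submodule.span ℂ (Set.range fun k : Fin 78 => g k) = ⊤

/-- The root vectors and the torus elements as one family. -/
noncomputable def rootFamily {L : Type*} [AddCommGroup L] [Module ℂ L] (g : ℕ → L) :
    Fin 6 ⊕ Fin 72 → L :=
  Sum.elim (fun j => Lin.eval g (torusVec j)) fun r => Lin.eval g (rootVec r)

lemma span_rootFamily {L : Type*} [AddCommGroup L] [Module ℂ L] {g : ℕ → L}
    (hspan : Submodule.span ℂ (Set.range fun k : Fin 78 => g k) = ⊤) :
    ⊤ ≤ Submodule.span ℂ (Set.range (rootFamily g)) := by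
  rw [← hspan, Submodule.span_le]
  rintro _ ⟨k, rfl⟩
  have h := List.all_eq_true.mp gen_test k (List.mem_range.mpr k.2)
  have h2 := Lin.eval_eq_of_eqv g h
  simp only [Lin.eval_append, Lin.eval_bind, Lin.eval_cons, Lin.eval_nil, add_zero] at h2
  have mem : ∀ (f : ℕ → L) (l : Lin ℕ),
      (∀ n, f n ∈ Submodule.span ℂ (Set.range (rootFamily g))) →
      Lin.eval f l ∈ Submodule.span ℂ (Set.range (rootFamily g)) := by
    intro f l hf
    induction l with
    | nil => exact zero_mem _
    | cons t l ih => exact add_mem (Submodule.smul_mem _ _ (hf _)) ih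
  have h3 : GInt.toC (2, 0) • g k ∈ Submodule.span ℂ (Set.range (rootFamily g)) := by
    rw [h2]
    refine add_mem (mem _ _ fun n => ?_) (mem _ _ fun n => ?_)
    · by_cases hn : n < 6
      · exact Submodule.subset_span ⟨.inl ⟨n, hn⟩, rfl⟩
      · rw [torusVec, List.getD_eq_default _ _ (by simpa using hn)]
        exact zero_mem _
    · by_cases hn : n < 72
      · exact Submodule.subset_span ⟨.inr ⟨n, hn⟩, rfl⟩
      · rw [rootVec, List.getD_eq_default _ _ (by
          have : rootTab.length = 72 := by decide +kernel
          omega)]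
        exact zero_mem _
  have h4 : (2 : ℂ)⁻¹ • GInt.toC (2, 0) • g k = g k := by
    rw [smul_smul]; simp [GInt.toC]
  change g k ∈ _
  rw [← h4]
  exact Submodule.smul_mem _ _ h3

/-- The negative of a root. -/
def negRoot (r : Fin 72) : Fin 72 := r + 36

/-- The number of the `i`-th simple root, in Bourbaki's order. -/
def simpleRoot : Fin 6 → ℕ := ![0, 3, 4, 2, 1, 5]

lemma simpleRoot_lt (i : Fin 6) : simpleRoot i < 6 := by revert i; decide

lemma brTest_eq {a b c : Lin ℕ} (h : brTest a b c = true) :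
    polyBracket (Lin.eval gen a) (Lin.eval gen b) = Lin.eval gen c := polyBracket_eval_gen h

lemma toC_int (n : ℤ) : GInt.toC (n, 0) = n := by simp [GInt.toC]

lemma eval_opp {L : Type*} [AddCommGroup L] [Module ℂ L] (f : ℕ → L) (c : ℕ → ℤ) :
    Lin.eval f ((List.range 6).map fun j => ((c j, 0), j)) = ∑ j : Fin 6, (c j : ℂ) • f j := by
  simp only [List.range_succ, List.range_zero, List.nil_append, List.cons_append, List.map_cons,
    List.map_nil, Lin.eval_cons, Lin.eval_nil, toC_int, Fin.sum_univ_succ, Fin.sum_univ_zero]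
  simp

lemma rootWt_negRoot (r : Fin 72) (j : Fin 6) : rootWt (negRoot r) j = -rootWt r j := by
  revert r j; decide +kernel

lemma exists_rootWt_ne (r : Fin 72) : ∃ j : Fin 6, rootWt r j ≠ 0 := by
  revert r; decide +kernel

lemma exists_rootWt_add_ne (r s : Fin 72) (h : s ≠ negRoot r) :
    ∃ j : Fin 6, rootWt s j + rootWt r j ≠ 0 := by
  revert r s; decide +kernel

lemma exists_oppCoef_ne (r : Fin 72) (hr : r < 36) : ∃ j : Fin 6, oppCoef r j ≠ 0 := by
  revert r; decide +kernel

/-- The sum of the squares of the roots, as a quadratic form on the torus. -/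
def gramMatrix : Matrix (Fin 6) (Fin 6) ℤ :=
  !![48, 0, -24, -24, 0, 0; 0, 48, -24, -24, 0, 0; -24, -24, 48, 24, 0, 0; -24, -24, 24, 48, 0, 0;
    0, 0, 0, 0, 32, -16; 0, 0, 0, 0, -16, 32]

lemma sum_rootWt_mul (i j : Fin 6) : ∑ r : Fin 72, rootWt r i * rootWt r j = gramMatrix i j := by
  have h : ∀ i j : Fin 6, decide (∑ r : Fin 72, rootWt r i * rootWt r j = gramMatrix i j) = true := by
    decide +kernel
  exact of_decide_eq_true (h i j)

lemma gramMatrix_inv : gramMatrix * !![6, 3, 3, 3, 0, 0; 3, 6, 3, 3, 0, 0; 3, 3, 6, 0, 0, 0;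
    3, 3, 0, 6, 0, 0; 0, 0, 0, 0, 6, 3; 0, 0, 0, 0, 3, 6] = (144 : ℤ) • 1 := by
  decide +kernel

lemma cartanE₆_inv : CartanMatrix.E₆ * !![4, 3, 5, 6, 4, 2; 3, 6, 6, 9, 6, 3; 5, 6, 10, 12, 8, 4;
    6, 9, 12, 18, 12, 6; 4, 6, 8, 12, 10, 5; 2, 3, 4, 6, 5, 4] = (3 : ℤ) • 1 := by
  decide +kernel

/-- The value of the root numbered `s` on the bracket of the root vectors numbered `r` and
`r + 36`. -/
def pairing (r s : ℕ) : ℤ := ∑ j : Fin 6, oppCoef r j * rootWt s j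

/-- The Cartan integers of the simple roots are the entries of the Cartan matrix of type `E₆`. -/
lemma two_mul_pairing (i j : Fin 6) : 2 * pairing (simpleRoot j) (simpleRoot i) =
    CartanMatrix.E₆ i j * pairing (simpleRoot j) (simpleRoot j) := by
  revert i j; decide +kernel

lemma pairing_ne_zero (i : Fin 6) : pairing (simpleRoot i) (simpleRoot i) ≠ 0 := by
  revert i; decide +kernel

lemma stepTab_pos (r : Fin 36) (hr : 6 ≤ r) :
    (stepTab.getD (r - 6) (0, 0, 0, (0, 0))).1 = r ∧
    (stepTab.getD (r - 6) (0, 0, 0, (0, 0))).2.1 < 6 ∧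
    (stepTab.getD (r - 6) (0, 0, 0, (0, 0))).2.2.1 < r ∧
    (stepTab.getD (r - 6) (0, 0, 0, (0, 0))).2.2.2 ≠ (0, 0) := by
  revert r; decide +kernel

lemma stepTab_neg (r : Fin 36) (hr : 6 ≤ r) :
    (stepTab.getD (r + 24) (0, 0, 0, (0, 0))).1 = r + 36 ∧
    (stepTab.getD (r + 24) (0, 0, 0, (0, 0))).2.1 - 36 < 6 ∧
    36 ≤ (stepTab.getD (r + 24) (0, 0, 0, (0, 0))).2.1 ∧
    (stepTab.getD (r + 24) (0, 0, 0, (0, 0))).2.2.1 < r + 36 ∧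
    36 ≤ (stepTab.getD (r + 24) (0, 0, 0, (0, 0))).2.2.1 ∧
    (stepTab.getD (r + 24) (0, 0, 0, (0, 0))).2.2.2 ≠ (0, 0) := by
  revert r; decide +kernel

lemma toC_ne_zero {a : GInt} (h : a ≠ (0, 0)) : a.toC ≠ 0 := by
  intro h0
  apply h
  have h1 := congrArg Complex.re h0
  have h2 := congrArg Complex.im h0
  simp [GInt.toC] at h1 h2
  exact Prod.ext h1 h2

/-- An integral matrix with a right inverse up to a nonzero factor `d` has trivial left kernel over
the complex numbers. -/
lemma eq_zero_of_int_matrix {A N : Matrix (Fin 6) (Fin 6) ℤ} {d : ℤ} (h : A * N = d • 1)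
    (hd : d ≠ 0) (x : Fin 6 → ℂ) (hx : ∀ j, ∑ i, x i * (A i j : ℂ) = 0) : x = 0 := by
  funext k
  have h1 : ∀ i, (∑ j, (A i j : ℂ) * N j k) = if i = k then (d : ℂ) else 0 := by
    intro i
    have h2 := congrFun (congrFun h i) k
    rw [Matrix.mul_apply, Matrix.smul_apply, Matrix.one_apply] at h2
    have h3 : ((∑ j, A i j * N j k : ℤ) : ℂ) = ((d • if i = k then 1 else 0 : ℤ) : ℂ) := by rw [h2]
    push_cast at h3
    rw [h3]
    split_ifs <;> simp
  have h4 : x k * d = ∑ j, (∑ i, x i * (A i j : ℂ)) * N j k := by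
    simp only [Finset.sum_mul]
    rw [Finset.sum_comm]
    simp only [mul_assoc, ← Finset.mul_sum, h1]
    simp
  simp only [hx, zero_mul, Finset.sum_const_zero] at h4
  exact (mul_eq_zero.mp h4).resolve_right (by exact_mod_cast hd)

namespace Realizes

variable {L : Type*} [LieRing L] [LieAlgebra ℂ L] {g : ℕ → L}

lemma finrank_eq (hg : Realizes g) : Module.finrank ℂ L = 78 := by
  have h := finrank_span_eq_card hg.linInd
  rw [hg.span, finrank_top] at h
  simpa using h

/-- The basis of torus elements and root vectors. -/
noncomputable def rootBasis (hg : Realizes g) : Basis (Fin 6 ⊕ Fin 72) ℂ L :=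
  basisOfTopLeSpanOfCardEqFinrank (rootFamily g) (span_rootFamily hg.span)
    (by rw [hg.finrank_eq]; simp)

@[simp] lemma coe_rootBasis (hg : Realizes g) : ⇑hg.rootBasis = rootFamily g :=
  coe_basisOfTopLeSpanOfCardEqFinrank _ _ _

lemma lie_torus_torus (hg : Realizes g) {i j : ℕ} (hi : i < 6) (hj : j < 6) :
    ⁅Lin.eval g (torusVec i), Lin.eval g (torusVec j)⁆ = 0 := by
  have h := List.all_eq_true.mp (List.all_eq_true.mp torus_torus_test i (List.mem_range.mpr hi)) j
    (List.mem_range.mpr hj)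
  exact hg.lie _ _ _ (brTest_eq h)

lemma lie_torus_root (hg : Realizes g) {j r : ℕ} (hj : j < 6) (hr : r < 72) :
    ⁅Lin.eval g (torusVec j), Lin.eval g (rootVec r)⁆ =
      (rootWt r j : ℂ) • Lin.eval g (rootVec r) := by
  have h := List.all_eq_true.mp (List.all_eq_true.mp torus_root_test r (List.mem_range.mpr hr)) j
    (List.mem_range.mpr hj)
  rw [hg.lie _ _ _ (brTest_eq h), Lin.eval_scale, toC_int]

lemma lie_root_opp (hg : Realizes g) {r : ℕ} (hr : r < 36) :
    ⁅Lin.eval g (rootVec r), Lin.eval g (rootVec (r + 36))⁆ =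
      ∑ j : Fin 6, (oppCoef r j : ℂ) • Lin.eval g (torusVec j) := by
  have h := List.all_eq_true.mp opp_test r (List.mem_range.mpr hr)
  rw [hg.lie _ _ _ (brTest_eq h), Lin.eval_bind, eval_opp]

lemma lie_simple_ne (hg : Realizes g) {i j : ℕ} (hi : i < 6) (hj : j < 6) (hij : i ≠ j) :
    ⁅Lin.eval g (rootVec i), Lin.eval g (rootVec (j + 36))⁆ = 0 := by
  have h := List.all_eq_true.mp (List.all_eq_true.mp simple_test i (List.mem_range.mpr hi)) j
    (List.mem_range.mpr hj)
  have hb : Nat.beq i j = false := Bool.eq_false_iff.mpr fun h => hij (Nat.eq_of_beq_eq_true h)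
  rw [hb, cond_false] at h
  exact hg.lie _ _ _ (brTest_eq h)

lemma lie_opp_root (hg : Realizes g) {r s : ℕ} (hr : r < 36) (hs : s < 72) :
    ⁅⁅Lin.eval g (rootVec r), Lin.eval g (rootVec (r + 36))⁆, Lin.eval g (rootVec s)⁆ =
      (pairing r s : ℂ) • Lin.eval g (rootVec s) := by
  rw [hg.lie_root_opp hr, sum_lie, pairing]
  push_cast
  rw [Finset.sum_smul]
  refine Finset.sum_congr rfl fun j _ => ?_
  rw [smul_lie, hg.lie_torus_root j.2 hs, smul_smul]

theorem isKilling (hg : Realizes g) : LieAlgebra.IsKilling ℂ L := by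
  have hopp : ∀ r : Fin 72, ⁅hg.rootBasis (.inr r), hg.rootBasis (.inr (negRoot r))⁆ =
      ∑ j : Fin 6, (((if r < 36 then oppCoef r j else -oppCoef (negRoot r) j : ℤ) : ℂ)) •
        hg.rootBasis (.inl j) := by
    intro r
    simp only [coe_rootBasis, rootFamily, Sum.elim_inr, Sum.elim_inl]
    split_ifs with hr
    · have h : ((negRoot r : Fin 72) : ℕ) = r + 36 := by
        revert r; decide
      rw [h, hg.lie_root_opp (by omega)]
    · have h : (r : ℕ) = (negRoot r : Fin 72) + 36 := by
        revert r; decide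
      have h' : ((negRoot r : Fin 72) : ℕ) < 36 := by omega
      rw [← lie_skew, h, hg.lie_root_opp h', ← Finset.sum_neg_distrib]
      simp
  refine isKilling_of_root_basis hg.rootBasis (wt := fun r j => (rootWt r j : ℂ)) (neg := negRoot)
    ?_ ?_ ?_ ?_ hopp ?_ (by decide) ?_
  · intro i j
    simpa [rootFamily] using hg.lie_torus_torus i.2 j.2
  · intro j r
    simpa [rootFamily] using hg.lie_torus_root j.2 r.2
  · intro r
    obtain ⟨j, hj⟩ := exists_rootWt_ne r
    exact ⟨j, by exact_mod_cast hj⟩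
  · intro r s h
    obtain ⟨j, hj⟩ := exists_rootWt_add_ne r s h
    exact ⟨j, by exact_mod_cast hj⟩
  · intro r h
    have h' : ∀ j : Fin 6, (if r < 36 then oppCoef r j else -oppCoef (negRoot r) j) = 0 :=
      fun j => by
        have := congrFun h j
        simp only [Pi.zero_apply] at this
        exact_mod_cast this
    by_cases hr : r < 36
    · obtain ⟨j, hj⟩ := exists_oppCoef_ne r hr
      exact hj (by simpa [hr] using h' j)
    · have h36 : negRoot r < 36 := by
        clear h h'
        revert r; decide
      obtain ⟨j, hj⟩ := exists_oppCoef_ne _ h36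
      exact hj (by simpa [hr] using h' j)
  · intro x hx
    refine eq_zero_of_int_matrix gramMatrix_inv (by norm_num) x fun j => ?_
    rw [← hx j]
    refine Finset.sum_congr rfl fun i _ => ?_
    rw [← sum_rootWt_mul]
    push_cast
    rfl

/-- The root vectors and their opposites for the simple roots generate. -/
lemma lieSpan_simple (hg : Realizes g) {S : LieSubalgebra ℂ L}
    (he : ∀ r < 6, Lin.eval g (rootVec r) ∈ S) (hf : ∀ r < 6, Lin.eval g (rootVec (r + 36)) ∈ S) :
    (∀ r < 36, Lin.eval g (rootVec r) ∈ S) ∧ ∀ r < 36, Lin.eval g (rootVec (r + 36)) ∈ S := by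
  have step : ∀ n < 60, (stepTab.getD n (0, 0, 0, (0, 0))).2.2.2 ≠ (0, 0) →
      Lin.eval g (rootVec (stepTab.getD n (0, 0, 0, (0, 0))).2.1) ∈ S →
      Lin.eval g (rootVec (stepTab.getD n (0, 0, 0, (0, 0))).2.2.1) ∈ S →
      Lin.eval g (rootVec (stepTab.getD n (0, 0, 0, (0, 0))).1) ∈ S := by
    intro n hn
    have hlen : n < stepTab.length := lt_of_lt_of_eq hn (by decide +kernel)
    rw [List.getD_eq_getElem _ _ hlen]
    intro hc ha hb
    have ht := List.all_eq_true.mp step_test _ (List.getElem_mem hlen)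
    have hl := hg.lie _ _ _ (brTest_eq ht)
    rw [Lin.eval_scale] at hl
    have hm := S.lie_mem ha hb
    rw [hl] at hm
    have h2 := S.smul_mem (GInt.toC stepTab[n].2.2.2)⁻¹ hm
    rwa [smul_smul, inv_mul_cancel₀ (toC_ne_zero hc), one_smul] at h2
  constructor
  · intro r
    induction r using Nat.strong_induction_on with
    | _ r ih =>
      intro hr
      by_cases h6 : r < 6
      · exact he r h6
      · obtain ⟨h1, h2, h3, h4⟩ := stepTab_pos ⟨r, hr⟩ (by rw [Fin.le_def]; simpa using h6)
        simp only at h1 h2 h3 h4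
        have := step (r - 6) (by omega) h4 (he _ h2) (ih _ h3 (h3.trans hr))
        rwa [h1] at this
  · intro r
    induction r using Nat.strong_induction_on with
    | _ r ih =>
      intro hr
      by_cases h6 : r < 6
      · exact hf r h6
      · obtain ⟨h1, h2, h2', h3, h3', h4⟩ :=
          stepTab_neg ⟨r, hr⟩ (by rw [Fin.le_def]; simpa using h6)
        simp only at h1 h2 h2' h3 h3' h4
        have ha := hf _ h2
        rw [Nat.sub_add_cancel h2'] at ha
        have hb := ih ((stepTab.getD (r + 24) (0, 0, 0, (0, 0))).2.2.1 - 36) (by omega) (by omega)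
        rw [Nat.sub_add_cancel h3'] at hb
        have := step (r + 24) (by omega) h4 ha hb
        rwa [h1] at this

/-- The Chevalley generators `e`. -/
noncomputable def chevE (g : ℕ → L) (i : Fin 6) : L := Lin.eval g (rootVec (simpleRoot i))

/-- The Chevalley generators `f`: opposite root vectors, scaled so that `⁅e, f⁆` is a coroot. -/
noncomputable def chevF (g : ℕ → L) (i : Fin 6) : L :=
  (2 / pairing (simpleRoot i) (simpleRoot i) : ℂ) • Lin.eval g (rootVec (simpleRoot i + 36))

/-- The simple coroots. -/
noncomputable def chevH (g : ℕ → L) (i : Fin 6) : L := ⁅chevE g i, chevF g i⁆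

lemma pairing_neg (r : ℕ) (s : Fin 36) : pairing r (s + 36) = -pairing r s := by
  have h := fun j => rootWt_negRoot ⟨s, by omega⟩ j
  have hs : ((negRoot ⟨s, by omega⟩ : Fin 72) : ℕ) = s + 36 := by
    simp only [negRoot, Fin.val_add]
    have : ((36 : Fin 72) : ℕ) = 36 := rfl
    rw [this]
    exact Nat.mod_eq_of_lt (by omega)
  rw [hs] at h
  simp only [pairing, h, mul_neg, Finset.sum_neg_distrib]

lemma lie_chevH (hg : Realizes g) (j : Fin 6) {s : ℕ} (hs : s < 72) :
    ⁅chevH g j, Lin.eval g (rootVec s)⁆ =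
      (2 / pairing (simpleRoot j) (simpleRoot j) * pairing (simpleRoot j) s : ℂ) •
        Lin.eval g (rootVec s) := by
  have := simpleRoot_lt j
  rw [chevH, chevE, chevF, lie_smul, smul_lie, hg.lie_opp_root (by omega) hs, smul_smul]

lemma chev_coeff (i j : Fin 6) :
    (2 / pairing (simpleRoot j) (simpleRoot j) * pairing (simpleRoot j) (simpleRoot i) : ℂ) =
      CartanMatrix.E₆ i j := by
  have h := pairing_ne_zero j
  have h' : (pairing (simpleRoot j) (simpleRoot j) : ℂ) ≠ 0 := by exact_mod_cast h
  have h2 : (2 * pairing (simpleRoot j) (simpleRoot i) : ℂ) =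
    CartanMatrix.E₆ i j * pairing (simpleRoot j) (simpleRoot j) := by
      exact_mod_cast two_mul_pairing i j
  field_simp
  linear_combination h2

lemma lie_chevH_chevE (hg : Realizes g) (i j : Fin 6) :
    ⁅chevH g j, chevE g i⁆ = CartanMatrix.E₆ i j • chevE g i := by
  have := simpleRoot_lt i
  rw [chevE, hg.lie_chevH j (by omega), chev_coeff, Int.cast_smul_eq_zsmul]

lemma lie_chevH_chevF (hg : Realizes g) (i j : Fin 6) :
    ⁅chevH g j, chevF g i⁆ = -CartanMatrix.E₆ i j • chevF g i := by
  have := simpleRoot_lt i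
  have h := pairing_neg (simpleRoot j) ⟨simpleRoot i, by omega⟩
  simp only at h
  rw [chevF, lie_smul, hg.lie_chevH j (by omega), h]
  push_cast
  rw [mul_neg, chev_coeff, smul_comm, ← Int.cast_smul_eq_zsmul ℂ]
  push_cast
  rfl

lemma chevH_mem_span (hg : Realizes g) (i : Fin 6) : chevH g i ∈
    Submodule.span ℂ (Set.range fun j : Fin 6 => Lin.eval g (torusVec j)) := by
  have := simpleRoot_lt i
  rw [chevH, chevE, chevF, lie_smul, hg.lie_root_opp (by omega)]
  exact Submodule.smul_mem _ _ (Submodule.sum_mem _ fun j _ =>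
    Submodule.smul_mem _ _ (Submodule.subset_span ⟨j, rfl⟩))

lemma lie_chevH_chevH (hg : Realizes g) (i j : Fin 6) : ⁅chevH g i, chevH g j⁆ = 0 := by
  have h : ∀ x ∈ Submodule.span ℂ (Set.range fun j : Fin 6 => Lin.eval g (torusVec j)),
      ∀ y ∈ Submodule.span ℂ (Set.range fun j : Fin 6 => Lin.eval g (torusVec j)), ⁅x, y⁆ = 0 := by
    intro x hx y hy
    induction hx using Submodule.span_induction with
    | mem x hx =>
      obtain ⟨i, rfl⟩ := hx
      induction hy using Submodule.span_induction with
      | mem y hy => obtain ⟨j, rfl⟩ := hy; exact hg.lie_torus_torus i.2 j.2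
      | zero => simp
      | add a b _ _ ha hb => rw [lie_add, ha, hb, add_zero]
      | smul c a _ ha => rw [lie_smul, ha, smul_zero]
    | zero => simp
    | add a b _ _ ha hb => rw [add_lie, ha, hb, add_zero]
    | smul c a _ ha => rw [smul_lie, ha, smul_zero]
  exact h _ (hg.chevH_mem_span i) _ (hg.chevH_mem_span j)

lemma rootVec_ne_zero (hg : Realizes g) {r : ℕ} (hr : r < 72) : Lin.eval g (rootVec r) ≠ 0 := by
  have := hg.rootBasis.ne_zero (.inr ⟨r, hr⟩)
  simpa [rootFamily] using this

lemma linearIndependent_chevH (hg : Realizes g) : LinearIndependent ℂ (chevH g) := by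
  rw [Fintype.linearIndependent_iff]
  intro x hx i
  refine congrFun (eq_zero_of_int_matrix cartanE₆_inv (by norm_num) x fun j => ?_) i
  have h := congrArg (fun y => ⁅y, chevE g j⁆) hx
  simp only [sum_lie, smul_lie, hg.lie_chevH_chevE, zero_lie] at h
  have h2 : (∑ i, x i * (CartanMatrix.E₆ i j : ℂ)) • chevE g j = 0 := by
    rw [Finset.sum_smul, ← h]
    refine Finset.sum_congr rfl fun i _ => ?_
    rw [mul_smul, Int.cast_smul_eq_zsmul, ← CartanMatrix.E₆_transpose, Matrix.transpose_apply,
      CartanMatrix.E₆_transpose]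
  have := simpleRoot_lt j
  exact (smul_eq_zero.mp h2).resolve_right (hg.rootVec_ne_zero (by omega))

lemma torus_mem_span_chevH (hg : Realizes g) (j : Fin 6) :
    Lin.eval g (torusVec j) ∈ Submodule.span ℂ (Set.range (chevH g)) := by
  have hle : Submodule.span ℂ (Set.range (chevH g)) ≤
      Submodule.span ℂ (Set.range fun j : Fin 6 => Lin.eval g (torusVec j)) :=
    Submodule.span_le.mpr (by rintro _ ⟨i, rfl⟩; exact hg.chevH_mem_span i)
  have hli : LinearIndependent ℂ fun j : Fin 6 => Lin.eval g (torusVec j) := by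
    have h := hg.rootBasis.linearIndependent.comp (Sum.inl : Fin 6 → _) Sum.inl_injective
    rw [coe_rootBasis] at h
    exact h
  have : FiniteDimensional ℂ L := hg.rootBasis.finiteDimensional_of_finite
  have h := Submodule.eq_of_le_of_finrank_eq hle (by
    rw [finrank_span_eq_card hg.linearIndependent_chevH, finrank_span_eq_card hli])
  rw [h]
  exact Submodule.subset_span ⟨j, rfl⟩

/-- The Chevalley generators. -/
noncomputable def lieBasis (hg : Realizes g) :
    LieAlgebra.Basis (Fin 6) (LieSubalgebra.lieSpan ℂ L (Set.range (chevH g))) where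
  A := CartanMatrix.E₆
  h := chevH g
  e := chevE g
  f := chevF g
  cartan_eq_lieSpan := rfl
  span_ef := by
    set S := LieSubalgebra.lieSpan ℂ L (Set.range (chevE g) ∪ Set.range (chevF g)) with hS
    have hE : ∀ i, chevE g i ∈ S := fun i => LieSubalgebra.subset_lieSpan (.inl ⟨i, rfl⟩)
    have hF : ∀ i, chevF g i ∈ S := fun i => LieSubalgebra.subset_lieSpan (.inr ⟨i, rfl⟩)
    have hsurj : ∀ r < 6, ∃ i, simpleRoot i = r := by decide
    obtain ⟨h1, h2⟩ := hg.lieSpan_simple (S := S)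
      (fun r hr => by
        obtain ⟨i, rfl⟩ := hsurj r hr
        exact hE i)
      (fun r hr => by
        obtain ⟨i, rfl⟩ := hsurj r hr
        have h := S.smul_mem (pairing (simpleRoot i) (simpleRoot i) / 2 : ℂ) (hF i)
        have h0 : (pairing (simpleRoot i) (simpleRoot i) : ℂ) ≠ 0 := by
          exact_mod_cast pairing_ne_zero i
        rw [chevF, smul_smul] at h
        have h1 : (pairing (simpleRoot i) (simpleRoot i) / 2 : ℂ) *
            (2 / pairing (simpleRoot i) (simpleRoot i)) = 1 := by field_simp
        rwa [h1, one_smul] at h)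
    rw [eq_top_iff]
    intro x _
    have hle : Submodule.span ℂ (Set.range (rootFamily g)) ≤ S.toSubmodule := by
      rw [Submodule.span_le]
      rintro _ ⟨j | r, rfl⟩
      · refine (Submodule.span_le.mpr ?_) (hg.torus_mem_span_chevH j)
        rintro _ ⟨i, rfl⟩
        exact S.lie_mem (hE i) (hF i)
      · by_cases hr : (r : ℕ) < 36
        · exact h1 r hr
        · have h := h2 (r - 36) (by omega)
          rwa [Nat.sub_add_cancel (by omega)] at h
    exact hle (span_rootFamily hg.span trivial)
  linInd := hg.linearIndependent_chevH
  nondegen := by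
    rw [Matrix.nondegenerate_iff_det_ne_zero]
    intro h0
    have h := congrArg Matrix.det cartanE₆_inv
    rw [Matrix.det_mul, h0, zero_mul, Matrix.det_smul, Matrix.det_one] at h
    norm_num at h
  sl2 i := by
    have := simpleRoot_lt i
    have he : chevE g i ≠ 0 := hg.rootVec_ne_zero (by omega)
    have h2 := hg.lie_chevH_chevE i i
    rw [CartanMatrix.E₆_diag] at h2
    refine ⟨?_, rfl, ?_, ?_⟩
    · intro h0
      rw [h0, zero_lie] at h2
      have : (2 : ℂ) • chevE g i = 0 := by
        rw [h2, ← Int.cast_smul_eq_zsmul ℂ]; norm_num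
      exact he ((smul_eq_zero.mp this).resolve_left (by norm_num))
    · rw [h2, ← Int.cast_smul_eq_zsmul ℂ, ← Nat.cast_smul_eq_nsmul ℂ]; norm_num
    · rw [hg.lie_chevH_chevF, CartanMatrix.E₆_diag, ← Int.cast_smul_eq_zsmul ℂ,
        ← Nat.cast_smul_eq_nsmul ℂ, ← neg_smul]; norm_num
  lie_h_h := hg.lie_chevH_chevH
  lie_h_e := hg.lie_chevH_chevE
  lie_h_f := hg.lie_chevH_chevF
  lie_e_f_ne i j hij := by
    have hi := simpleRoot_lt i
    have hj := simpleRoot_lt j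
    have hinj : Function.Injective simpleRoot := by decide
    rw [chevE, chevF, lie_smul, hg.lie_simple_ne hi hj (fun h => hij (hinj h)), smul_zero]

/-- The Chevalley generators form a Lie algebra basis in the sense of `LieAlgebra.Basis`, whose Cartan
matrix is that of the root system with respect to a base. -/
theorem isTypeE6 (hg : Realizes g) : IsTypeE6 L := by
  have hfin : FiniteDimensional ℂ L := hg.rootBasis.finiteDimensional_of_finite
  have hk := hg.isKilling
  let b := hg.lieBasis
  refine ⟨hfin, hk, _, b.isCartanSubalgebra, b.base, b.baseSupportEquiv.symm, ?_⟩
  rw [b.cartanMatrix_base_eq, ← Matrix.reindex_symm, Equiv.symm_apply_apply]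
  rfl

end Realizes

end CREII

namespace CREII

/-! ### The signature of the Killing form -/

/-- An element of the split torus, as a combination of generators. All generators are eigenvectors
of its adjoint action, and only those of the Cartan subalgebra have eigenvalue zero. -/
def gradingVec : Lin ℕ := [((-3, 0), 27), ((-1, 0), 31), ((1, 0), 33), ((3, 0), 35)]

/-- The eigenvalues of `ad gradingVec` on the generators. -/
def gradingEig (k : ℕ) : ℤ := [
  -4, 3, 10, 7, 5, 3, 1, -1, 1, 8, -1, 6, -3, 4, -5, 2, 1, 8, -1, 6, -3, 4, -5, 2, 4, 2, -7, 0,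
  7, -2, -4, 0, 6, 0, 2, 0, -2, -6, 4, 2, -2, -4, -3, 11, 0, -5, 0, 9, -11, -9, -7, 3, 5, 7, -1,
  -8, 1, -6, 3, -4, 5, -2, -1, -8, 1, -6, 3, -4, 5, -2, 4, -3, -10, -7, -5, -3, -1, 1].getD k 0

lemma grading_test : ((List.range 78).all fun k =>
    brTest gradingVec [((1, 0), k)] [((gradingEig k, 0), k)]) = true := by
  decide +kernel

section Signature

variable {𝔤 : Type*} [LieRing 𝔤] [LieAlgebra ℝ 𝔤] {G : ℕ → 𝔤}

/-- The real family `G` is a basis of `𝔤` with the bracket relations of the generators. -/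
structure RealRealizes (G : ℕ → 𝔤) : Prop where
  realizes : Realizes fun k => (1 : ℂ) ⊗ₜ[ℝ] G k
  linInd : LinearIndependent ℝ fun k : Fin 78 => G k
  span : Submodule.span ℝ (Set.range fun k : Fin 78 => G k) = ⊤

namespace RealRealizes

lemma finiteDimensional (hG : RealRealizes G) : FiniteDimensional ℝ 𝔤 :=
  (Basis.mk hG.linInd hG.span.ge).finiteDimensional_of_finite

lemma finrank_eq (hG : RealRealizes G) : Module.finrank ℝ 𝔤 = 78 := by
  have h := finrank_span_eq_card hG.linInd
  rw [hG.span, finrank_top] at h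
  simpa using h

lemma killingForm_tmul (hG : RealRealizes G) (x y : 𝔤) :
    killingForm ℂ (ℂ ⊗[ℝ] 𝔤) (1 ⊗ₜ x) (1 ⊗ₜ y) = (killingForm ℝ 𝔤 x y : ℂ) := by
  have := hG.finiteDimensional
  have h := LieModule.traceForm_baseChange (R := ℝ) (L := 𝔤) (M := 𝔤) ℂ
  rw [killingForm, h, LinearMap.BilinForm.baseChange_tmul]
  simp [killingForm]

/-- Generators are orthogonal unless their eigenvalues under the grading element cancel. -/
lemma killingForm_eq_zero (hG : RealRealizes G) {k l : ℕ} (hk : k < 78) (hl : l < 78)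
    (h : gradingEig k + gradingEig l ≠ 0) : killingForm ℝ 𝔤 (G k) (G l) = 0 := by
  have key : ∀ k < 78, ⁅Lin.eval (fun k => (1 : ℂ) ⊗ₜ[ℝ] G k) gradingVec, (1 : ℂ) ⊗ₜ[ℝ] G k⁆ =
      (gradingEig k : ℂ) • (1 : ℂ) ⊗ₜ[ℝ] G k := by
    intro k hk
    have h1 := List.all_eq_true.mp grading_test k (List.mem_range.mpr hk)
    have h2 := hG.realizes.lie _ _ _ (brTest_eq h1)
    simp only [Lin.eval_cons (l := []), Lin.eval_nil, add_zero, toC_int] at h2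
    simpa using h2
  have h3 := killingForm_eq_zero_of_lie_eq_smul (key k hk) (key l hl) (by exact_mod_cast h)
  rw [hG.killingForm_tmul] at h3
  exact_mod_cast h3

lemma killingForm_torusVec (hG : RealRealizes G) (i j : Fin 6) :
    killingForm ℂ (ℂ ⊗[ℝ] 𝔤) (Lin.eval (fun k => (1 : ℂ) ⊗ₜ[ℝ] G k) (torusVec i))
      (Lin.eval (fun k => (1 : ℂ) ⊗ₜ[ℝ] G k) (torusVec j)) = gramMatrix i j := by
  have hg := hG.realizes
  have h := killingForm_torus hg.rootBasis (wt := fun r j => (rootWt r j : ℂ))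
    (fun i j => by simpa [rootFamily] using hg.lie_torus_torus i.2 j.2)
    (fun j r => by simpa [rootFamily] using hg.lie_torus_root j.2 r.2) i j
  rw [Realizes.coe_rootBasis] at h
  simp only [rootFamily, Sum.elim_inl] at h
  rw [h, ← sum_rootWt_mul]
  push_cast
  rfl

/-- The Killing form vanishes on a space spanned by generators with positive eigenvalues, and this
space is orthogonal to the generators with eigenvalue zero. -/
lemma killingForm_eq_zero_of_mem (hG : RealRealizes G) {S : Set (Fin 78)}
    (hS : ∀ k ∈ S, 0 ≤ gradingEig k) {x y : 𝔤}
    (hx : x ∈ Submodule.span ℝ ((fun k : Fin 78 => G k) '' S))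
    (hy : y ∈ Submodule.span ℝ ((fun k : Fin 78 => G k) '' {k | 0 < gradingEig k})) :
    killingForm ℝ 𝔤 x y = 0 := by
  induction hx using Submodule.span_induction with
  | mem x hx =>
    obtain ⟨k, hk, rfl⟩ := hx
    induction hy using Submodule.span_induction with
    | mem y hy =>
      obtain ⟨l, hl, rfl⟩ := hy
      have h1 := hS k hk
      have h2 : 0 < gradingEig l := hl
      exact hG.killingForm_eq_zero k.2 l.2 (by omega)
    | zero => simp
    | add a b _ _ ha hb => rw [map_add, ha, hb, add_zero]
    | smul c a _ ha => rw [map_smul, ha, smul_zero]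
  | zero => simp
  | add a b _ _ ha hb => rw [map_add, LinearMap.add_apply, ha, hb, add_zero]
  | smul c a _ ha => rw [map_smul, LinearMap.smul_apply, ha, smul_zero]

/-- The Killing form of the sum of an element of the torus and one of the positive part. -/
lemma killingForm_of_mem_union (hG : RealRealizes G) {S : Set (Fin 78)}
    (hS : ∀ k ∈ S, gradingEig k = 0) {x : 𝔤}
    (hx : x ∈ Submodule.span ℝ ((fun k : Fin 78 => G k) '' (S ∪ {k | 0 < gradingEig k}))) :
    ∃ t ∈ Submodule.span ℝ ((fun k : Fin 78 => G k) '' S),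
      killingForm ℝ 𝔤 x x = killingForm ℝ 𝔤 t t := by
  rw [Set.image_union, Submodule.span_union, Submodule.mem_sup] at hx
  obtain ⟨t, ht, n, hn, rfl⟩ := hx
  refine ⟨t, ht, ?_⟩
  have h1 := hG.killingForm_eq_zero_of_mem (fun k hk => (hS k hk).ge) ht hn
  have h2 := hG.killingForm_eq_zero_of_mem (fun k (hk : 0 < gradingEig k) => hk.le) hn hn
  have h3 : killingForm ℝ 𝔤 n t = 0 := by
    rw [killingForm, LieModule.traceForm_comm]; exact h1
  simp only [map_add, LinearMap.add_apply, h1, h2, h3, add_zero]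

lemma finrank_span (hG : RealRealizes G) (S : Finset (Fin 78)) :
    Module.finrank ℝ (Submodule.span ℝ ((fun k : Fin 78 => G k) '' (S : Set (Fin 78)))) = S.card := by
  have h := hG.linInd.comp ((↑) : S → Fin 78) Subtype.val_injective
  have h2 := finrank_span_eq_card h
  have h3 : Set.range ((fun k : Fin 78 => G k) ∘ ((↑) : S → Fin 78)) =
      (fun k : Fin 78 => G k) '' (S : Set (Fin 78)) := by
    rw [Set.range_comp]
    exact congrArg _ Subtype.range_coe
  have h4 := congrArg (fun T : Set 𝔤 => Module.finrank ℝ (Submodule.span ℝ T)) h3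
  rw [← h4, h2, Fintype.card_coe]

/-- The Killing form of a combination of elements of the split torus. -/
lemma killingForm_sum {n : ℕ} (s : Fin n → Fin 78)
    {M : Fin n → Fin n → ℝ} (hM : ∀ i j, killingForm ℝ 𝔤 (G (s i)) (G (s j)) = M i j) {t : 𝔤}
    (ht : t ∈ Submodule.span ℝ ((fun k : Fin 78 => G k) '' Set.range s)) :
    ∃ a : Fin n → ℝ, killingForm ℝ 𝔤 t t = ∑ i, ∑ j, a i * a j * M i j := by
  rw [← Set.range_comp, Submodule.mem_span_range_iff_exists_fun] at ht
  obtain ⟨a, rfl⟩ := ht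
  refine ⟨a, ?_⟩
  simp only [map_sum, LinearMap.sum_apply, map_smul, LinearMap.smul_apply, smul_eq_mul,
    Function.comp_apply, hM, Finset.mul_sum]
  rw [Finset.sum_comm]
  exact Finset.sum_congr rfl fun i _ => Finset.sum_congr rfl fun j _ => by ring

/-- The noncompact part of the Cartan subalgebra. -/
def splitGens : Fin 4 → Fin 78 := ![27, 31, 33, 35]

/-- The compact part of the Cartan subalgebra. -/
def compactGens : Fin 2 → Fin 78 := ![44, 46]

lemma killingForm_splitGens (hG : RealRealizes G) (i j : Fin 4) :
    killingForm ℝ 𝔤 (G (splitGens i)) (G (splitGens j)) =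
      gramMatrix (i.castLE (by omega)) (j.castLE (by omega)) := by
  have h := hG.killingForm_torusVec (i.castLE (by omega)) (j.castLE (by omega))
  have h1 : ∀ i : Fin 4, Lin.eval (fun k => (1 : ℂ) ⊗ₜ[ℝ] G k)
      (torusVec (i.castLE (by omega : 4 ≤ 6))) = (1 : ℂ) ⊗ₜ[ℝ] G (splitGens i) := by
    intro i
    fin_cases i <;> simp [torusVec, GInt.toC, splitGens]
  rw [h1, h1, hG.killingForm_tmul] at h
  exact_mod_cast h

lemma killingForm_compactGens (hG : RealRealizes G) (i j : Fin 2) :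
    killingForm ℝ 𝔤 (G (compactGens i)) (G (compactGens j)) =
      -gramMatrix (i.natAdd 4) (j.natAdd 4) := by
  have h := hG.killingForm_torusVec (i.natAdd 4) (j.natAdd 4)
  have h1 : ∀ i : Fin 2, Lin.eval (fun k => (1 : ℂ) ⊗ₜ[ℝ] G k)
      (torusVec (i.natAdd 4)) = (-Complex.I) • (1 : ℂ) ⊗ₜ[ℝ] G (compactGens i) := by
    intro i
    fin_cases i <;> simp [torusVec, GInt.toC, compactGens]
  rw [h1, h1, map_smul, map_smul, LinearMap.smul_apply, hG.killingForm_tmul, smul_eq_mul,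
    smul_eq_mul, ← mul_assoc, neg_mul_neg, Complex.I_mul_I] at h
  have h2 : (killingForm ℝ 𝔤 (G (compactGens i)) (G (compactGens j)) : ℂ) =
      ((-gramMatrix (i.natAdd 4) (j.natAdd 4) : ℤ) : ℂ) := by
    push_cast
    linear_combination -h
  exact_mod_cast h2

lemma killingForm_split_nonneg (hG : RealRealizes G) {t : 𝔤}
    (ht : t ∈ Submodule.span ℝ ((fun k : Fin 78 => G k) '' Set.range splitGens)) :
    0 ≤ killingForm ℝ 𝔤 t t := by
  obtain ⟨a, ha⟩ := killingForm_sum splitGens hG.killingForm_splitGens ht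
  have h : killingForm ℝ 𝔤 t t = 12 * (2 * a 0 - (a 2 + a 3)) ^ 2 + 12 * (2 * a 1 - (a 2 + a 3)) ^ 2
      + 24 * (a 2) ^ 2 + 24 * (a 3) ^ 2 := by
    rw [ha]
    simp [Fin.sum_univ_four, gramMatrix]
    ring
  rw [h]
  positivity

lemma killingForm_compact_nonpos (hG : RealRealizes G) {t : 𝔤}
    (ht : t ∈ Submodule.span ℝ ((fun k : Fin 78 => G k) '' Set.range compactGens)) :
    killingForm ℝ 𝔤 t t ≤ 0 := by
  obtain ⟨a, ha⟩ := killingForm_sum compactGens (M := fun i j =>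
    ((-gramMatrix (i.natAdd 4) (j.natAdd 4) : ℤ) : ℝ))
    (fun i j => by rw [hG.killingForm_compactGens]; push_cast; rfl) ht
  have h : killingForm ℝ 𝔤 t t = -(16 * (a 0) ^ 2 + 16 * (a 1) ^ 2 + 16 * (a 0 - a 1) ^ 2) := by
    rw [ha]
    simp [Fin.sum_univ_two, gramMatrix]
    ring
  rw [h]
  have : 0 ≤ 16 * (a 0) ^ 2 + 16 * (a 1) ^ 2 + 16 * (a 0 - a 1) ^ 2 := by positivity
  linarith

lemma finrank_span_union (hG : RealRealizes G) {n m : ℕ} (s : Fin n → Fin 78)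
    (hm : (Finset.univ.filter fun k : Fin 78 => (∃ i, s i = k) ∨ 0 < gradingEig k).card = m) :
    Module.finrank ℝ (Submodule.span ℝ ((fun k : Fin 78 => G k) ''
      (Set.range s ∪ {k | 0 < gradingEig k}))) = m := by
  have h : (Set.range s ∪ {k : Fin 78 | 0 < gradingEig k}) =
      ((Finset.univ.filter fun k : Fin 78 => (∃ i, s i = k) ∨ 0 < gradingEig k :
        Finset (Fin 78)) : Set (Fin 78)) := by
    ext k
    simp
  have h4 := congrArg (fun T : Set (Fin 78) => Module.finrank ℝ (Submodule.span ℝ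
    ((fun k : Fin 78 => G k) '' T))) h
  rw [← hm, ← hG.finrank_span]
  exact h4

/-- The Killing form of the real Lie algebra is nondegenerate, because that of its complexification
is. -/
theorem radical_eq_bot (hG : RealRealizes G) :
    (killingForm ℝ 𝔤).toQuadraticMap.radical = ⊥ := by
  have hk := hG.realizes.isKilling
  rw [eq_bot_iff]
  intro x hx
  have h1 := LinearMap.mem_ker.mp (QuadraticMap.radical_le_ker_polarBilin hx)
  have h2 : ∀ y, killingForm ℝ 𝔤 x y = 0 := by
    intro y
    have h3 := LinearMap.congr_fun h1 y
    have hs : killingForm ℝ 𝔤 y x = killingForm ℝ 𝔤 x y := LieModule.traceForm_comm ℝ 𝔤 𝔤 y x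
    simp only [QuadraticMap.polarBilin_apply_apply, QuadraticMap.polar,
      LinearMap.BilinMap.toQuadraticMap_apply, map_add, LinearMap.add_apply,
      LinearMap.zero_apply, hs] at h3
    linarith
  have h4 : (1 : ℂ) ⊗ₜ[ℝ] x ∈ LieIdeal.killingCompl ℂ (ℂ ⊗[ℝ] 𝔤) ⊤ := by
    rw [LieIdeal.mem_killingCompl]
    intro y _
    induction y using TensorProduct.induction_on with
    | zero => simp
    | tmul c y =>
      have : c ⊗ₜ[ℝ] y = c • (1 : ℂ) ⊗ₜ[ℝ] y := by rw [TensorProduct.smul_tmul', smul_eq_mul, mul_one]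
      have h5 := hG.killingForm_tmul y x
      have h6 : killingForm ℝ 𝔤 y x = 0 := by
        rw [killingForm, LieModule.traceForm_comm]; exact h2 y
      rw [this, map_smul, LinearMap.smul_apply, h5, h6]
      simp
    | add y z hy hz => rw [map_add, LinearMap.add_apply, hy trivial, hz trivial, add_zero]
  rw [LieAlgebra.IsKilling.killingCompl_top_eq_bot] at h4
  have h5 : (1 : ℂ) ⊗ₜ[ℝ] x = 0 := by simpa using h4
  have h6 := (Module.Flat.rTensor_preserves_injective_linearMap (M := 𝔤)
    (Algebra.linearMap ℝ ℂ) (algebraMap ℝ ℂ).injective)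
  have h7 : LinearMap.rTensor 𝔤 (Algebra.linearMap ℝ ℂ) ((1 : ℝ) ⊗ₜ x) =
      LinearMap.rTensor 𝔤 (Algebra.linearMap ℝ ℂ) 0 := by
    rw [LinearMap.rTensor_tmul, map_zero]; simpa using h5
  have h8 := congrArg (TensorProduct.lid ℝ 𝔤) (h6 h7)
  simpa using h8

/-- The Killing form is positive semidefinite on the sum of the split torus and the span of the
generators with positive eigenvalue, which has dimension `4 + 36`, and negative semidefinite on the
sum of the compact torus and that span, which has dimension `2 + 36`. As the form is nondegenerate on
a space of dimension `78`, these bounds determine its signature. -/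
theorem isEII (hG : RealRealizes G) : IsEII 𝔤 := by
  have hfin := hG.finiteDimensional
  have hsum := QuadraticForm.sigPos_add_sigNeg_add_radical (𝕜 := ℝ)
    (Q := (killingForm ℝ 𝔤).toQuadraticMap)
  rw [hG.radical_eq_bot, finrank_bot, hG.finrank_eq] at hsum
  have hpos : _root_.sigPos (killingForm ℝ 𝔤).toQuadraticMap + 38 ≤ 78 := by
    rw [← hG.finrank_eq, ← hG.finrank_span_union compactGens (m := 38) (by decide +kernel)]
    refine QuadraticForm.sigPos_add_finrank_le_of_nonpos fun x hx => ?_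
    obtain ⟨t, ht, h⟩ := hG.killingForm_of_mem_union (by decide +kernel) hx
    rw [LinearMap.BilinMap.toQuadraticMap_apply, h]
    exact hG.killingForm_compact_nonpos ht
  have hneg : _root_.sigNeg (killingForm ℝ 𝔤).toQuadraticMap + 40 ≤ 78 := by
    rw [← hG.finrank_eq, ← hG.finrank_span_union splitGens (m := 40) (by decide +kernel),
      ← sigPos_neg]
    refine QuadraticForm.sigPos_add_finrank_le_of_nonpos fun x hx => ?_
    obtain ⟨t, ht, h⟩ := hG.killingForm_of_mem_union (by decide +kernel) hx
    rw [neg_apply, LinearMap.BilinMap.toQuadraticMap_apply, h, neg_nonpos]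
    exact hG.killingForm_split_nonneg ht
  exact ⟨hG.realizes.isTypeE6, hfin, by omega, by omega⟩

end RealRealizes

end Signature

end CREII

namespace CREII

/-! ### The quadric and its tangent spaces -/

/-- The sign of the conjugate in the `j`-th equation `w_j ± w̄_j = Q_j(z, z̄)`. -/
def conjSign : Fin 8 → ℤ := ![1, 1, 1, -1, -1, 1, -1, 1]

/-- Coefficients of the forms `Q_j`, see `segre`. -/
def segreSign : Matrix (Fin 8) (Fin 8) ℤ :=
  !![1, 0, 0, 0, 0, 1, 1, 1;
    0, 1, 1, 1, 1, 0, 0, 0;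
    0, 1, 1, 0, 0, 1, 1, 0;
    0, 1, 0, -1, 0, 1, 0, -1;
    -1, 1, 1, 1, 1, -1, -1, -1;
    -1, -1, 1, 1, -1, -1, 1, 1;
    -1, 0, 1, 0, -1, 0, 1, 0;
    1, 0, 0, 1, 1, 0, 0, 1]

/-- Indices of the forms `Q_j`, see `segre`. -/
def segrePartner : Matrix (Fin 8) (Fin 8) (Fin 8) :=
  !![5, 0, 0, 0, 0, 0, 7, 6;
    0, 4, 3, 2, 1, 0, 0, 0;
    0, 6, 5, 0, 0, 2, 1, 0;
    0, 7, 0, 5, 0, 3, 0, 1;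
    1, 0, 7, 6, 5, 4, 3, 2;
    1, 0, 7, 6, 5, 4, 3, 2;
    2, 0, 0, 0, 6, 0, 4, 0;
    3, 0, 0, 0, 7, 0, 0, 4]

/-- The bilinear forms `Q_j(a, b)` for which the quadric has the equations
`w_j ± w̄_j = Q_j(z, z̄)`: the sum over `p` of `a_p b_q` with a sign (or zero), `q` being the
partner of `p` in the `j`-th form. -/
noncomputable def segre (a b : Fin 8 → ℂ) (j : Fin 8) : ℂ :=
  ∑ p, (segreSign j p : ℂ) * (a p * b (segrePartner j p))

lemma segre_add_left (a a' b : Fin 8 → ℂ) : segre (a + a') b = segre a b + segre a' b := by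
  funext j
  simp only [segre, Pi.add_apply, ← Finset.sum_add_distrib]
  exact Finset.sum_congr rfl fun p _ => by ring

lemma segre_add_right (a b b' : Fin 8 → ℂ) : segre a (b + b') = segre a b + segre a b' := by
  funext j
  simp only [segre, Pi.add_apply, ← Finset.sum_add_distrib]
  exact Finset.sum_congr rfl fun p _ => by ring

lemma segre_smul_left (c : ℂ) (a b : Fin 8 → ℂ) : segre (c • a) b = c • segre a b := by
  funext j
  simp only [segre, Pi.smul_apply, smul_eq_mul, Finset.mul_sum]
  exact Finset.sum_congr rfl fun p _ => by ring

lemma segre_smul_right (c : ℂ) (a b : Fin 8 → ℂ) : segre a (c • b) = c • segre a b := by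
  funext j
  simp only [segre, Pi.smul_apply, smul_eq_mul, Finset.mul_sum]
  exact Finset.sum_congr rfl fun p _ => by ring

/-- `segre` as a bilinear map. -/
noncomputable def segreBilin : (Fin 8 → ℂ) →ₗ[ℂ] (Fin 8 → ℂ) →ₗ[ℂ] (Fin 8 → ℂ) :=
  LinearMap.mk₂ ℂ segre segre_add_left segre_smul_left segre_add_right segre_smul_right

/-- The `z`-part of a vector. -/
abbrev zPart (p : Space) : Fin 8 → ℂ := fun j => p (.inl j)

/-- The `w`-part of a vector. -/
abbrev wPart (p : Space) : Fin 8 → ℂ := fun j => p (.inr j)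

/-- The complex form of the defining equations. -/
noncomputable def complexDefining (p : Space) (j : Fin 8) : ℂ :=
  wPart p j + conjSign j * starRingEnd ℂ (wPart p j) - segre (zPart p) (star (zPart p)) j

/-- The factor between `defining` and `complexDefining`. -/
noncomputable def defFactor (j : Fin 8) : ℂ := if conjSign j = 1 then 2 else 2 * Complex.I

lemma defFactor_ne_zero (j : Fin 8) : defFactor j ≠ 0 := by
  unfold defFactor; split_ifs <;> simp

lemma defFactor_mul_defining (p : Space) (j : Fin 8) :
    defFactor j * (defining p (j - 1) : ℂ) = complexDefining p j := by
  have h0 : (8 : Fin 8) = 0 := rfl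
  fin_cases j <;>
    simp [defining, complexDefining, defFactor, conjSign, segre, segreSign, segrePartner,
      Fin.sum_univ_eight, h0] <;>
    apply Complex.ext <;> simp <;> ring

lemma mem_quadric_iff {p : Space} : p ∈ quadric ↔ ∀ j, complexDefining p j = 0 := by
  constructor
  · intro h j
    rw [← defFactor_mul_defining]
    have : defining p = 0 := h
    simp [this]
  · intro h
    change defining p = 0
    funext k
    have := defFactor_mul_defining p (k + 1)
    rw [h, add_sub_cancel_right] at this
    simpa using (mul_eq_zero.mp this).resolve_left (defFactor_ne_zero _)

/-- The differential of `complexDefining`. -/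
noncomputable def complexDifferential (p v : Space) (j : Fin 8) : ℂ :=
  wPart v j + conjSign j * starRingEnd ℂ (wPart v j) -
    (segre (zPart v) (star (zPart p)) j + segre (zPart p) (star (zPart v)) j)

lemma complexDefining_add_smul (p v : Space) (t : ℝ) (j : Fin 8) :
    complexDefining (p + t • v) j = complexDefining p j + t * complexDifferential p v j -
      (t : ℂ) ^ 2 * segre (zPart v) (star (zPart v)) j := by
  have h1 : zPart (p + t • v) = zPart p + (t : ℂ) • zPart v := by
    funext i; simp [zPart]
  have h2 : star (zPart p + (t : ℂ) • zPart v) = star (zPart p) + (t : ℂ) • star (zPart v) := by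
    funext i; simp
  simp only [complexDefining, complexDifferential, h1, h2, segre_add_left, segre_add_right,
    segre_smul_left, segre_smul_right, Pi.add_apply, Pi.smul_apply, smul_eq_mul, wPart,
    Complex.real_smul, map_add, map_mul, Complex.conj_ofReal]
  ring

lemma defFactor_mul_fderiv (p v : Space) (j : Fin 8) :
    defFactor j * (fderiv ℝ defining p v (j - 1) : ℂ) = complexDifferential p v j := by
  have hd : HasFDerivAt defining (fderiv ℝ defining p) p :=
    ((contDiff_defining (n := 1)).differentiable (by simp) p).hasFDerivAt
  have hline : HasDerivAt (fun t : ℝ => p + t • v) v 0 := by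
    simpa using ((hasDerivAt_id (0 : ℝ)).smul_const v).const_add p
  have h1 : HasDerivAt (fun t : ℝ => defining (p + t • v)) (fderiv ℝ defining p v) 0 := by
    have hd' : HasFDerivAt defining (fderiv ℝ defining p) (p + (0 : ℝ) • v) := by simpa using hd
    exact hd'.comp_hasDerivAt (0 : ℝ) hline
  have h2 : HasDerivAt (fun t : ℝ => (defining (p + t • v) (j - 1) : ℂ))
      (fderiv ℝ defining p v (j - 1) : ℂ) 0 :=
    ((hasDerivAt_pi.mp h1) (j - 1)).ofReal_comp
  have h3 := h2.const_mul (defFactor j)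
  simp only [defFactor_mul_defining, complexDefining_add_smul] at h3
  have ht : HasDerivAt (fun t : ℝ => (t : ℂ)) 1 0 := by
    simpa using (hasDerivAt_id (0 : ℝ)).ofReal_comp
  have h4 : HasDerivAt (fun t : ℝ => complexDefining p j + (t : ℂ) * complexDifferential p v j -
      (t : ℂ) ^ 2 * segre (zPart v) (star (zPart v)) j) (complexDifferential p v j) 0 := by
    have := ((ht.mul_const (complexDifferential p v j)).const_add (complexDefining p j)).sub
      ((ht.pow 2).mul_const (segre (zPart v) (star (zPart v)) j))
    exact this.congr_deriv (by simp)
  exact h3.unique h4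

/-- A vector is tangent to the quadric iff the complex differentials vanish on it. -/
lemma mem_tangent_iff {p v : Space} : v ∈ tangent p ↔ ∀ j, complexDifferential p v j = 0 := by
  constructor
  · intro h j
    rw [← defFactor_mul_fderiv]
    have : fderiv ℝ defining p v = 0 := h
    simp [this]
  · intro h
    change fderiv ℝ defining p v = 0
    funext k
    have := defFactor_mul_fderiv p v (k + 1)
    rw [h, add_sub_cancel_right] at this
    simpa using (mul_eq_zero.mp this).resolve_left (defFactor_ne_zero _)

lemma fderiv_defining_shift (p : Space) (s : Fin 8 → ℝ) : fderiv ℝ defining p (shift s) = s := by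
  have hd : HasFDerivAt defining (fderiv ℝ defining p) p :=
    ((contDiff_defining (n := 1)).differentiable (by simp) p).hasFDerivAt
  have hline : HasDerivAt (fun t : ℝ => p + t • shift s) (shift s) 0 := by
    simpa using ((hasDerivAt_id (0 : ℝ)).smul_const (shift s)).const_add p
  have h1 : HasDerivAt (fun t : ℝ => defining (p + t • shift s))
      (fderiv ℝ defining p (shift s)) 0 := by
    have hd' : HasFDerivAt defining (fderiv ℝ defining p) (p + (0 : ℝ) • shift s) := by
      simpa using hd
    exact hd'.comp_hasDerivAt (0 : ℝ) hline
  have h2 : HasDerivAt (fun t : ℝ => defining p + t • s) s 0 := by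
    simpa using ((hasDerivAt_id (0 : ℝ)).smul_const s).const_add (defining p)
  refine h1.unique (h2.congr_of_eventuallyEq (Filter.Eventually.of_forall fun t => ?_))
  simp only
  rw [← map_smul, defining_add_shift]

lemma surjective_fderiv_defining (p : Space) : Function.Surjective (fderiv ℝ defining p) :=
  fun s => ⟨shift s, fderiv_defining_shift p s⟩

lemma finrank_space : Module.finrank ℝ Space = 32 := by
  rw [Module.finrank_pi_fintype]
  simp [Complex.finrank_real_complex]

lemma finrank_tangent (p : Space) : Module.finrank ℝ (tangent p) = 24 := by
  have h := LinearMap.finrank_range_add_finrank_ker (fderiv ℝ defining p).toLinearMap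
  rw [LinearMap.range_eq_top.mpr (surjective_fderiv_defining p), finrank_top, finrank_space] at h
  have h8 : Module.finrank ℝ (Fin 8 → ℝ) = 8 := by simp
  rw [h8] at h
  change Module.finrank ℝ (LinearMap.ker (fderiv ℝ defining p).toLinearMap) = 24
  omega

lemma J_J (v : Space) : J (J v) = -v := by
  change Complex.I • (Complex.I • v) = -v
  rw [smul_smul, Complex.I_mul_I, neg_one_smul]

/-- `J` maps the space of normal directions used by `shift` into the tangent space. -/
lemma J_shift_mem_tangent (p : Space) (s : Fin 8 → ℝ) : J (shift s) ∈ tangent p := by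
  rw [mem_tangent_iff]
  have hz : zPart (J (shift s)) = 0 := by
    funext i
    change Complex.I * (0 : ℂ) = 0
    simp
  intro j
  have h0 : ∀ a, segre 0 a = 0 := fun a => by simpa using segre_smul_left 0 0 a
  have h0' : ∀ a, segre a 0 = 0 := fun a => by simpa using segre_smul_right 0 a 0
  rw [complexDifferential, hz, star_zero, h0, h0']
  change Complex.I * _ + _ * starRingEnd ℂ (Complex.I * _) - (0 + 0) = 0
  fin_cases j <;> simp [shift, conjSign]

lemma tangent_sup_J (p : Space) : tangent p ⊔ (tangent p).map J = ⊤ := by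
  rw [eq_top_iff]
  intro v _
  have h1 : v - shift (fderiv ℝ defining p v) ∈ tangent p := by
    change fderiv ℝ defining p _ = 0
    rw [map_sub, fderiv_defining_shift, sub_self]
  have h2 : shift (fderiv ℝ defining p v) ∈ (tangent p).map J := by
    refine ⟨-J (shift (fderiv ℝ defining p v)), neg_mem (J_shift_mem_tangent p _), ?_⟩
    rw [map_neg, J_J, neg_neg]
  have := add_mem (Submodule.mem_sup_left (T := (tangent p).map J) h1)
    (Submodule.mem_sup_right (S := tangent p) h2)
  simpa using this

lemma finrank_tangent_inf_J (p : Space) :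
    Module.finrank ℝ ↥(tangent p ⊓ (tangent p).map J) = 16 := by
  have hJ : Function.Injective J := fun v v' h => by
    have := congrArg J h
    rwa [J_J, J_J, neg_inj] at this
  have h1 : Module.finrank ℝ ((tangent p).map J) = 24 := by
    rw [← finrank_tangent p]
    exact (Submodule.equivMapOfInjective J hJ (tangent p)).finrank_eq.symm
  have h := Submodule.finrank_sup_add_finrank_inf_eq (tangent p) ((tangent p).map J)
  rw [tangent_sup_J, finrank_top, finrank_space, finrank_tangent, h1] at h
  omega

end CREII

namespace CREII

/-! ### Weights of the generators -/

/-- Weight of a coordinate, by number. -/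
def coordWt (i : ℕ) : ℕ := bif Nat.blt (i % 16) 8 then 1 else 2

/-- Weighted degree of a monomial. -/
def monoWt : Mono → ℕ
  | [] => 0
  | u :: m => coordWt u + monoWt m

lemma weight_coord (i : ℕ) : weight (coord i) = coordWt i := by
  unfold coord coordWt
  split_ifs with h
  · have : Nat.blt (i % 16) 8 = true := by simpa [Nat.blt] using h
    simp [weight, this]
  · have : Nat.blt (i % 16) 8 = false := by
      rw [Bool.eq_false_iff]; simpa [Nat.blt] using h
    simp [weight, this]

lemma isWeightedHomogeneous_mono (m : Mono) :
    MvPolynomial.IsWeightedHomogeneous weight (Mono.val var m) (monoWt m : ℤ) := by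
  induction m with
  | nil => simpa [Mono.val, monoWt] using MvPolynomial.isWeightedHomogeneous_one ℂ weight
  | cons u m ih =>
    have h1 : Mono.val var (u :: m) = var u * Mono.val var m := by simp [Mono.val]
    rw [h1, monoWt]
    push_cast
    refine MvPolynomial.IsWeightedHomogeneous.mul ?_ ih
    rw [← weight_coord]
    exact MvPolynomial.isWeightedHomogeneous_X ℂ weight _

/-- Test for homogeneity of a sparse vector field. -/
def weightTest (k : ℤ) (F : SField) : Bool :=
  F.all fun t => ((monoWt t.2.1 : ℤ) - coordWt t.2.2 == k)

lemma val_mem_ofWeight {k : ℤ} {F : SField} (h : weightTest k F = true) :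
    SField.val F ∈ PolyField.ofWeight k := by
  induction F with
  | nil => exact zero_mem _
  | cons t F ih =>
    simp only [weightTest, List.all_cons, Bool.and_eq_true, beq_iff_eq] at h ih
    refine add_mem (Submodule.smul_mem _ _ ?_) (ih h.2)
    intro i _
    change (Pi.single (coord t.2.2) (Mono.val var t.2.1) : PolyField) i ∈ _
    by_cases hi : i = coord t.2.2
    · subst hi
      change _ ∈ MvPolynomial.weightedHomogeneousSubmodule ℂ weight (k + weight (coord t.2.2))
      rw [Pi.single_eq_same, weight_coord, ← h.1, sub_add_cancel]
      exact isWeightedHomogeneous_mono _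
    · rw [Pi.single_eq_of_ne hi]
      exact zero_mem _

/-- The weight of a generator. -/
def genWeight (k : ℕ) : ℤ :=
  if k < 8 then -2 else if k < 24 then -1 else if k < 54 then 0 else if k < 70 then 1 else 2

lemma weight_test : ((List.range 78).all fun k =>
    weightTest (genWeight k) (combData [((1, 0), k)])) = true := by
  decide +kernel

lemma val_combData_single (k : ℕ) : SField.val (combData [((1, 0), k)]) = gen k := by
  rw [val_combData]
  simp [GInt.toC]

lemma gen_mem_ofWeight {k : ℕ} (hk : k < 78) : gen k ∈ PolyField.ofWeight (genWeight k) := by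
  rw [← val_combData_single]
  exact val_mem_ofWeight (List.all_eq_true.mp weight_test k (List.mem_range.mpr hk))

/-! ### Linear independence of the generators -/

/-- The exponent vector of a monomial. -/
noncomputable def Mono.expo : Mono → Coord →₀ ℕ
  | [] => 0
  | u :: m => Finsupp.single (coord u) 1 + Mono.expo m

lemma Mono.val_var_eq_monomial (m : Mono) :
    Mono.val var m = MvPolynomial.monomial (Mono.expo m) (1 : ℂ) := by
  induction m with
  | nil => rfl
  | cons u m ih =>
    have h1 : Mono.val var (u :: m) = var u * Mono.val var m := by simp [Mono.val]
    rw [h1, ih, Mono.expo, var, MvPolynomial.X, MvPolynomial.monomial_mul, one_mul]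

/-- The multiplicity of a variable in a monomial. -/
def Mono.mult (v : ℕ) : Mono → ℕ
  | [] => 0
  | u :: m => bif Nat.beq (u % 16) (v % 16) then Mono.mult v m + 1 else Mono.mult v m

lemma Mono.expo_coord (v : ℕ) (m : Mono) : Mono.expo m (coord v) = Mono.mult v m := by
  induction m with
  | nil => rfl
  | cons u m ih =>
    simp only [Mono.expo, Finsupp.add_apply, ih, Finsupp.single_apply, coord_eq_iff, Mono.mult]
    cases h : Nat.beq (u % 16) (v % 16)
    · have h' : u % 16 ≠ v % 16 := fun e => by simp [e] at h
      simp [h']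
    · have h' : u % 16 = v % 16 := Nat.eq_of_beq_eq_true h
      simp [h', add_comm]

/-- Equality of monomials as polynomials. -/
def Mono.same (m k : Mono) : Bool :=
  (List.range 16).all fun v => Nat.beq (Mono.mult v m) (Mono.mult v k)

lemma exists_coord (c : Coord) : ∃ v < 16, coord v = c := by
  rcases c with j | j
  · exact ⟨zi j, by unfold zi; omega, coord_zi j⟩
  · exact ⟨wi j, by unfold wi; omega, coord_wi j⟩

lemma Mono.same_iff (m k : Mono) : Mono.same m k = true ↔ Mono.expo m = Mono.expo k := by
  constructor
  · intro h
    ext c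
    obtain ⟨v, hv, rfl⟩ := exists_coord c
    rw [Mono.expo_coord, Mono.expo_coord]
    exact Nat.eq_of_beq_eq_true (List.all_eq_true.mp h v (List.mem_range.mpr hv))
  · intro h
    refine List.all_eq_true.mpr fun v _ => ?_
    rw [← Mono.expo_coord, ← Mono.expo_coord, h]
    simp

/-- The coefficient of a polynomial vector field at a key. -/
noncomputable def coeffAt (k : Mono × ℕ) : PolyField →ₗ[ℂ] ℂ :=
  (MvPolynomial.lcoeff ℂ (Mono.expo k.1)).comp (LinearMap.proj (coord k.2))

/-- Test for two keys to define the same field. -/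
def sameKey (k l : Mono × ℕ) : Bool :=
  bif Nat.beq (k.2 % 16) (l.2 % 16) then Mono.same k.1 l.1 else false

lemma coeffAt_keyField (k l : Mono × ℕ) :
    coeffAt k (SField.keyField l) = if sameKey k l = true then 1 else 0 := by
  change MvPolynomial.coeff (Mono.expo k.1)
    ((Pi.single (coord l.2) (Mono.val var l.1) : PolyField) (coord k.2)) = _
  unfold sameKey
  cases h : Nat.beq (k.2 % 16) (l.2 % 16)
  · have h' : coord k.2 ≠ coord l.2 := fun e => by
      have := coord_eq_iff.mp e
      simp [this] at h
    simp [Pi.single_eq_of_ne h']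
  · rw [coord_eq_iff.mpr (Nat.eq_of_beq_eq_true h), Pi.single_eq_same, Mono.val_var_eq_monomial,
      MvPolynomial.coeff_monomial, cond_true]
    by_cases he : Mono.expo k.1 = Mono.expo l.1
    · rw [if_pos he.symm, if_pos ((Mono.same_iff _ _).mpr he)]
    · rw [if_neg fun e => he e.symm, if_neg fun e => he ((Mono.same_iff _ _).mp e)]

/-- The value of a combination of coefficient functionals on sparse data. -/
def dualVal (l : Lin (Mono × ℕ)) (F : SField) : GInt :=
  l.foldr (fun s acc => F.foldr (fun t acc =>
    bif sameKey s.2 t.2 then GInt.add (GInt.mul s.1 t.1) acc else acc) acc) (0, 0)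

lemma toC_dualVal (l : Lin (Mono × ℕ)) (F : SField) :
    (Lin.eval coeffAt l) (SField.val F) = GInt.toC (dualVal l F) := by
  have h0 : GInt.toC (0, 0) = 0 := by simp [GInt.toC]
  have key : ∀ (s : GInt × (Mono × ℕ)) (acc : GInt),
      GInt.toC (F.foldr (fun t acc =>
        bif sameKey s.2 t.2 then GInt.add (GInt.mul s.1 t.1) acc else acc) acc) =
      GInt.toC s.1 * coeffAt s.2 (SField.val F) + GInt.toC acc := by
    intro s acc
    induction F with
    | nil => simp [SField.val]
    | cons t F ih =>
      simp only [SField.val, Lin.eval_cons, List.foldr_cons, map_add, map_smul, smul_eq_mul,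
        coeffAt_keyField] at ih ⊢
      cases h : sameKey s.2 t.2
      · simp [ih]
      · simp only [cond_true, GInt.toC_add, GInt.toC_mul, ih, if_true]
        ring
  unfold dualVal
  induction l with
  | nil => simp [h0]
  | cons s l ih => rw [List.foldr_cons, key, ← ih, Lin.eval_cons]; simp

/-- Coefficient functionals dual to the generators, up to a factor: the `k`-th entry takes the value
`n` on the `k`-th generator and vanishes on the other ones. -/
def dualTab : List (ℤ × Lin (Mono × ℕ)) := [
  (1, [((1, 0), ([], 11))]),
  (1, [((1, 0), ([], 12))]),
  (1, [((1, 0), ([], 14))]),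
  (1, [((0, -1), ([], 9))]),
  (1, [((0, -1), ([], 10))]),
  (1, [((0, -1), ([], 13))]),
  (1, [((0, -1), ([], 15))]),
  (1, [((0, -1), ([], 8))]),
  (2, [((1, 0), ([4], 9)), ((1, 0), ([], 1))]),
  (2, [((1, 0), ([3], 9)), ((1, 0), ([], 2))]),
  (2, [((1, 0), ([2], 9)), ((1, 0), ([], 3))]),
  (2, [((1, 0), ([1], 9)), ((1, 0), ([], 4))]),
  (2, [((1, 0), ([2], 10)), ((1, 0), ([], 5))]),
  (2, [((1, 0), ([1], 10)), ((1, 0), ([], 6))]),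
  (2, [((1, 0), ([1], 11)), ((1, 0), ([], 7))]),
  (2, [((1, 0), ([1], 12)), ((1, 0), ([], 0))]),
  (2, [((0, 1), ([4], 9)), ((0, -1), ([], 1))]),
  (2, [((0, 1), ([3], 9)), ((0, -1), ([], 2))]),
  (2, [((0, 1), ([2], 9)), ((0, -1), ([], 3))]),
  (2, [((0, 1), ([1], 9)), ((0, -1), ([], 4))]),
  (2, [((0, 1), ([2], 10)), ((0, -1), ([], 5))]),
  (2, [((0, 1), ([1], 10)), ((0, -1), ([], 6))]),
  (2, [((0, 1), ([1], 11)), ((0, -1), ([], 7))]),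
  (2, [((0, 1), ([1], 12)), ((0, -1), ([], 0))]),
  (1, [((1, 0), ([13], 9))]),
  (1, [((1, 0), ([13], 10))]),
  (1, [((1, 0), ([12], 11))]),
  (1, [((1, 0), ([12], 12))]),
  (2, [((1, 0), ([11], 12))]),
  (2, [((-1, 0), ([10], 13))]),
  (2, [((1, 0), ([9], 13))]),
  (2, [((-1, 0), ([4], 4)), ((1, 0), ([6], 6)), ((2, 0), ([9], 9)), ((-1, 0), ([14], 14))]),
  (1, [((1, 0), ([7], 1))]),
  (2, [((-1, 0), ([2], 2)), ((1, 0), ([0], 0)), ((2, 0), ([9], 9)), ((-1, 0), ([14], 14))]),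
  (1, [((1, 0), ([5], 3))]),
  (2, [((-1, 0), ([2], 2)), ((-2, 0), ([4], 4)), ((2, 0), ([6], 6)), ((1, 0), ([0], 0)), ((2, 0), ([9], 9)), ((-1, 0), ([14], 14))]),
  (1, [((1, 0), ([3], 5))]),
  (1, [((1, 0), ([1], 7))]),
  (1, [((0, 1), ([12], 9))]),
  (1, [((0, -1), ([12], 10))]),
  (2, [((0, -1), ([10], 12))]),
  (2, [((0, 1), ([9], 12))]),
  (1, [((0, -1), ([6], 1))]),
  (1, [((0, -1), ([5], 2))]),
  (2, [((0, -1), ([2], 2)), ((0, -1), ([0], 0)), ((0, 1), ([14], 14))]),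
  (1, [((0, -1), ([4], 1))]),
  (2, [((0, -1), ([4], 4)), ((0, -1), ([6], 6)), ((0, 1), ([14], 14))]),
  (1, [((0, -1), ([3], 2))]),
  (1, [((0, -1), ([2], 5))]),
  (1, [((0, -1), ([2], 3))]),
  (1, [((0, -1), ([13], 11))]),
  (1, [((0, -1), ([1], 6))]),
  (1, [((0, -1), ([1], 4))]),
  (2, [((0, -1), ([11], 13))]),
  (4, [((-1, 0), ([9], 4)), ((1, 0), ([1, 1], 1))]),
  (4, [((1, 0), ([9], 3)), ((-1, 0), ([1, 2], 1))]),
  (4, [((1, 0), ([9], 2)), ((-1, 0), ([1, 3], 1))]),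
  (4, [((-1, 0), ([9], 1)), ((1, 0), ([1, 4], 1))]),
  (4, [((-1, 0), ([10], 2)), ((1, 0), ([1, 5], 1))]),
  (4, [((1, 0), ([10], 1)), ((-1, 0), ([1, 6], 1))]),
  (4, [((1, 0), ([11], 1)), ((-1, 0), ([1, 7], 1))]),
  (4, [((-2, 0), ([12], 1)), ((1, 0), ([2, 7], 1))]),
  (4, [((0, -1), ([9], 4)), ((0, -1), ([1, 1], 1))]),
  (4, [((0, -1), ([9], 3)), ((0, -1), ([1, 2], 1))]),
  (4, [((0, -1), ([9], 2)), ((0, -1), ([1, 3], 1))]),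
  (4, [((0, -1), ([9], 1)), ((0, -1), ([1, 4], 1))]),
  (4, [((0, -1), ([10], 2)), ((0, -1), ([1, 5], 1))]),
  (4, [((0, -1), ([10], 1)), ((0, -1), ([1, 6], 1))]),
  (4, [((0, -1), ([11], 1)), ((0, -1), ([1, 7], 1))]),
  (4, [((0, -2), ([12], 1)), ((0, -1), ([2, 7], 1))]),
  (4, [((1, 0), ([1, 11], 1))]),
  (2, [((-1, 0), ([9, 12], 9))]),
  (4, [((1, 0), ([6, 9], 1))]),
  (4, [((0, -1), ([1, 9], 1))]),
  (4, [((0, -1), ([1, 10], 1))]),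
  (2, [((0, 1), ([9, 13], 9))]),
  (4, [((0, -1), ([7, 9], 1))]),
  (4, [((0, -1), ([7, 10], 1))])]

lemma dual_test : ((List.range 78).all fun l =>
    (fun F => (List.range 78).all fun k =>
      GInt.isZero (GInt.add (dualVal (dualTab.getD k (0, [])).2 F)
        (bif Nat.beq k l then (-(dualTab.getD k (0, [])).1, 0) else (0, 0))))
    (combData [((1, 0), l)])) = true := by
  decide +kernel

lemma dual_ne_zero : ∀ k < 78, (dualTab.getD k (0, [])).1 ≠ 0 := by
  decide +kernel

lemma dual_gen {k l : ℕ} (hk : k < 78) (hl : l < 78) :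
    (Lin.eval coeffAt (dualTab.getD k (0, [])).2) (gen l) =
      if k = l then ((dualTab.getD k (0, [])).1 : ℂ) else 0 := by
  have h := List.all_eq_true.mp (List.all_eq_true.mp dual_test l (List.mem_range.mpr hl)) k
    (List.mem_range.mpr hk)
  have h2 := GInt.toC_isZero h
  rw [GInt.toC_add, ← toC_dualVal, val_combData_single] at h2
  by_cases hkl : k = l
  · have hb : Nat.beq k l = true := by simp [hkl]
    rw [hb, cond_true, toC_int] at h2
    rw [if_pos hkl, ← sub_eq_zero, ← h2]
    push_cast; ring
  · have hb : Nat.beq k l = false := Bool.eq_false_iff.mpr fun h => hkl (Nat.eq_of_beq_eq_true h)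
    rw [hb, cond_false] at h2
    rw [if_neg hkl, ← h2]
    simp [GInt.toC]

theorem linearIndependent_gen : LinearIndependent ℂ fun k : Fin 78 => gen k := by
  rw [Fintype.linearIndependent_iff]
  intro a ha k
  have h := congrArg (Lin.eval coeffAt (dualTab.getD k (0, [])).2 : PolyField →ₗ[ℂ] ℂ) ha
  simp only [map_sum, map_smul, map_zero, dual_gen k.2 (Fin.is_lt _), smul_eq_mul] at h
  rw [Finset.sum_eq_single k] at h
  · rw [if_pos rfl] at h
    exact (mul_eq_zero.mp h).resolve_right (by exact_mod_cast dual_ne_zero k k.2)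
  · intro l _ hl
    rw [if_neg (fun e => hl (Fin.ext e.symm)), mul_zero]
  · simp

end CREII

namespace CREII

/-! ### Tangency of the generators -/

/-- Substitution of sparse polynomials into a monomial. -/
def Mono.subst (σ : ℕ → SPoly) : Mono → SPoly
  | [] => [((1, 0), [])]
  | u :: m => SPoly.mul (σ u) (Mono.subst σ m)

namespace SPoly

/-- Substitution of sparse polynomials into a sparse polynomial. -/
def subst (σ : ℕ → SPoly) (q : SPoly) : SPoly :=
  q.flatMap fun t => Lin.scale t.1 (Mono.subst σ t.2)

/-- Complex conjugation of the coefficients. -/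
def conj (q : SPoly) : SPoly := q.map fun t => ((t.1.1, -t.1.2), t.2)

lemma val_mono_subst (ν : ℕ → ℂ) (σ : ℕ → SPoly) (m : Mono) :
    val ν (Mono.subst σ m) = Mono.val (fun u => val ν (σ u)) m := by
  induction m with
  | nil => simp [Mono.subst, val, Mono.val, GInt.toC]
  | cons u m ih => rw [Mono.subst, val_mul, ih]; simp [Mono.val]

lemma val_subst (ν : ℕ → ℂ) (σ : ℕ → SPoly) (q : SPoly) :
    val ν (subst σ q) = val (fun u => val ν (σ u)) q := by
  rw [val, subst, Lin.eval_flatMap, val, Lin.eval_eq_sum]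
  have h : ∀ q, Lin.eval (Mono.val ν) q = val ν q := fun _ => rfl
  simp only [h, val_scale, val_mono_subst]

lemma conj_val (ν : ℕ → ℂ) (q : SPoly) :
    starRingEnd ℂ (val ν q) = val (fun u => starRingEnd ℂ (ν u)) (conj q) := by
  induction q with
  | nil => simp [val, conj]
  | cons t q ih =>
    have h1 : starRingEnd ℂ (GInt.toC t.1) = GInt.toC (t.1.1, -t.1.2) := by
      simp [GInt.toC]
    have h2 : starRingEnd ℂ (Mono.val ν t.2) = Mono.val (fun u => starRingEnd ℂ (ν u)) t.2 := by
      rw [Mono.val, map_list_prod, List.map_map]; rfl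
    simp only [val, conj, List.map_cons, Lin.eval_cons, smul_eq_mul, map_add, map_mul] at ih ⊢
    rw [ih, h1, h2]

lemma eval_val (p : Space) (q : SPoly) :
    MvPolynomial.eval p (val var q) = val (fun u => p (coord u)) q := by
  induction q with
  | nil => simp [val]
  | cons t q ih =>
    have h2 : MvPolynomial.eval p (Mono.val var t.2) = Mono.val (fun u => p (coord u)) t.2 := by
      rw [Mono.val, map_list_prod, List.map_map]
      congr 2
      funext u
      simp [var]
    simp only [val, Lin.eval_cons, map_add, MvPolynomial.smul_eval, smul_eq_mul] at ih ⊢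
    rw [ih, h2]

end SPoly

/-- The coordinates of a point and their conjugates, numbered from `0` to `15` and from `16` on. -/
noncomputable def conjVal (p : Space) (n : ℕ) : ℂ :=
  if n < 16 then p (coord n) else starRingEnd ℂ (p (coord n))

/-- The form `segre` on sparse polynomials. -/
def segreData (α β : Fin 8 → SPoly) (j : Fin 8) : SPoly :=
  (List.finRange 8).flatMap fun p =>
    Lin.scale (segreSign j p, 0) (SPoly.mul (α p) (β (segrePartner j p)))

lemma val_segreData (ν : ℕ → ℂ) (α β : Fin 8 → SPoly) (j : Fin 8) :
    SPoly.val ν (segreData α β j) =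
      segre (fun p => SPoly.val ν (α p)) (fun p => SPoly.val ν (β p)) j := by
  rw [SPoly.val, segreData, Lin.eval_flatMap, segre, Fin.sum_univ_def]
  have h : ∀ q, Lin.eval (Mono.val ν) q = SPoly.val ν q := fun _ => rfl
  simp only [h, SPoly.val_scale, SPoly.val_mul, toC_int, smul_eq_mul]

/-- The variables `z`. -/
def zData (j : Fin 8) : SPoly := [((1, 0), [zi j])]

/-- The variables `z̄`. -/
def zetaData (j : Fin 8) : SPoly := [((1, 0), [16 + j.val])]

/-- A coordinate, on the quadric. -/
def holSubst (u : ℕ) : SPoly := [((1, 0), [u % 16])]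

/-- The conjugate of a coordinate, expressed on the quadric by `z`, `z̄` and `w`. -/
def conjSubst (u : ℕ) : SPoly :=
  bif Nat.blt (u % 16) 8 then [((1, 0), [16 + u % 16])]
  else Lin.scale (conjSign (Fin.ofNat 8 u), 0)
    (segreData zData zetaData (Fin.ofNat 8 u) ++ [((-1, 0), [u % 16])])

lemma val_holSubst (p : Space) (u : ℕ) : SPoly.val (conjVal p) (holSubst u) = p (coord u) := by
  have h : coord (u % 16) = coord u := coord_eq_iff.mpr (by simp)
  have h' : u % 16 < 16 := by omega
  simp [SPoly.val, holSubst, GInt.toC, Mono.val, conjVal, h, h']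

lemma val_zData (p : Space) (j : Fin 8) : SPoly.val (conjVal p) (zData j) = zPart p j := by
  have h' : zi j < 16 := by unfold zi; omega
  simp [SPoly.val, zData, GInt.toC, Mono.val, conjVal, h', coord_zi]

lemma val_zetaData (p : Space) (j : Fin 8) :
    SPoly.val (conjVal p) (zetaData j) = star (zPart p) j := by
  have h : coord (16 + j.val) = .inl j := by
    rw [← coord_zi, coord_eq_iff, zi]; omega
  simp [SPoly.val, zetaData, GInt.toC, Mono.val, conjVal, h]

lemma val_conjSubst {p : Space} (hp : p ∈ quadric) (u : ℕ) :
    SPoly.val (conjVal p) (conjSubst u) = starRingEnd ℂ (p (coord u)) := by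
  have h16 : coord (u % 16) = coord u := coord_eq_iff.mpr (by simp)
  unfold conjSubst
  cases h : Nat.blt (u % 16) 8
  · have h8 : ¬ u % 16 < 8 := by
      rw [Bool.eq_false_iff] at h; simpa [Nat.blt] using h
    have hc : coord u = .inr (Fin.ofNat 8 u) := by
      rw [← coord_wi, coord_eq_iff, wi]
      simp only [Fin.ofNat]
      omega
    have hq := mem_quadric_iff.mp hp (Fin.ofNat 8 u)
    have hh : SPoly.val (conjVal p) [((-1, 0), [u % 16])] = -p (coord u) := by
      have h' : u % 16 < 16 := by omega
      simp [SPoly.val, GInt.toC, Mono.val, conjVal, h16, h']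
    have hs : (conjSign (Fin.ofNat 8 u) : ℂ) * conjSign (Fin.ofNat 8 u) = 1 := by
      generalize Fin.ofNat 8 u = j
      fin_cases j <;> simp [conjSign]
    rw [cond_false, SPoly.val_scale, SPoly.val_add, val_segreData, hh, toC_int, smul_eq_mul]
    simp only [val_zData, val_zetaData]
    rw [complexDefining] at hq
    simp only [wPart, ← hc] at hq
    linear_combination (-(conjSign (Fin.ofNat 8 u) : ℂ)) * hq +
      (starRingEnd ℂ (p (coord u))) * hs
  · have h8 : u % 16 < 8 := by simpa [Nat.blt] using h
    have h2 : coord (16 + u % 16) = coord u := coord_eq_iff.mpr (by omega)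
    simp [SPoly.val, GInt.toC, Mono.val, conjVal, h2]

/-- The `j`-th tangency condition for a sparse vector field, as a polynomial in `z`, `w`, `z̄`. -/
def tangencyData (F : SField) (j : Fin 8) : SPoly :=
  (SPoly.subst holSubst (SField.comp F (wi j)) ++
    Lin.scale (conjSign j, 0) (SPoly.subst conjSubst (SPoly.conj (SField.comp F (wi j))))) ++
  Lin.scale (-1, 0)
    (segreData (fun p => SPoly.subst holSubst (SField.comp F (zi p))) zetaData j ++
      segreData zData (fun p => SPoly.subst conjSubst (SPoly.conj (SField.comp F (zi p)))) j)

lemma val_tangencyData (F : SField) {p : Space} (hp : p ∈ quadric) (j : Fin 8) :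
    SPoly.val (conjVal p) (tangencyData F j) =
      complexDifferential p (fun i => MvPolynomial.eval p (SField.val F i)) j := by
  have h1 : ∀ i, SPoly.val (conjVal p) (SPoly.subst holSubst (SField.comp F i)) =
      MvPolynomial.eval p (SField.val F (coord i)) := fun i => by
    rw [SPoly.val_subst, ← SField.val_comp, SPoly.eval_val]
    simp only [val_holSubst]
  have h2 : ∀ i, SPoly.val (conjVal p) (SPoly.subst conjSubst (SPoly.conj (SField.comp F i))) =
      starRingEnd ℂ (MvPolynomial.eval p (SField.val F (coord i))) := fun i => by
    rw [SPoly.val_subst, ← SField.val_comp, SPoly.eval_val, SPoly.conj_val]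
    simp only [val_conjSubst hp]
  have hm : GInt.toC (-1, 0) = -1 := by simp [GInt.toC]
  simp only [tangencyData, SPoly.val_add, SPoly.val_scale, val_segreData, h1, h2, val_zData,
    val_zetaData, coord_zi, coord_wi, complexDifferential, toC_int, hm, smul_eq_mul]
  rw [neg_one_mul, ← sub_eq_add_neg]
  rfl

/-- The generators of weight at most `0` and the first one of weight `1` are tangent to the
quadric. -/
lemma tangency_test : ((List.range 55).all fun k => (fun F => (List.finRange 8).all fun j =>
    Lin.eqv (tangencyData F j) []) (combData [((1, 0), k)])) = true := by
  decide +kernel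

/-- The generators numbered from `55` on as multiples of brackets of earlier ones: the entry
`(a, b, n)` says that `⁅G a, G b⁆ = n • G k`. -/
def bracketTab : List (ℕ × ℕ × ℤ) := [
  (26, 54, -1), (25, 54, -1), (25, 55, 1), (24, 54, -1), (24, 55, 1), (24, 56, 1), (24, 57, -1),
  (40, 56, -1), (26, 62, 1), (25, 62, 1), (25, 63, -1), (24, 62, -1), (24, 63, 1), (24, 64, 1),
  (24, 65, -1), (54, 60, -2), (54, 61, -2), (55, 61, -2), (54, 65, -2), (54, 67, -2), (54, 69,
  -2), (56, 69, 2), (58, 69, -2)]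

lemma bracketTab_test : ((List.range 23).all fun k => (fun s : ℕ × ℕ × ℤ =>
    brTest [((1, 0), s.1)] [((1, 0), s.2.1)] [((s.2.2, 0), k + 55)])
      (bracketTab.getD k (0, 0, 0))) = true := by
  decide +kernel

lemma bracketTab_lt : ∀ k < 23, (bracketTab.getD k (0, 0, 0)).1 < k + 55 ∧
    (bracketTab.getD k (0, 0, 0)).2.1 < k + 55 ∧ (bracketTab.getD k (0, 0, 0)).2.2 ≠ 0 := by
  decide +kernel

/-- The listed fields are infinitesimal symmetries: a direct check for those of weight at most `0`
and the first one of weight `1`, which together generate the others. -/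
theorem restrict_gen_mem_hol (U : TopologicalSpace.Opens Space) {k : ℕ} (hk : k < 78) :
    PolyField.restrict U (gen k) ∈ hol U := by
  induction k using Nat.strong_induction_on with
  | _ k ih =>
    by_cases h55 : k < 55
    · intro p hp hpU
      rw [mem_tangent_iff]
      intro j
      rw [PolyField.restrict_apply _ hpU, ← val_combData_single, ← val_tangencyData _ hp]
      have h := List.all_eq_true.mp (List.all_eq_true.mp tangency_test k (List.mem_range.mpr h55))
        j (List.mem_finRange j)
      exact Lin.eval_eq_of_eqv (Mono.val (conjVal p)) h
    · obtain ⟨m, rfl⟩ : ∃ m, k = m + 55 := ⟨k - 55, by omega⟩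
      have hm : m < 23 := by omega
      have h := brTest_eq (List.all_eq_true.mp bracketTab_test m (List.mem_range.mpr hm))
      obtain ⟨ha, hb, hn⟩ := bracketTab_lt m hm
      simp only [Lin.eval_cons, Lin.eval_nil, add_zero, toC_int, Int.cast_one, one_smul] at h
      have h2 := (hol U).lie_mem (ih _ ha (ha.trans hk)) (ih _ hb (hb.trans hk))
      rw [← PolyField.restrict_bracket, h, map_smul] at h2
      have h3 := (hol U).smul_mem ((bracketTab.getD m (0, 0, 0)).2.2 : ℝ)⁻¹ h2
      have h4 : ((bracketTab.getD m (0, 0, 0)).2.2 : ℝ)⁻¹ •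
          ((bracketTab.getD m (0, 0, 0)).2.2 : ℂ) • PolyField.restrict U (gen (m + 55)) =
          PolyField.restrict U (gen (m + 55)) := by
        have h5 : ((bracketTab.getD m (0, 0, 0)).2.2 : ℂ) ≠ 0 := by exact_mod_cast hn
        change ((((bracketTab.getD m (0, 0, 0)).2.2 : ℝ)⁻¹ : ℝ) : ℂ) •
          (((bracketTab.getD m (0, 0, 0)).2.2 : ℂ) • PolyField.restrict U (gen (m + 55))) = _
        rw [smul_smul]
        push_cast
        rw [inv_mul_cancel₀ h5, one_smul]
      rwa [h4] at h3

end CREII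

namespace CREII

/-! ### The tangency condition along the quadric -/

/-- The forms `Q_j` are Hermitian up to sign. -/
lemma conj_segre (a b : Fin 8 → ℂ) (j : Fin 8) :
    starRingEnd ℂ (segre a (star b) j) = conjSign j * segre b (star a) j := by
  fin_cases j <;>
    simp [segre, segreSign, segrePartner, conjSign, Fin.sum_univ_eight] <;> ring

/-- The vector `(v, Q(v, ζ))`; for `ζ = z̄` it is a CR tangent vector of the quadric. -/
noncomputable def crVec (v ζ : Fin 8 → ℂ) : Space := Sum.elim v (segre v ζ)

lemma crVec_smul (c : ℂ) (v ζ : Fin 8 → ℂ) : crVec (c • v) ζ = c • crVec v ζ := by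
  funext i
  rcases i with i | i
  · rfl
  · exact congrFun (segre_smul_left c v ζ) i

/-- A curve in the quadric with a given CR tangent vector as velocity. -/
noncomputable def crCurve (p : Space) (v : Fin 8 → ℂ) (t : ℝ) : Space :=
  p + t • crVec v (star (zPart p)) + (t ^ 2 / 2) • (Sum.elim 0 (segre v (star v)) : Space)

lemma zPart_crCurve (p : Space) (v : Fin 8 → ℂ) (t : ℝ) :
    zPart (crCurve p v t) = zPart p + (t : ℂ) • v := by
  funext i
  simp [crCurve, zPart, crVec]

lemma crCurve_mem_quadric {p : Space} (hp : p ∈ quadric) (v : Fin 8 → ℂ) (t : ℝ) :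
    crCurve p v t ∈ quadric := by
  rw [mem_quadric_iff] at hp ⊢
  intro j
  have h1 := conj_segre v (zPart p) j
  have h2 := conj_segre v v j
  have h3 : (conjSign j : ℂ) * conjSign j = 1 := by fin_cases j <;> simp [conjSign]
  have h4 : star (zPart p + (t : ℂ) • v) = star (zPart p) + (t : ℂ) • star v := by
    funext i; simp
  have h0 := hp j
  rw [complexDefining] at h0 ⊢
  rw [zPart_crCurve, h4]
  have hw : wPart (crCurve p v t) j = wPart p j + t * segre v (star (zPart p)) j +
      (t : ℂ) ^ 2 / 2 * segre v (star v) j := by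
    simp [crCurve, wPart, crVec]
  rw [hw]
  simp only [segre_add_left, segre_add_right, segre_smul_left, segre_smul_right, Pi.add_apply,
    Pi.smul_apply, smul_eq_mul, map_add, map_mul, map_div₀, map_pow, Complex.conj_ofReal,
    Complex.conj_ofNat, h1, h2]
  linear_combination h0 + (t * segre (zPart p) (star v) j +
    (t : ℂ) ^ 2 / 2 * segre v (star v) j) * h3

lemma hasDerivAt_crCurve (p : Space) (v : Fin 8 → ℂ) :
    HasDerivAt (crCurve p v) (crVec v (star (zPart p))) 0 := by
  have h1 := ((hasDerivAt_id (0 : ℝ)).smul_const (crVec v (star (zPart p)))).const_add p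
  have h2 := (((hasDerivAt_id (0 : ℝ)).pow 2).div_const 2).smul_const
    (Sum.elim 0 (segre v (star v)) : Space)
  have h3 := h1.add h2
  simp only [id, one_smul] at h3
  refine HasDerivAt.congr_deriv (f := crCurve p v) h3 ?_
  simp

lemma crCurve_zero (p : Space) (v : Fin 8 → ℂ) : crCurve p v 0 = p := by simp [crCurve]

lemma hasDerivAt_segre {a b : ℝ → Fin 8 → ℂ} {a' b' : Fin 8 → ℂ} {t : ℝ}
    (ha : HasDerivAt a a' t) (hb : HasDerivAt b b' t) (j : Fin 8) :
    HasDerivAt (fun s => segre (a s) (b s) j) (segre a' (b t) j + segre (a t) b' j) t := by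
  have h := HasDerivAt.fun_sum (u := Finset.univ) fun p _ =>
    (((hasDerivAt_pi.mp ha) p).mul ((hasDerivAt_pi.mp hb) (segrePartner j p))).const_mul
      (segreSign j p : ℂ)
  refine h.congr_deriv ?_
  simp only [segre, ← Finset.sum_add_distrib]
  exact Finset.sum_congr rfl fun p _ => by ring

variable {U : TopologicalSpace.Opens Space}

/-- The derivative at `0` of the `j`-th tangency condition along `crCurve p v`. -/
lemma tangency_along_curve {X : HolField U} (hX : X ∈ hol U) {p : Space} (hp : p ∈ quadric)
    (hpU : p ∈ U) (v : Fin 8 → ℂ) {Y : Space}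
    (hY : Y = fderiv ℂ (X : Space → Space) p (crVec v (star (zPart p)))) (j : Fin 8) :
    wPart Y j + conjSign j * starRingEnd ℂ (wPart Y j) -
      (segre (zPart Y) (star (zPart p)) j +
        segre (zPart ((X : Space → Space) p)) (star v) j +
        (segre v (star (zPart ((X : Space → Space) p))) j +
          segre (zPart p) (star (zPart Y)) j)) = 0 := by
  have hc := hasDerivAt_crCurve p v
  have hXd : HasFDerivAt (X : Space → Space) (fderiv ℂ (X : Space → Space) p) (crCurve p v 0) := by
    rw [crCurve_zero]
    exact (HolField.analyticAt X hpU).differentiableAt.hasFDerivAt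
  have hXc : HasDerivAt (fun t => (X : Space → Space) (crCurve p v t)) Y 0 := by
    have := (hXd.restrictScalars ℝ).comp_hasDerivAt (0 : ℝ) hc
    rw [hY]
    exact this
  have hz : ∀ {γ : ℝ → Space} {γ' : Space}, HasDerivAt γ γ' 0 →
      HasDerivAt (fun t => zPart (γ t)) (zPart γ') 0 := fun h =>
    hasDerivAt_pi.mpr fun i => hasDerivAt_pi.mp h (.inl i)
  have hw : HasDerivAt (fun t => wPart ((X : Space → Space) (crCurve p v t)) j) (wPart Y j) 0 :=
    hasDerivAt_pi.mp hXc (.inr j)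
  have hd := (hw.add (hw.star.const_mul (conjSign j : ℂ))).sub
    ((hasDerivAt_segre (hz hXc) (hz hc).star j).add (hasDerivAt_segre (hz hc) (hz hXc).star j))
  have hev : (fun t => complexDifferential (crCurve p v t)
      ((X : Space → Space) (crCurve p v t)) j) =ᶠ[nhds (0 : ℝ)] fun _ => 0 := by
    have hU : crCurve p v ⁻¹' (U : Set Space) ∈ nhds (0 : ℝ) :=
      hc.continuousAt.preimage_mem_nhds (by
        rw [crCurve_zero]; exact U.isOpen.mem_nhds hpU)
    filter_upwards [hU] with t ht
    exact mem_tangent_iff.mp (hX _ (crCurve_mem_quadric hp v t) ht) j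
  have h0 := hd.unique ((hasDerivAt_const (0 : ℝ) (0 : ℂ)).congr_of_eventuallyEq hev)
  rw [crCurve_zero] at h0
  exact h0

/-- The tangency condition differentiated along the CR directions. -/
lemma cr_equation {X : HolField U} (hX : X ∈ hol U) {p : Space} (hp : p ∈ quadric)
    (hpU : p ∈ U) (v : Fin 8 → ℂ) {Y : Space}
    (hY : Y = fderiv ℂ (X : Space → Space) p (crVec v (star (zPart p)))) (j : Fin 8) :
    wPart Y j - segre (zPart Y) (star (zPart p)) j =
      segre v (star (zPart ((X : Space → Space) p))) j := by
  have h1 := tangency_along_curve hX hp hpU v hY j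
  -- replacing `v` by `i v` separates the complex linear part from the antilinear part
  have h2 := tangency_along_curve hX hp hpU (Complex.I • v) (Y := Complex.I • Y)
    (by rw [crVec_smul, map_smul, ← hY]) j
  have e1 : zPart (Complex.I • Y) = Complex.I • zPart Y := rfl
  have e2 : wPart (Complex.I • Y) j = Complex.I * wPart Y j := rfl
  have e3 : ∀ a : Fin 8 → ℂ, star (Complex.I • a) = -Complex.I • star a := fun a => by
    funext i; simp
  rw [e1, e2, e3, e3] at h2
  simp only [segre_smul_left, segre_smul_right, Pi.smul_apply, smul_eq_mul, map_mul,
    Complex.conj_I] at h2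
  linear_combination (1 / 2 : ℂ) * h1 - (Complex.I / 2) * h2 +
    (1 / 2) * (wPart Y j - conjSign j * starRingEnd ℂ (wPart Y j) -
      segre (zPart Y) (star (zPart p)) j + segre (zPart ((X : Space → Space) p)) (star v) j -
      segre v (star (zPart ((X : Space → Space) p))) j + segre (zPart p) (star (zPart Y)) j) *
      Complex.I_sq

end CREII

namespace CREII

/-! ### The quadric as a uniqueness set -/

open Filter Topology

/-- A holomorphic function that vanishes at the real points near a real point vanishes near that
point. -/
lemma eventually_eq_zero_of_real {ι : Type*} [Fintype ι] {F : (ι → ℂ) → ℂ} {t₀ : ι → ℝ}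
    (hF : ∀ᶠ t in 𝓝 (fun i => (t₀ i : ℂ)), DifferentiableAt ℂ F t)
    (h0 : ∀ᶠ s in 𝓝 t₀, F (fun i => (s i : ℂ)) = 0) :
    ∀ᶠ t in 𝓝 (fun i => (t₀ i : ℂ)), F t = 0 := by
  obtain ⟨r₁, hr₁, hF⟩ := Metric.eventually_nhds_iff_ball.mp hF
  obtain ⟨r₂, hr₂, h0⟩ := Metric.eventually_nhds_iff_ball.mp h0
  set r := min r₁ r₂
  have hr : 0 < r := lt_min hr₁ hr₂
  refine Metric.eventually_nhds_iff_ball.mpr ⟨r, hr, fun t ht => ?_⟩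
  -- on the complex line through `Re t` in the direction `Im t` the real points are real
  let γ : ℂ → ι → ℂ := fun s i => ((t i).re : ℂ) + s * ((t i).im : ℂ)
  have hγd : Differentiable ℂ γ := by
    refine differentiable_pi.mpr fun i => ?_
    exact (differentiable_id.mul_const _).const_add _
  let S : Set ℂ := γ ⁻¹' Metric.ball (fun i => (t₀ i : ℂ)) r
  have hSo : IsOpen S := Metric.isOpen_ball.preimage hγd.continuous
  have hSc : Convex ℝ S := by
    intro a ha b hb α β hα hβ hαβ
    have hab : γ (α • a + β • b) = α • γ a + β • γ b := by
      funext i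
      have h1 : (α : ℂ) + β = 1 := by exact_mod_cast hαβ
      simp only [γ, Pi.add_apply, Pi.smul_apply, Complex.real_smul]
      linear_combination (-((t i).re : ℂ)) * h1
    change γ _ ∈ Metric.ball (fun i => (t₀ i : ℂ)) r
    rw [hab]
    exact convex_ball _ r ha hb hα hβ hαβ
  have hdist : ∀ i, dist (t i) (t₀ i : ℂ) < r := fun i => (dist_pi_lt_iff hr).mp ht i
  have h0S : (0 : ℂ) ∈ S := by
    refine (dist_pi_lt_iff hr).mpr fun i => lt_of_le_of_lt ?_ (hdist i)
    have := Complex.abs_re_le_norm (t i - t₀ i)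
    rw [dist_eq_norm, dist_eq_norm]
    simp only [γ, zero_mul, add_zero]
    rw [← Complex.ofReal_sub, Complex.norm_real]
    simpa using this
  have hIS : Complex.I ∈ S := by
    have : γ Complex.I = t := by
      funext i
      simp only [γ]
      rw [mul_comm, Complex.re_add_im]
    change γ _ ∈ Metric.ball (fun i => (t₀ i : ℂ)) r
    rw [this]
    exact ht
  have han : AnalyticOnNhd ℂ (F ∘ γ) S := by
    refine DifferentiableOn.analyticOnNhd (fun s hs => ?_) hSo
    have h1 : DifferentiableAt ℂ F (γ s) :=
      hF _ (Metric.ball_subset_ball (min_le_left _ _) hs)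
    exact (h1.comp s (hγd s)).differentiableWithinAt
  have hfreq : ∃ᶠ s in 𝓝[≠] (0 : ℂ), (F ∘ γ) s = 0 := by
    -- real parameters close to zero
    have hτ : Tendsto (fun n : ℕ => (((1 : ℝ) / ((n : ℝ) + 1) : ℝ) : ℂ)) atTop (𝓝[≠] 0) := by
      refine tendsto_nhdsWithin_iff.mpr ⟨?_, Eventually.of_forall fun n => ?_⟩
      · have := (Complex.continuous_ofReal.tendsto 0).comp
          (tendsto_one_div_add_atTop_nhds_zero_nat (𝕜 := ℝ))
        simpa [Function.comp_def] using this
      · have : (0 : ℝ) < 1 / ((n : ℝ) + 1) := by positivity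
        exact Complex.ofReal_ne_zero.mpr this.ne'
    have hin : ∀ᶠ n : ℕ in atTop, (((1 : ℝ) / ((n : ℝ) + 1) : ℝ) : ℂ) ∈ S :=
      (hτ.mono_right nhdsWithin_le_nhds).eventually (hSo.mem_nhds h0S)
    refine hτ.frequently (Eventually.frequently ?_)
    filter_upwards [hin] with n hn
    have hreal : γ (((1 : ℝ) / ((n : ℝ) + 1) : ℝ) : ℂ) =
        fun i => (((t i).re + 1 / ((n : ℝ) + 1) * (t i).im : ℝ) : ℂ) := by
      funext i
      simp only [γ]
      push_cast
      ring
    change F (γ _) = 0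
    rw [hreal]
    refine h0 _ ((dist_pi_lt_iff hr₂).mpr fun i => ?_)
    have h2 : dist (γ (((1 : ℝ) / ((n : ℝ) + 1) : ℝ) : ℂ) i) (t₀ i : ℂ) < r :=
      (dist_pi_lt_iff hr).mp hn i
    rw [hreal] at h2
    simp only [dist_eq_norm] at h2 ⊢
    rw [← Complex.ofReal_sub, Complex.norm_real] at h2
    exact h2.trans_le (min_le_right _ _)
  have := han.eqOn_zero_of_preconnected_of_frequently_eq_zero hSc.isPreconnected h0S hfreq hIS
  have hI : γ Complex.I = t := by
    funext i
    simp only [γ]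
    rw [mul_comm, Complex.re_add_im]
  change F (γ Complex.I) = 0 at this
  rwa [hI] at this

lemma continuous_segre (j : Fin 8) :
    Continuous fun q : (Fin 8 → ℂ) × (Fin 8 → ℂ) => segre q.1 q.2 j := by
  unfold segre
  fun_prop

lemma differentiable_segre {E : Type*} [NormedAddCommGroup E] [NormedSpace ℂ E]
    {a b : E → Fin 8 → ℂ} {x : E} (ha : DifferentiableAt ℂ a x) (hb : DifferentiableAt ℂ b x)
    (j : Fin 8) : DifferentiableAt ℂ (fun q => segre (a q) (b q) j) x := by
  unfold segre
  have ha' := differentiableAt_pi.mp ha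
  have hb' := differentiableAt_pi.mp hb
  exact DifferentiableAt.fun_sum fun p _ => ((ha' p).mul (hb' _)).const_mul _

/-- The factor of the free parameter of `w_j` on the quadric: `1` or `i`. -/
noncomputable def fiberFactor (j : Fin 8) : ℂ := if conjSign j = 1 then Complex.I else 1

lemma fiberFactor_ne_zero (j : Fin 8) : fiberFactor j ≠ 0 := by
  unfold fiberFactor; split_ifs <;> simp

lemma conj_fiberFactor (j : Fin 8) :
    starRingEnd ℂ (fiberFactor j) = -conjSign j * fiberFactor j := by
  fin_cases j <;> simp [fiberFactor, conjSign]

/-- The polynomial parametrization `(x, y, u) ↦ (z, w)` of the quadric by real parameters, with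
`z = x + i y`; for complex parameters, `x - i y` takes the place of `z̄`. -/
noncomputable def param (t : Fin 3 × Fin 8 → ℂ) : Space × (Fin 8 → ℂ) :=
  (Sum.elim (fun j => t (0, j) + Complex.I * t (1, j)) fun j =>
    1 / 2 * segre (fun j => t (0, j) + Complex.I * t (1, j))
      (fun j => t (0, j) - Complex.I * t (1, j)) j + fiberFactor j * t (2, j),
    fun j => t (0, j) - Complex.I * t (1, j))

/-- The inverse of `param`. -/
noncomputable def paramInv (q : Space × (Fin 8 → ℂ)) (k : Fin 3 × Fin 8) : ℂ :=
  ![(zPart q.1 k.2 + q.2 k.2) / 2, (zPart q.1 k.2 - q.2 k.2) / (2 * Complex.I),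
    (wPart q.1 k.2 - 1 / 2 * segre (zPart q.1) q.2 k.2) / fiberFactor k.2] k.1

lemma param_paramInv (q : Space × (Fin 8 → ℂ)) : param (paramInv q) = q := by
  have h1 : (fun j => paramInv q (0, j) + Complex.I * paramInv q (1, j)) = zPart q.1 := by
    funext j
    simp only [paramInv, Matrix.cons_val_zero, Matrix.cons_val_one]
    field_simp [Complex.I_ne_zero]
    ring
  have h2 : (fun j => paramInv q (0, j) - Complex.I * paramInv q (1, j)) = q.2 := by
    funext j
    simp only [paramInv, Matrix.cons_val_zero, Matrix.cons_val_one]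
    field_simp [Complex.I_ne_zero]
    ring
  refine Prod.ext ?_ ?_
  · funext i
    rcases i with i | i
    · exact congrFun h1 i
    · simp only [param, Sum.elim_inr]
      rw [h1, h2]
      have : paramInv q (2, i) =
        (wPart q.1 i - 1 / 2 * segre (zPart q.1) q.2 i) / fiberFactor i := rfl
      rw [this, mul_div_cancel₀ _ (fiberFactor_ne_zero i)]
      simp [wPart]
  · exact h2

lemma continuous_paramInv : Continuous paramInv := by
  refine continuous_pi fun k => ?_
  obtain ⟨a, j⟩ := k
  have hz : Continuous fun q : Space × (Fin 8 → ℂ) => zPart q.1 :=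
    continuous_pi fun i => (continuous_apply (Sum.inl i : Coord)).comp continuous_fst
  have hs : Continuous fun q : Space × (Fin 8 → ℂ) => segre (zPart q.1) q.2 j :=
    (continuous_segre j).comp (hz.prodMk continuous_snd)
  have hzj : Continuous fun q : Space × (Fin 8 → ℂ) => zPart q.1 j := (continuous_apply j).comp hz
  have h2j : Continuous fun q : Space × (Fin 8 → ℂ) => q.2 j :=
    (continuous_apply j).comp continuous_snd
  have hw : Continuous fun q : Space × (Fin 8 → ℂ) => wPart q.1 j :=
    (continuous_apply (Sum.inr j : Coord)).comp continuous_fst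
  fin_cases a
  · exact (hzj.add h2j).div_const _
  · exact (hzj.sub h2j).div_const _
  · exact (hw.sub (hs.const_mul _)).div_const _

lemma differentiable_param : Differentiable ℂ param := by
  have hc : ∀ k : Fin 3 × Fin 8, Differentiable ℂ fun t : Fin 3 × Fin 8 → ℂ => t k := fun k =>
    differentiable_apply k
  have h1 : Differentiable ℂ fun (t : Fin 3 × Fin 8 → ℂ) (j : Fin 8) =>
      t (0, j) + Complex.I * t (1, j) :=
    differentiable_pi.mpr fun j => (hc _).add ((hc _).const_mul _)
  have h2 : Differentiable ℂ fun (t : Fin 3 × Fin 8 → ℂ) (j : Fin 8) =>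
      t (0, j) - Complex.I * t (1, j) :=
    differentiable_pi.mpr fun j => (hc _).sub ((hc _).const_mul _)
  refine Differentiable.prodMk (differentiable_pi.mpr fun i => ?_) h2
  rcases i with i | i
  · exact differentiable_pi.mp h1 i
  · exact (Differentiable.const_mul (fun t => differentiable_segre (h1 t) (h2 t) i) _).add
      ((hc _).const_mul _)

lemma param_real_mem (s : Fin 3 × Fin 8 → ℝ) :
    (param fun k => (s k : ℂ)).1 ∈ quadric ∧
      (param fun k => (s k : ℂ)).2 = star (zPart (param fun k => (s k : ℂ)).1) := by
  have h2 : (param fun k => (s k : ℂ)).2 = star (zPart (param fun k => (s k : ℂ)).1) := by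
    funext j
    simp [param, zPart, sub_eq_add_neg]
  refine ⟨mem_quadric_iff.mpr fun j => ?_, h2⟩
  have hw : wPart (param fun k => (s k : ℂ)).1 j =
      1 / 2 * segre (zPart (param fun k => (s k : ℂ)).1) (param fun k => (s k : ℂ)).2 j +
        fiberFactor j * s (2, j) := rfl
  have h3 : (conjSign j : ℂ) * conjSign j = 1 := by fin_cases j <;> simp [conjSign]
  rw [complexDefining, hw, h2]
  simp only [map_add, map_mul, map_div₀, map_one, Complex.conj_ofReal, Complex.conj_ofNat,
    conj_segre, conj_fiberFactor]
  linear_combination (1 / 2 * segre (zPart (param fun k => (s k : ℂ)).1)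
    (star (zPart (param fun k => (s k : ℂ)).1)) j - fiberFactor j * s (2, j)) * h3

lemma paramInv_real {p : Space} (hp : p ∈ quadric) (k : Fin 3 × Fin 8) :
    (((paramInv (p, star (zPart p)) k).re : ℝ) : ℂ) = paramInv (p, star (zPart p)) k := by
  obtain ⟨a, j⟩ := k
  rw [← Complex.conj_eq_iff_re]
  have h := mem_quadric_iff.mp hp j
  rw [complexDefining] at h
  have h3 : (conjSign j : ℂ) * conjSign j = 1 := by fin_cases j <;> simp [conjSign]
  have h4 : (conjSign j : ℂ) ≠ 0 := left_ne_zero_of_mul_eq_one h3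
  fin_cases a
  · change starRingEnd ℂ ((zPart p j + star (zPart p) j) / 2) = (zPart p j + star (zPart p) j) / 2
    simp [add_comm, Complex.conj_ofNat]
  · change starRingEnd ℂ ((zPart p j - star (zPart p) j) / (2 * Complex.I)) =
      (zPart p j - star (zPart p) j) / (2 * Complex.I)
    simp only [map_div₀, map_sub, map_mul, Pi.star_apply, RCLike.star_def, Complex.conj_conj,
      Complex.conj_I, Complex.conj_ofNat]
    field_simp [Complex.I_ne_zero]
    ring
  · change starRingEnd ℂ ((wPart p j - 1 / 2 * segre (zPart p) (star (zPart p)) j) /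
      fiberFactor j) = (wPart p j - 1 / 2 * segre (zPart p) (star (zPart p)) j) / fiberFactor j
    simp only [map_div₀, map_sub, map_mul, map_one, Complex.conj_ofNat, conj_segre,
      conj_fiberFactor]
    have hf := fiberFactor_ne_zero j
    rw [div_eq_div_iff (mul_ne_zero (neg_ne_zero.mpr h4) hf) hf]
    linear_combination (conjSign j * fiberFactor j) * h -
      fiberFactor j * starRingEnd ℂ (wPart p j) * h3

/-- A holomorphic function `H(p, ζ)` that vanishes for `p ∈ M`, `ζ = z̄`, vanishes identically. -/
lemma eventually_eq_zero_of_quadric {H : Space × (Fin 8 → ℂ) → ℂ} {p₀ : Space}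
    (hp₀ : p₀ ∈ quadric)
    (hH : ∀ᶠ q in 𝓝 (p₀, star (zPart p₀)), DifferentiableAt ℂ H q)
    (h0 : ∀ᶠ p in 𝓝 p₀, p ∈ quadric → H (p, star (zPart p)) = 0) :
    ∀ᶠ q in 𝓝 (p₀, star (zPart p₀)), H q = 0 := by
  set q₀ : Space × (Fin 8 → ℂ) := (p₀, star (zPart p₀)) with hq₀
  let t₀ : Fin 3 × Fin 8 → ℝ := fun k => (paramInv q₀ k).re
  have ht₀ : (fun k => (t₀ k : ℂ)) = paramInv q₀ := funext fun k => paramInv_real hp₀ k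
  have hpt : param (fun k => (t₀ k : ℂ)) = q₀ := by rw [ht₀, param_paramInv]
  have hcont : Tendsto param (𝓝 fun k => (t₀ k : ℂ)) (𝓝 q₀) := by
    have := differentiable_param.continuous.tendsto fun k => (t₀ k : ℂ)
    rwa [hpt] at this
  have h1 : ∀ᶠ t in 𝓝 (fun k => (t₀ k : ℂ)), (H ∘ param) t = 0 := by
    refine eventually_eq_zero_of_real ?_ ?_
    · filter_upwards [hcont.eventually hH] with t ht using ht.comp t (differentiable_param t)
    · have hreal : Continuous fun (s : Fin 3 × Fin 8 → ℝ) k => (s k : ℂ) :=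
        continuous_pi fun k => Complex.continuous_ofReal.comp (continuous_apply k)
      have h2 : Tendsto (fun s : Fin 3 × Fin 8 → ℝ => (param fun k => (s k : ℂ)).1) (𝓝 t₀)
          (𝓝 p₀) := (continuous_fst.tendsto q₀).comp (hcont.comp (hreal.tendsto t₀))
      filter_upwards [h2.eventually h0] with s hs
      have h3 := hs (param_real_mem s).1
      rw [← (param_real_mem s).2] at h3
      exact h3
  have hinv : Tendsto paramInv (𝓝 q₀) (𝓝 fun k => (t₀ k : ℂ)) := by
    rw [ht₀]
    exact continuous_paramInv.tendsto q₀
  filter_upwards [hinv.eventually h1] with q hq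
  have : H (param (paramInv q)) = 0 := hq
  rwa [param_paramInv] at this

end CREII

namespace CREII

/-! ### The first-order condition on symmetries -/

/-- The form `(A V)_{w_j} - Q_j((A V)_z, ζ)` on `V = (e_p, Q(e_p, ζ))`. -/
noncomputable def crForm (A : Space →L[ℂ] Space) (ζ : Fin 8 → ℂ) (j p : Fin 8) : ℂ :=
  wPart (A (crVec (Pi.single p 1) ζ)) j - segre (zPart (A (crVec (Pi.single p 1) ζ))) ζ j

/-- The index `p'` with `segrePartner 4 p' = segrePartner j p`; in the fourth form every index has a
partner. -/
def crMate (j p : Fin 8) : Fin 8 := segrePartner 4 (segrePartner j p)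

/-- The sign relating `crForm A ζ j p` to `crForm A ζ 4 (crMate j p)`. -/
def crSign (j p : Fin 8) : ℤ := segreSign j p * segreSign 4 (crMate j p)

/-- The linear maps `A` such that for every `ζ` there is `a` with
`(A V)_{w_j} - Q_j((A V)_z, ζ) = Q_j(v, a)` for all `V = (v, Q(v, ζ))` and all `j`; the vector `a` is
eliminated by means of the fourth form. -/
noncomputable def crSpace : Submodule ℂ (Space →L[ℂ] Space) where
  carrier := {A | ∀ ζ j p, crForm A ζ j p = crSign j p * crForm A ζ 4 (crMate j p)}
  add_mem' := by
    intro A B hA hB ζ j p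
    have h : ∀ j p, crForm (A + B) ζ j p = crForm A ζ j p + crForm B ζ j p := fun j p => by
      have e : ∀ x y : Space, zPart (x + y) = zPart x + zPart y := fun _ _ => rfl
      simp only [crForm, add_apply, e, segre_add_left, Pi.add_apply]
      ring
    rw [h, h, hA, hB]
    ring
  zero_mem' := by
    intro ζ j p
    have h : ∀ j p, crForm 0 ζ j p = 0 := fun j p => by
      have e : zPart (0 : Space) = 0 := rfl
      have h0 : segre 0 ζ = 0 := by simpa using segre_smul_left 0 0 ζ
      simp [crForm, e, h0]
    rw [h, h, mul_zero]
  smul_mem' := by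
    intro c A hA ζ j p
    have h : ∀ j p, crForm (c • A) ζ j p = c * crForm A ζ j p := fun j p => by
      have e : ∀ x : Space, zPart (c • x) = c • zPart x := fun _ => rfl
      simp only [crForm, smul_apply, e, segre_smul_left, Pi.smul_apply, smul_eq_mul]
      ring
    rw [h, h, hA]
    ring

lemma segre_single_left (p : Fin 8) (b : Fin 8 → ℂ) (j : Fin 8) :
    segre (Pi.single p 1) b j = segreSign j p * b (segrePartner j p) := by
  rw [segre, Finset.sum_eq_single p]
  · simp
  · intro q _ hq
    simp [Pi.single_eq_of_ne hq]
  · simp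

lemma crSign_mul (j p : Fin 8) (a : Fin 8 → ℂ) :
    segre (Pi.single p 1) a j = crSign j p * segre (Pi.single (crMate j p) 1) a 4 := by
  have h : ∀ q, segrePartner 4 (segrePartner 4 q) = q := by decide
  have h2 : ∀ q, segreSign 4 q * segreSign 4 q = 1 := by decide
  rw [segre_single_left, segre_single_left, crSign, crMate, h]
  have h3 : (segreSign 4 (segrePartner 4 (segrePartner j p)) : ℂ) *
      segreSign 4 (segrePartner 4 (segrePartner j p)) = 1 := by exact_mod_cast h2 _
  push_cast
  linear_combination (-(segreSign j p : ℂ) * a (segrePartner j p)) * h3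

lemma differentiable_crVec (p : Fin 8) :
    Differentiable ℂ fun ζ : Fin 8 → ℂ => crVec (Pi.single p 1) ζ := by
  refine differentiable_pi.mpr fun i => ?_
  rcases i with i | i
  · exact differentiable_const _
  · exact fun ζ => differentiable_segre (differentiableAt_const _) differentiableAt_id i

open Filter Topology in
/-- The derivative of an infinitesimal CR symmetry satisfies the first-order condition. -/
lemma eventually_fderiv_mem_crSpace {U : TopologicalSpace.Opens Space} {X : HolField U}
    (hX : X ∈ hol U) {p₀ : Space} (hp : p₀ ∈ quadric) (hpU : p₀ ∈ U) :
    ∀ᶠ p in 𝓝 p₀, fderiv ℂ (X : Space → Space) p ∈ crSpace := by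
  have key : ∀ j p, ∀ᶠ q in 𝓝 (p₀, star (zPart p₀)),
      crForm (fderiv ℂ (X : Space → Space) q.1) q.2 j p -
        crSign j p * crForm (fderiv ℂ (X : Space → Space) q.1) q.2 4 (crMate j p) = 0 := by
    intro j p
    refine eventually_eq_zero_of_quadric hp ?_ ?_
    · have hU : ∀ᶠ q in 𝓝 (p₀, star (zPart p₀)), q.1 ∈ U :=
        (continuous_fst.tendsto (p₀, star (zPart p₀))).eventually (U.isOpen.mem_nhds hpU)
      filter_upwards [hU] with q hq
      have hd : DifferentiableAt ℂ (fun q : Space × (Fin 8 → ℂ) =>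
          fderiv ℂ (X : Space → Space) q.1) q :=
        (HolField.analyticAt X hq).fderiv.differentiableAt.comp q differentiableAt_fst
      have hcv : ∀ p, DifferentiableAt ℂ (fun q : Space × (Fin 8 → ℂ) =>
          fderiv ℂ (X : Space → Space) q.1 (crVec (Pi.single p 1) q.2)) q := fun p =>
        hd.clm_apply ((differentiable_crVec p q.2).comp q differentiableAt_snd)
      have hform : ∀ j p, DifferentiableAt ℂ (fun q : Space × (Fin 8 → ℂ) =>
          crForm (fderiv ℂ (X : Space → Space) q.1) q.2 j p) q := fun j p =>
        (differentiableAt_pi.mp (hcv p) (.inr j)).sub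
          (differentiable_segre (differentiableAt_pi.mpr fun i =>
            differentiableAt_pi.mp (hcv p) (.inl i)) differentiableAt_snd j)
      exact (hform j p).sub ((hform 4 (crMate j p)).const_mul _)
    · filter_upwards [U.isOpen.mem_nhds hpU] with q hqU hq
      have h := fun j p => cr_equation hX hq hqU (Pi.single p 1) rfl j
      simp only [crForm, h]
      rw [crSign_mul, sub_self]
  have hall : ∀ᶠ q in 𝓝 (p₀, star (zPart p₀)), ∀ j p,
      crForm (fderiv ℂ (X : Space → Space) q.1) q.2 j p -
        crSign j p * crForm (fderiv ℂ (X : Space → Space) q.1) q.2 4 (crMate j p) = 0 :=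
    eventually_all.mpr fun j => eventually_all.mpr fun p => key j p
  rw [nhds_prod_eq] at hall
  filter_upwards [hall.curry] with q hq
  intro ζ j p
  -- both sides are polynomial in `ζ`
  have hform : ∀ j p, Differentiable ℂ fun ζ : Fin 8 → ℂ =>
      crForm (fderiv ℂ (X : Space → Space) q) ζ j p := fun j p ζ =>
    have hcv : Differentiable ℂ fun ζ : Fin 8 → ℂ =>
        fderiv ℂ (X : Space → Space) q (crVec (Pi.single p 1) ζ) :=
      (fderiv ℂ (X : Space → Space) q).differentiable.comp (differentiable_crVec p)
    (differentiable_pi.mp hcv (.inr j) ζ).sub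
      (differentiable_segre (differentiableAt_pi.mpr fun i => differentiable_pi.mp hcv (.inl i) ζ)
        differentiableAt_id j)
  -- the identity theorem along the complex line through `ζ`
  let γ : ℂ → Fin 8 → ℂ := fun s => star (zPart p₀) + s • (ζ - star (zPart p₀))
  have hγ : Differentiable ℂ γ := (differentiable_id.smul_const _).const_add _
  let f : ℂ → ℂ := fun s => crForm (fderiv ℂ (X : Space → Space) q) (γ s) j p -
    crSign j p * crForm (fderiv ℂ (X : Space → Space) q) (γ s) 4 (crMate j p)
  have hf : Differentiable ℂ f :=
    ((hform j p).comp hγ).sub (((hform 4 (crMate j p)).comp hγ).const_mul _)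
  have hγ0 : Tendsto γ (𝓝 0) (𝓝 (star (zPart p₀))) := by
    have := hγ.continuous.tendsto 0
    simpa [γ] using this
  have h0 : f =ᶠ[𝓝 0] fun _ => 0 := by
    filter_upwards [hγ0.eventually hq] with s hs using hs j p
  have h1 := AnalyticOnNhd.eq_of_eventuallyEq (f := f) (g := fun _ => 0)
    (fun s _ => hf.analyticAt s) analyticOnNhd_const h0
  have h2 : f 1 = 0 := congrFun h1 1
  have hγ1 : γ 1 = ζ := by simp [γ]
  simp only [f, hγ1] at h2
  exact sub_eq_zero.mp h2

end CREII

namespace CREII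

/-! ### Coefficients of the first-order condition -/

/-- A polynomial of degree two that vanishes identically has vanishing coefficients. -/
lemma coeff_eq_zero {V : Type*} [AddCommGroup V] [Module ℂ V] {c : ℂ} {L : V →ₗ[ℂ] ℂ}
    {B : V →ₗ[ℂ] V →ₗ[ℂ] ℂ} (h : ∀ x, c + L x + B x x = 0) :
    c = 0 ∧ (∀ x, L x = 0) ∧ ∀ x y, B x y + B y x = 0 := by
  have h0 : c = 0 := by simpa using h 0
  have hL : ∀ x, L x = 0 := fun x => by
    have h1 := h x
    have h2 := h (-x)
    simp only [map_neg, LinearMap.neg_apply, neg_neg] at h2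
    linear_combination (h1 - h2) / 2
  refine ⟨h0, hL, fun x y => ?_⟩
  have hB : ∀ x, B x x = 0 := fun x => by simpa [h0, hL] using h x
  have h1 := hB (x + y)
  simp only [map_add, LinearMap.add_apply, hB] at h1
  linear_combination h1

/-- The vector `(0, x)`. -/
def wIncl : (Fin 8 → ℂ) →ₗ[ℂ] Space where
  toFun x := Sum.elim 0 x
  map_add' x y := by funext i; rcases i with i | i <;> simp
  map_smul' c x := by funext i; rcases i with i | i <;> simp

/-- The linear part of `crForm` in `ζ`. -/
noncomputable def crLin (A : Space →L[ℂ] Space) (j p : Fin 8) : (Fin 8 → ℂ) →ₗ[ℂ] ℂ :=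
  (LinearMap.proj (Sum.inr j : Coord)) ∘ₗ A.toLinearMap ∘ₗ wIncl ∘ₗ segreBilin (Pi.single p 1) -
    (LinearMap.proj j) ∘ₗ segreBilin (zPart (A (Pi.single (.inl p) 1)))

/-- The quadratic part of `crForm` in `ζ`. -/
noncomputable def crQuad (A : Space →L[ℂ] Space) (j p : Fin 8) :
    (Fin 8 → ℂ) →ₗ[ℂ] (Fin 8 → ℂ) →ₗ[ℂ] ℂ :=
  -((segreBilin.compr₂ (LinearMap.proj j)) ∘ₗ (LinearMap.funLeft ℂ ℂ Sum.inl) ∘ₗ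
    A.toLinearMap ∘ₗ wIncl ∘ₗ segreBilin (Pi.single p 1))

lemma crForm_eq (A : Space →L[ℂ] Space) (ζ : Fin 8 → ℂ) (j p : Fin 8) :
    crForm A ζ j p =
      A (Pi.single (.inl p) 1) (.inr j) + crLin A j p ζ + crQuad A j p ζ ζ := by
  have h : crVec (Pi.single p 1) ζ = Pi.single (.inl p) 1 + wIncl (segre (Pi.single p 1) ζ) := by
    funext i
    rcases i with i | i
    · simp [crVec, wIncl, Pi.single_apply]
    · simp [crVec, wIncl]
  have e : ∀ x y : Space, zPart (x + y) = zPart x + zPart y := fun _ _ => rfl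
  have hs : ∀ a b, segreBilin a b = segre a b := fun _ _ => rfl
  have hf : ∀ x : Space, LinearMap.funLeft ℂ ℂ Sum.inl x = zPart x := fun _ => rfl
  rw [crForm, h, map_add, e, segre_add_left]
  simp only [crLin, crQuad, LinearMap.sub_apply, LinearMap.neg_apply, LinearMap.comp_apply,
    LinearMap.proj_apply, LinearMap.compr₂_apply, hs, hf, ContinuousLinearMap.coe_coe,
    Pi.add_apply]
  ring

/-- The coefficient of `a_p b_q` in `Q_j(a, b)`. -/
def segreCoef (j p q : Fin 8) : ℤ := if segrePartner j p = q then segreSign j p else 0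

lemma segre_single_single (j p q : Fin 8) :
    segre (Pi.single p 1) (Pi.single q 1) j = segreCoef j p q := by
  rw [segre_single_left, segreCoef, Pi.single_apply]
  split_ifs <;> simp

lemma segre_single_right (a : Fin 8 → ℂ) (j q : Fin 8) :
    segre a (Pi.single q 1) j = ∑ m, (segreCoef j m q : ℂ) * a m := by
  refine Finset.sum_congr rfl fun m _ => ?_
  rw [segreCoef, Pi.single_apply]
  split_ifs <;> simp

lemma wIncl_eq_sum (x : Fin 8 → ℂ) : wIncl x = ∑ l, x l • (Pi.single (.inr l) 1 : Space) := by
  funext i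
  rw [Finset.sum_apply]
  rcases i with i | i
  · simp [wIncl]
  · simp [wIncl, Pi.single_apply]

/-- The matrix entry of number `16 r + c`, in row `r` and column `c`. -/
noncomputable def entry (A : Space →L[ℂ] Space) (n : ℕ) : ℂ :=
  A (Pi.single (coord n) 1) (coord (n / 16))

/-- The number of a matrix entry. -/
def entryNum (r c : ℕ) : ℕ := 16 * r + c

lemma entry_entryNum (A : Space →L[ℂ] Space) (r : ℕ) {c : ℕ} (hc : c < 16) :
    entry A (entryNum r c) = A (Pi.single (coord c) 1) (coord r) := by
  have h1 : coord (16 * r + c) = coord c := coord_eq_iff.mpr (by omega)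
  have h2 : (16 * r + c) / 16 = r := by omega
  rw [entry, entryNum, h1, h2]

/-- `crLin A j p` at the `q`-th basis vector, in matrix entries. -/
def linData (j p q : Fin 8) : Lin ℕ :=
  ((List.finRange 8).map fun l => ((segreCoef l p q, 0), entryNum (wi j) (wi l))) ++
    (List.finRange 8).map fun m => ((-segreCoef j m q, 0), entryNum (zi m) (zi p))

/-- The symmetrization of `crQuad A j p` at two basis vectors, in matrix entries. -/
def quadData (j p q r : Fin 8) : Lin ℕ :=
  (List.finRange 8).flatMap fun m => (List.finRange 8).map fun l =>
    ((-(segreCoef j m r * segreCoef l p q + segreCoef j m q * segreCoef l p r), 0),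
      entryNum (zi m) (wi l))

lemma Lin.eval_map_finRange {A : Type*} [AddCommGroup A] [Module ℂ A] (f : ℕ → A) {n : ℕ}
    (c : Fin n → ℤ) (k : Fin n → ℕ) :
    Lin.eval f ((List.finRange n).map fun i => ((c i, 0), k i)) =
      ∑ i, (c i : ℂ) • f (k i) := by
  rw [Lin.eval_eq_sum, List.map_map, ← List.ofFn_eq_map, List.sum_ofFn]
  simp [toC_int]

lemma wi_lt (j : Fin 8) : wi j < 16 := by unfold wi; omega
lemma zi_lt (j : Fin 8) : zi j < 16 := by unfold zi; omega

lemma eval_linData (A : Space →L[ℂ] Space) (j p q : Fin 8) :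
    Lin.eval (entry A) (linData j p q) = crLin A j p (Pi.single q 1) := by
  have hs : ∀ a b, segreBilin a b = segre a b := fun _ _ => rfl
  rw [linData, Lin.eval_append, Lin.eval_map_finRange,
    Lin.eval_map_finRange (entry A) (fun m => -segreCoef j m q)]
  simp only [entry_entryNum A _ (wi_lt _), entry_entryNum A _ (zi_lt _), coord_wi, coord_zi, crLin,
    LinearMap.sub_apply, LinearMap.comp_apply, LinearMap.proj_apply, hs, wIncl_eq_sum, map_sum,
    map_smul, segre_single_single, ContinuousLinearMap.coe_coe, smul_eq_mul]
  simp only [segre_single_right]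
  simp [sub_eq_add_neg]

lemma eval_quadData (A : Space →L[ℂ] Space) (j p q r : Fin 8) :
    Lin.eval (entry A) (quadData j p q r) =
      crQuad A j p (Pi.single q 1) (Pi.single r 1) +
        crQuad A j p (Pi.single r 1) (Pi.single q 1) := by
  have hs : ∀ a b, segreBilin a b = segre a b := fun _ _ => rfl
  have hf : ∀ x : Space, LinearMap.funLeft ℂ ℂ Sum.inl x = zPart x := fun _ => rfl
  have hq : ∀ q r, crQuad A j p (Pi.single q 1) (Pi.single r 1) =
      -∑ m, ∑ l, (segreCoef j m r * segreCoef l p q : ℂ) *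
        A (Pi.single (.inr l) 1) (.inl m) := fun q r => by
    simp only [crQuad, LinearMap.neg_apply, LinearMap.comp_apply, LinearMap.compr₂_apply,
      LinearMap.proj_apply, hs, hf, wIncl_eq_sum, map_sum, map_smul,
      ContinuousLinearMap.coe_coe, segre_single_single]
    simp only [segre_single_right, zPart, Finset.sum_apply, Pi.smul_apply, smul_eq_mul,
      Finset.mul_sum, mul_assoc]
  rw [hq, hq, quadData, Lin.eval_flatMap, ← List.ofFn_eq_map, List.sum_ofFn,
    ← neg_add, ← Finset.sum_add_distrib, ← Finset.sum_neg_distrib]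
  refine Finset.sum_congr rfl fun m _ => ?_
  rw [Lin.eval_map_finRange (entry A)
    (fun l => -(segreCoef j m r * segreCoef l p q + segreCoef j m q * segreCoef l p r)),
    ← Finset.sum_add_distrib, ← Finset.sum_neg_distrib]
  refine Finset.sum_congr rfl fun l _ => ?_
  rw [entry_entryNum A _ (wi_lt _), coord_wi, coord_zi]
  push_cast
  rw [smul_eq_mul]
  ring

/-- The constant, linear and symmetrized quadratic parts of `crForm` in matrix entries: `k = 0` is
the constant part, `k = 1 + q` and `k = 9 + 8 q + r` stand for the coefficients of `ζ_q` and
`ζ_q ζ_r`. -/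
def formData (j p : Fin 8) (k : ℕ) : Lin ℕ :=
  if k = 0 then [((1, 0), entryNum (wi j) (zi p))]
  else if k < 9 then linData j p (Fin.ofNat 8 (k - 1))
  else quadData j p (Fin.ofNat 8 ((k - 9) / 8)) (Fin.ofNat 8 (k - 9))

/-- A linear relation between the matrix entries of elements of `crSpace`; the number `n` encodes
`j`, `p` and the index `k` of `formData`. -/
def relData (n : ℕ) : Lin ℕ :=
  let j := Fin.ofNat 8 n
  let p := Fin.ofNat 8 (n / 8)
  formData j p (n / 64) ++ Lin.scale (-crSign j p, 0) (formData 4 (crMate j p) (n / 64))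

lemma eval_relData {A : Space →L[ℂ] Space} (hA : A ∈ crSpace) (n : ℕ) :
    Lin.eval (entry A) (relData n) = 0 := by
  rw [relData]
  set j := Fin.ofNat 8 n
  set p := Fin.ofNat 8 (n / 8)
  set k := n / 64
  obtain ⟨h0, h1, h2⟩ := coeff_eq_zero
    (c := A (Pi.single (.inl p) 1) (.inr j) -
      crSign j p * A (Pi.single (.inl (crMate j p)) 1) (.inr 4))
    (L := crLin A j p - (crSign j p : ℂ) • crLin A 4 (crMate j p))
    (B := crQuad A j p - (crSign j p : ℂ) • crQuad A 4 (crMate j p)) (fun ζ => by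
      have h := hA ζ j p
      rw [crForm_eq, crForm_eq] at h
      simp only [LinearMap.sub_apply, LinearMap.smul_apply, smul_eq_mul]
      linear_combination h)
  simp only [LinearMap.sub_apply, LinearMap.smul_apply, smul_eq_mul] at h1 h2
  rw [Lin.eval_append, Lin.eval_scale, toC_int, smul_eq_mul]
  push_cast
  unfold formData
  split_ifs
  · simp only [Lin.eval_cons, Lin.eval_nil, toC_int, Int.cast_one, one_smul, add_zero,
      entry_entryNum A _ (zi_lt _), coord_wi, coord_zi]
    linear_combination h0
  · rw [eval_linData, eval_linData]
    linear_combination h1 (Pi.single (Fin.ofNat 8 (k - 1)) 1)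
  · rw [eval_quadData, eval_quadData]
    linear_combination h2 (Pi.single (Fin.ofNat 8 ((k - 9) / 8)) 1)
      (Pi.single (Fin.ofNat 8 (k - 9)) 1)

/-! ### A basis of weight vectors -/

/-- A basis of `ℂ^{8+8}` consisting of weight vectors: the coordinate vectors, except that
`∂_{w_4} + ∂_{w_5}` and `-∂_{w_4} + ∂_{w_5}` replace the vectors of number `12` and `13`. -/
def frameData (n : ℕ) : Lin ℕ :=
  if n = 12 then [((1, 0), 12), ((1, 0), 13)] else
    if n = 13 then [((-1, 0), 12), ((1, 0), 13)] else [((1, 0), n)]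

/-- Twice the dual basis. -/
def coframeData (n : ℕ) : Lin ℕ :=
  if n = 12 then [((1, 0), 12), ((1, 0), 13)] else
    if n = 13 then [((-1, 0), 12), ((1, 0), 13)] else [((2, 0), n)]

/-- The vectors of the basis. -/
noncomputable def frame (n : ℕ) : Space :=
  Lin.eval (fun c => (Pi.single (coord c) 1 : Space)) (frameData n)

/-- The coordinates with respect to the basis, multiplied by two. -/
noncomputable def coframe (n : ℕ) : Space →ₗ[ℂ] ℂ :=
  Lin.eval (fun c => (LinearMap.proj (coord c) : Space →ₗ[ℂ] ℂ)) (coframeData n)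

/-- The matrix entries with respect to the weight basis, numbered like `entry` and multiplied by
two. -/
noncomputable def wtEntry (A : Space →L[ℂ] Space) (n : ℕ) : ℂ :=
  coframe (n / 16) (A (frame (n % 16)))

/-- `wtEntry` in terms of `entry`. -/
def wtEntryData (n : ℕ) : Lin ℕ :=
  (coframeData (n / 16)).flatMap fun s => (frameData (n % 16)).map fun t =>
    (GInt.mul s.1 t.1, entryNum s.2 t.2)

lemma frameData_lt {n : ℕ} (hn : n < 16) : ∀ t ∈ frameData n, t.2 < 16 := by
  intro t ht
  unfold frameData at ht
  split_ifs at ht <;> simp at ht <;> aesop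

lemma eval_wtEntryData (A : Space →L[ℂ] Space) (n : ℕ) :
    Lin.eval (entry A) (wtEntryData n) = wtEntry A n := by
  have h1 : ∀ (s : GInt × ℕ) (l : Lin ℕ), (∀ t ∈ l, t.2 < 16) →
      Lin.eval (entry A) (l.map fun t => (GInt.mul s.1 t.1, entryNum s.2 t.2)) =
        GInt.toC s.1 * A (Lin.eval (fun c => (Pi.single (coord c) 1 : Space)) l) (coord s.2) := by
    intro s l hl
    induction l with
    | nil => simp
    | cons t l ih =>
      simp only [List.map_cons, Lin.eval_cons, map_add, map_smul, Pi.add_apply, Pi.smul_apply,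
        smul_eq_mul, GInt.toC_mul]
      rw [ih fun t ht => hl t (List.mem_cons_of_mem _ ht),
        entry_entryNum A _ (hl t List.mem_cons_self)]
      ring
  have h2 : ∀ (l : Lin ℕ) (x : Space),
      (Lin.eval (fun c => (LinearMap.proj (coord c) : Space →ₗ[ℂ] ℂ)) l) x =
        (l.map fun s => GInt.toC s.1 * x (coord s.2)).sum := by
    intro l x
    induction l with
    | nil => simp
    | cons t l ih => simp [ih]
  rw [wtEntryData, Lin.eval_flatMap, wtEntry, coframe, h2]
  simp only [h1 _ _ (frameData_lt (Nat.mod_lt n (by norm_num)))]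
  rfl

lemma coframe_separates {x : Space} (h : ∀ k < 16, coframe k x = 0) : x = 0 := by
  have h12 := h 12 (by norm_num)
  have h13 := h 13 (by norm_num)
  simp [coframe, coframeData, GInt.toC] at h12 h13
  funext i
  obtain ⟨n, hn, rfl⟩ := exists_coord i
  by_cases e12 : n = 12
  · subst e12
    change x (coord 12) = 0
    linear_combination (h12 - h13) / 2
  by_cases e13 : n = 13
  · subst e13
    change x (coord 13) = 0
    linear_combination (h12 + h13) / 2
  have hk := h n hn
  simp [coframe, coframeData, e12, e13, GInt.toC] at hk
  exact hk

/-- Linear maps that agree on the weight basis are equal. -/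
lemma eq_zero_of_frame {F : Type*} [AddCommGroup F] [Module ℂ F] {f : Space →ₗ[ℂ] F}
    (h : ∀ k < 16, f (frame k) = 0) : f = 0 := by
  have h12 := h 12 (by norm_num)
  have h13 := h 13 (by norm_num)
  simp [frame, frameData, GInt.toC] at h12 h13
  refine LinearMap.pi_ext' fun i => LinearMap.ext_ring ?_
  obtain ⟨n, hn, rfl⟩ := exists_coord i
  simp only [LinearMap.comp_apply, LinearMap.coe_single, LinearMap.zero_apply]
  have e13 : f (Pi.single (coord 13) 1) = 0 := by
    have h2 : (2 : ℂ) • f (Pi.single (coord 13) 1) = 0 := by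
      calc (2 : ℂ) • f (Pi.single (coord 13) 1)
          = (f (Pi.single (coord 12) 1) + f (Pi.single (coord 13) 1)) +
              (-f (Pi.single (coord 12) 1) + f (Pi.single (coord 13) 1)) := by
            rw [two_smul]; abel
        _ = 0 := by rw [h12, h13, add_zero]
    exact (smul_eq_zero.mp h2).resolve_left two_ne_zero
  have e12 : f (Pi.single (coord 12) 1) = 0 := by rwa [e13, add_zero] at h12
  by_cases n12 : n = 12
  · rwa [n12]
  by_cases n13 : n = 13
  · rwa [n13]
  have hk := h n hn
  simpa [frame, frameData, n12, n13, GInt.toC] using hk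

lemma eq_zero_of_wtEntry {A : Space →L[ℂ] Space} (h : ∀ n < 256, wtEntry A n = 0) : A = 0 := by
  have h1 : A.toLinearMap = 0 := eq_zero_of_frame fun l hl => coframe_separates fun k hk => by
    have h2 := h (16 * k + l) (by omega)
    have e1 : (16 * k + l) / 16 = k := by omega
    have e2 : (16 * k + l) % 16 = l := by omega
    rw [wtEntry, e1, e2] at h2
    exact h2
  exact ContinuousLinearMap.ext fun x => congrArg (fun f : Space →ₗ[ℂ] Space => f x) h1

/-! ### The reduction of the matrix entries -/

/-- Integral linear combinations. -/
abbrev IntLin := List (ℤ × ℕ)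

/-- Integral combinations as combinations with Gaussian coefficients. -/
def IntLin.toLin (l : IntLin) : Lin ℕ := l.map fun t => ((t.1, 0), t.2)

/-- The `n`-th entry lists an expression of `wtEntry n` in the entries of `crCoords`, and the
relations that reduce it to this expression. -/
def reduceTab : List (IntLin × IntLin) :=
  [([(1, 0)], []), ([], [(1, 141)]), ([(1, 2)], []), ([(1, 3)], []), ([(1, 4)], []),
  ([(1, 5)], []), ([(1, 6)], []), ([(1, 7)], []), ([(1, 8)], []), ([], [(-1, 1152)]),
  ([], [(1, 1159)]), ([], [(1, 1158)]), ([(1, 12)], []), ([], [(-1, 653)]), ([(1, 14)], []),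
  ([(1, 15)], []), ([], [(1, 69)]), ([(1, 17)], []), ([(1, 18)], []), ([(1, 19)], []),
  ([(1, 20)], []), ([(1, 21)], []), ([(1, 22)], []), ([(1, 23)], []), ([], [(-1, 585)]),
  ([(1, 25)], []), ([(1, 26)], []), ([(1, 27)], []), ([], [(-1, 645)]), ([(1, 29)], []),
  ([], [(1, 587)]), ([], [(1, 586)]), ([(1, 23)], [(-2, 70)]), ([(1, 7)], [(-2, 78), (-2, 254)]),
  ([(1, 34)], []), ([(1, 35)], []), ([(1, 36)], []), ([(1, 37)], []), ([(1, 38)], []),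
  ([], [(-2, 126)]), ([], [(-1, 622)]), ([(1, 15)], [(-2, 678)]), ([(1, 8)], [(-2, 694)]),
  ([], [(2, 702)]), ([(1, 27)], [(2, 646)]), ([], [(1, 590)]), ([(-1, 29)], [(-1, 598)]),
  ([], [(-1, 606)]), ([(-1, 22)], [(-2, 71)]), ([(-1, 6)], [(-2, 201), (2, 171)]), ([(1, 50)], []),
  ([(1, 51)], []), ([(1, 52)], []), ([(1, 53)], []), ([], [(-2, 119)]),
  ([(1, 38)], [(-2, 127), (2, 118)]), ([], [(-1, 623)]), ([(-1, 14)], [(-2, 679)]),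
  ([], [(-2, 695)]), ([(-1, 8)], [(2, 703)]), ([(1, 26)], [(2, 647)]), ([], [(1, 591)]),
  ([], [(-1, 599)]), ([(-1, 29)], [(-2, 729)]), ([(1, 21)], [(-2, 129), (2, 361)]),
  ([(1, 5)], [(-2, 137)]), ([(1, 66)], []), ([(1, 67)], []), ([(1, 68)], []), ([], [(-2, 169)]),
  ([(1, 53)], [(-2, 427)]), ([(-1, 37)], [(-2, 426)]), ([], [(-2, 681)]),
  ([(-1, 12)], [(-1, 1185)]), ([], [(-1, 1201)]), ([], [(1, 1209)]), ([], [(1, 1153)]),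
  ([(-1, 8)], [(2, 649)]), ([(-1, 26)], [(-2, 657)]), ([(1, 27)], [(-2, 665)]),
  ([(1, 20)], [(-2, 64)]), ([(1, 4)], [(-2, 202), (-2, 155)]), ([(1, 82)], []), ([(1, 83)], []),
  ([], [(-2, 96)]), ([(1, 0), (-1, 68), (1, 17)], [(2, 384), (-2, 104)]),
  ([(1, 52)], [(-2, 112), (2, 103)]), ([(-1, 36)], [(-2, 120), (-2, 102)]),
  ([(-1, 29)], [(-1, 616)]), ([], [(-2, 672)]), ([(-1, 14)], [(-2, 688)]), ([(1, 15)], [(2, 696)]),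
  ([(-1, 25)], [(2, 640)]), ([], [(1, 584)]), ([], [(-1, 592)]), ([], [(-1, 600)]),
  ([(-1, 19)], [(1, 93), (-1, 261)]), ([(-1, 3)], [(-2, 138)]), ([(1, 98)], []), ([], [(-2, 154)]),
  ([(1, 83)], [(2, 283)]), ([(1, 67)], [(-2, 170), (2, 153)]),
  ([(1, 0), (1, 17), (-1, 51)], [(-2, 95), (2, 263)]), ([(1, 35)], [(2, 281)]),
  ([(1, 27)], [(-2, 682)]), ([], [(-1, 1186)]), ([(-1, 12)], [(-2, 1398)]), ([], [(1, 1210)]),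
  ([], [(1, 1154)]), ([(1, 15)], [(2, 650)]), ([(1, 25)], [(-2, 658)]), ([], [(-2, 666)]),
  ([(1, 18)], [(-1, 197), (-1, 85)]), ([(1, 2)], [(2, 139)]), ([], [(2, 147)]),
  ([(1, 98)], [(2, 155), (2, 146)]), ([(-1, 82)], [(-2, 210)]),
  ([(-1, 66)], [(2, 171), (-2, 145)]), ([(1, 50)], [(2, 209)]),
  ([(1, 0), (1, 17), (-1, 34)], [(-2, 198), (-2, 86)]), ([(1, 26)], [(2, 683)]), ([], [(1, 1187)]),
  ([], [(1, 1203)]), ([(1, 12)], [(-1, 1211)]), ([], [(-1, 1155)]), ([(-1, 14)], [(-2, 651)]),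
  ([], [(2, 659)]), ([(1, 25)], [(2, 667)]), ([(1, 128)], []), ([], [(2, 8)]), ([], [(2, 16)]),
  ([], [(2, 24)]), ([], [(2, 32)]), ([(1, 133)], []), ([(1, 134)], []), ([(1, 135)], []),
  ([(1, 136)], []), ([], [(2, 160)]), ([(1, 2)], [(2, 176)]), ([(-1, 3)], [(-2, 184)]),
  ([(1, 98)], [(2, 528)]), ([(-1, 4)], [(-2, 416)]), ([(1, 82)], [(2, 80)]),
  ([(1, 83)], [(2, 88)]), ([], [(2, 1)]), ([(1, 145)], []), ([(1, 146)], []), ([(1, 147)], []),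
  ([(1, 148)], []), ([], [(2, 41)]), ([], [(2, 49)]), ([], [(2, 57)]), ([], [(2, 105)]),
  ([(-2, 0), (1, 68), (1, 34), (1, 136), (-1, 17), (1, 51)], [(2, 161), (-2, 560), (-2, 458), (2, 178)]),
  ([(1, 53)], [(2, 233)]), ([(1, 37)], [(2, 297)]), ([(-1, 21)], [(-2, 361)]),
  ([(1, 38)], [(2, 305)]), ([(1, 22)], [(2, 81)]), ([(1, 23)], [(2, 89)]), ([], [(2, 2)]),
  ([(1, 135)], [(2, 10), (-2, 56)]), ([(1, 128)], [(2, 18), (-2, 0)]), ([], [(2, 26)]),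
  ([], [(2, 34)]), ([(1, 147)], [(2, 42), (-2, 25)]), ([(1, 148)], [(2, 50), (-2, 33)]),
  ([], [(2, 58)]), ([(1, 23)], [(2, 106)]), ([(1, 83)], [(2, 218)]),
  ([(1, 34), (1, 136), (-1, 0)], [(2, 178), (-2, 560)]), ([(-1, 35)], [(-2, 410)]),
  ([(1, 19)], [(2, 474)]), ([(-1, 36)], [(-2, 418)]), ([(-1, 20)], [(2, 82)]), ([], [(2, 90)]),
  ([], [(2, 3)]), ([(1, 134)], [(2, 11), (-2, 48)]), ([], [(2, 19)]),
  ([(-1, 128)], [(2, 27), (2, 0)]), ([], [(2, 35)]), ([(1, 146)], [(2, 43), (-2, 17)]),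
  ([], [(2, 51)]), ([(-1, 148)], [(2, 59), (2, 33)]), ([(1, 22)], [(2, 107)]),
  ([(1, 82)], [(2, 275)]), ([(-1, 50)], [(2, 403)]),
  ([(-1, 0), (1, 51), (1, 136)], [(-2, 187), (-2, 504)]), ([(1, 18)], [(2, 531)]),
  ([(1, 52)], [(-2, 419)]), ([], [(2, 83)]), ([(1, 20)], [(2, 91)]),
  ([(-1, 148)], [(2, 33), (1, 5)]), ([], [(1, 13)]), ([(1, 134)], [(-2, 48), (1, 21)]),
  ([(1, 135)], [(-2, 56), (1, 29)]), ([], [(1, 37)]), ([(-1, 145)], [(2, 9), (1, 45)]),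
  ([], [(1, 53)]), ([], [(1, 61)]), ([(1, 38)], [(1, 565)]), ([(-1, 4)], [(1, 165)]),
  ([(-1, 6)], [(1, 181)]), ([(1, 7)], [(-1, 189)]),
  ([(1, 34), (1, 136), (-1, 0), (-1, 17), (1, 51)], [(-2, 560), (-2, 458), (2, 178), (-1, 133)]),
  ([], [(-1, 77)]), ([(-1, 52)], [(-1, 485)]), ([(1, 36)], [(1, 549)]), ([], [(1, 5)]),
  ([(-1, 133)], [(2, 40), (1, 13)]), ([], [(1, 21)]), ([], [(1, 29)]),
  ([(-1, 128)], [(2, 0), (1, 37)]), ([], [(1, 45)]), ([(1, 146)], [(-2, 17), (1, 53)]),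
  ([(1, 147)], [(-2, 25), (1, 61)]), ([(-1, 21)], [(1, 109)]), ([(1, 98)], [(1, 277)]),
  ([(-1, 66)], [(1, 405)]), ([(1, 67)], [(-1, 413)]), ([], [(-1, 133)]),
  ([(-1, 0), (1, 68), (1, 136)], [(-2, 384), (-1, 77)]), ([(-1, 18)], [(1, 85)]),
  ([(-1, 19)], [(1, 93)]), ([(-1, 147)], [(2, 25), (2, 6)]), ([], [(2, 14)]),
  ([(1, 133)], [(2, 22), (-2, 40)]), ([], [(2, 30)]), ([(-1, 135)], [(2, 56), (2, 38)]),
  ([], [(2, 46)]), ([(1, 145)], [(2, 54), (-2, 9)]), ([], [(2, 62)]), ([(1, 37)], [(2, 110)]),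
  ([(-1, 3)], [(2, 166)]), ([(-1, 5)], [(2, 182)]), ([], [(-2, 190)]), ([(-1, 67)], [(2, 478)]),
  ([(-1, 7)], [(2, 254)]), ([(1, 34), (-1, 0), (1, 68), (1, 136), (-1, 17)], [(2, 86), (-2, 384)]),
  ([(1, 35)], [(2, 94)]), ([(1, 146)], [(-2, 17), (2, 7)]), ([], [(2, 15)]), ([], [(2, 23)]),
  ([(1, 133)], [(-2, 40), (2, 31)]), ([(1, 134)], [(-2, 48), (2, 39)]), ([], [(2, 47)]),
  ([], [(2, 55)]), ([(1, 145)], [(2, 63), (-2, 9)]), ([(1, 53)], [(2, 111)]),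
  ([(1, 2)], [(2, 167)]), ([], [(2, 183)]), ([(1, 5)], [(-2, 191)]), ([(1, 66)], [(2, 535)]),
  ([(1, 6)], [(2, 311)]), ([(1, 50)], [(2, 87)]),
  ([(-1, 0), (1, 68), (1, 136), (-1, 17), (1, 51)], [(-2, 384), (2, 95)])]

/-- Numbers of matrix entries that determine an element of `crSpace`. -/
def crCoords : List ℕ :=
  [0, 17, 34, 51, 68, 136, 2, 3, 4, 98, 5, 6, 66, 7, 67, 8, 12, 14, 15, 18, 52, 19, 36, 20, 21, 38, 22, 23, 25, 26, 27, 29, 35, 37, 50, 53, 82, 83, 128, 133, 134, 135, 145, 146, 147, 148]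

/-- The expression of a matrix entry in the entries of `crCoords`. -/
def red (n : ℕ) : Lin ℕ := IntLin.toLin (reduceTab.getD n ([], [])).1

/-- `reduceTab` is correct: every matrix entry differs from its expression in the entries of
`crCoords` by a combination of the relations of `crSpace`. -/
lemma reduce_test : ((List.range 256).all fun n => Lin.eqv (wtEntryData n)
    (Lin.bind (red n) wtEntryData ++
      Lin.bind (IntLin.toLin (reduceTab.getD n ([], [])).2) relData)) = true := by
  decide +kernel

lemma red_crCoords : ((List.range 256).all fun n => (red n).all fun t => crCoords.contains t.2) =
    true := by
  decide +kernel

lemma wtEntry_eq {A : Space →L[ℂ] Space} (hA : A ∈ crSpace) {n : ℕ} (hn : n < 256) :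
    wtEntry A n = Lin.eval (wtEntry A) (red n) := by
  have h := Lin.eval_eq_of_eqv (entry A) (List.all_eq_true.mp reduce_test n (List.mem_range.mpr hn))
  have h0 : ∀ l : Lin ℕ, Lin.eval (fun _ => (0 : ℂ)) l = 0 := fun l => by
    induction l with
    | nil => rfl
    | cons t l ih => simp [ih]
  simp only [Lin.eval_append, Lin.eval_bind, eval_wtEntryData, eval_relData hA, h0, add_zero] at h
  exact h

/-- An element of `crSpace` is determined by 46 of its matrix entries. -/
lemma eq_zero_of_crCoords {A : Space →L[ℂ] Space} (hA : A ∈ crSpace)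
    (h : ∀ n ∈ crCoords, wtEntry A n = 0) : A = 0 := by
  refine eq_zero_of_wtEntry fun n hn => ?_
  rw [wtEntry_eq hA hn]
  have h1 := List.all_eq_true.mp red_crCoords n (List.mem_range.mpr hn)
  generalize red n = l at h1
  induction l with
  | nil => rfl
  | cons t l ih =>
    simp only [List.all_cons, Bool.and_eq_true] at h1
    rw [Lin.eval_cons, ih h1.2, h _ (by simpa using h1.1), smul_zero, add_zero]

end CREII

namespace CREII

/-! ### Prolongation -/

/-- A matrix whose entries satisfy the relations of `red`, as those of an element of `crSpace`
do. -/
def IsReduced (a : ℕ → ℕ → ℂ) : Prop :=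
  ∀ k < 16, ∀ l < 16, a k l = Lin.eval (fun n => a (n / 16) (n % 16)) (red (16 * k + l))

lemma isReduced_of_mem {A : Space →L[ℂ] Space} (hA : A ∈ crSpace) :
    IsReduced fun k l => coframe k (A (frame l)) := by
  intro k hk l hl
  have h := wtEntry_eq hA (n := 16 * k + l) (by omega)
  have e1 : (16 * k + l) / 16 = k := by omega
  have e2 : (16 * k + l) % 16 = l := by omega
  rw [wtEntry, e1, e2] at h
  exact h

/-- The `(k, l)` entry of every reduced matrix vanishes: the difference of the weights is neither a
root nor zero. -/
def far (k l : ℕ) : Bool := (red (16 * k + l)).isEmpty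

/-- The entries `(k, l)` and `(i, j)` of a reduced matrix are multiples of the same entry, the
second one by a nonzero factor: they belong to the same root. -/
def mate (k l i j : ℕ) : Bool :=
  match red (16 * k + l), red (16 * i + j) with
  | [t], [s] => Nat.beq t.2 s.2 && !GInt.isZero s.1
  | _, _ => false

lemma IsReduced.far {a : ℕ → ℕ → ℂ} (ha : IsReduced a) {k l : ℕ} (hk : k < 16) (hl : l < 16)
    (h : far k l = true) : a k l = 0 := by
  rw [ha k hk l hl, List.isEmpty_iff.mp h, Lin.eval_nil]

lemma GInt.toC_ne_zero {c : GInt} (h : GInt.isZero c = false) : GInt.toC c ≠ 0 := by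
  intro h0
  have hre := congrArg Complex.re h0
  have him := congrArg Complex.im h0
  simp [GInt.toC] at hre him
  simp [GInt.isZero, hre, him] at h

lemma IsReduced.mate {a : ℕ → ℕ → ℂ} (ha : IsReduced a) {k l i j : ℕ} (hk : k < 16) (hl : l < 16)
    (hi : i < 16) (hj : j < 16) (h : mate k l i j = true) (h0 : a i j = 0) : a k l = 0 := by
  have h1 := ha k hk l hl
  have h2 := ha i hi j hj
  unfold CREII.mate at h
  split at h
  · next t s ht hs =>
    rw [ht] at h1
    rw [hs, h0] at h2
    simp only [Bool.and_eq_true, Bool.not_eq_true'] at h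
    simp only [Lin.eval_cons, Lin.eval_nil, add_zero, smul_eq_mul] at h1 h2
    rw [h1, Nat.eq_of_beq_eq_true h.1,
      (mul_eq_zero.mp h2.symm).resolve_left (GInt.toC_ne_zero h.2), mul_zero]
  · exact absurd h (by simp)

/-- The identity `2 a_ll = a_kk + ∑ ± a_mm` for `k`, `l` whose weights differ by a root, where `m`
runs over the indices far from `k`. -/
lemma diag_test : ((List.range 16).all fun k => (List.range 16).all fun l =>
    k == l || far k l || Lin.eqv (Lin.scale (2, 0) (red (16 * l + l)))
      (red (16 * k + k) ++ (List.range 16).flatMap fun m =>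
        bif far m k then Lin.scale (bif far m l then (-1, 0) else (1, 0)) (red (16 * m + m))
        else [])) = true := by
  decide +kernel

lemma IsReduced.two_mul_diag {a : ℕ → ℕ → ℂ} (ha : IsReduced a) {k l : ℕ} (hk : k < 16)
    (hl : l < 16) (hkl : k ≠ l) (h : CREII.far k l = false)
    (h0 : ∀ m < 16, CREII.far m k = true → a m m = 0) : 2 * a l l = a k k := by
  have h1 := List.all_eq_true.mp (List.all_eq_true.mp diag_test k (List.mem_range.mpr hk)) l
    (List.mem_range.mpr hl)
  have hb : (k == l) = false := beq_eq_false_iff_ne.mpr hkl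
  rw [h, hb, Bool.false_or, Bool.false_or] at h1
  have h2 := Lin.eval_eq_of_eqv (fun n => a (n / 16) (n % 16)) h1
  rw [Lin.eval_scale, Lin.eval_append, ← ha l hl l hl, ← ha k hk k hk, Lin.eval_flatMap] at h2
  have h3 : ((List.range 16).map fun m => Lin.eval (fun n => a (n / 16) (n % 16))
      (bif CREII.far m k then Lin.scale (bif CREII.far m l then (-1, 0) else (1, 0))
        (red (16 * m + m)) else [])).sum = 0 := by
    refine List.sum_eq_zero fun x hx => ?_
    obtain ⟨m, hm, rfl⟩ := List.mem_map.mp hx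
    have hm' := List.mem_range.mp hm
    cases hf : CREII.far m k
    · rfl
    · rw [cond_true, Lin.eval_scale, ← ha m hm' m hm', h0 m hm' hf, smul_zero]
  rw [h3, add_zero] at h2
  rw [← h2]
  simp [GInt.toC]

/-- If the weights of `k` and `l` differ by a root, the entry `(k, l)` is a multiple of an entry
`(i, j)` with `i` far from `l`; this makes `b k l l` proportional to `b i j l = b i l j = 0`. -/
lemma offDiag_test : ((List.range 16).all fun k => (List.range 16).all fun l =>
    k == l || far k l || (List.range 16).any fun i => far i l &&
      (List.range 16).any fun j => mate k l i j) = true := by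
  decide +kernel

/-- For distinct `k`, `l`, `m`, no two of them far from `k`, some entry `(i, j)` proportional to
`(k, l)` has `i = m`, `j = m` or `i` far from `m`; this reduces `b k l m` to components known to
vanish. -/
lemma distinct_test : ((List.range 16).all fun k => (List.range 16).all fun l =>
    k == l || far k l ||
      (fun M : List (ℕ × ℕ) => (List.range 16).all fun m =>
        k == m || l == m || far k m || M.any fun t => t.1 == m || t.2 == m || far t.1 m)
      ((List.range 256).filterMap fun n =>
        bif mate k l (n / 16) (n % 16) then some (n / 16, n % 16) else none)) = true := by
  decide +kernel

lemma far_comm_test : ((List.range 16).all fun k => (List.range 16).all fun l =>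
    far k l == far l k) = true := by
  decide +kernel

lemma far_comm {k l : ℕ} (hk : k < 16) (hl : l < 16) : far k l = far l k :=
  beq_iff_eq.mp (List.all_eq_true.mp (List.all_eq_true.mp far_comm_test k (List.mem_range.mpr hk)) l
    (List.mem_range.mpr hl))

/-- Every weight differs from some other one by a root. -/
lemma near_test : ((List.range 16).all fun k => (List.range 16).any fun l =>
    !(k == l) && !far k l) = true := by
  decide +kernel

/-- The components `b k l m` of a symmetric bilinear map all of whose slices are reduced. -/
structure IsProlonged (b : ℕ → ℕ → ℕ → ℂ) : Prop where
  reduced : ∀ m < 16, IsReduced fun k l => b k l m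
  symm : ∀ k < 16, ∀ l < 16, ∀ m < 16, b k l m = b k m l

namespace IsProlonged

variable {b : ℕ → ℕ → ℕ → ℂ}

lemma apply_self (hb : IsProlonged b) {k l : ℕ} (hk : k < 16) (hl : l < 16) (hkl : k ≠ l) :
    b k l l = 0 := by
  have h := List.all_eq_true.mp (List.all_eq_true.mp offDiag_test k (List.mem_range.mpr hk)) l
    (List.mem_range.mpr hl)
  simp only [Bool.or_eq_true, List.any_eq_true, Bool.and_eq_true, List.mem_range,
    beq_iff_eq] at h
  rcases h with (h | h) | ⟨i, hi, hf, j, hj, hm⟩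
  · exact absurd h hkl
  · exact (hb.reduced l hl).far hk hl h
  · refine (hb.reduced l hl).mate hk hl hi hj hm ?_
    rw [hb.symm i hi j hj l hl]
    exact (hb.reduced j hj).far hi hl hf

lemma two_mul (hb : IsProlonged b) {k l : ℕ} (hk : k < 16) (hl : l < 16) (hkl : k ≠ l)
    (h : far k l = false) : 2 * b l l k = b k k k := by
  refine (hb.reduced k hk).two_mul_diag hk hl hkl h fun m hm hf => ?_
  rw [hb.symm m hm m hm k hk]
  exact (hb.reduced m hm).far hm hk hf

/-- A prolonged map is determined by the components `b k k k`. -/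
lemma eq_zero (hb : IsProlonged b) (h0 : ∀ k < 16, b k k k = 0) :
    ∀ k < 16, ∀ l < 16, ∀ m < 16, b k l m = 0 := by
  have h1 : ∀ k < 16, ∀ m < 16, b k k m = 0 := by
    intro k hk m hm
    by_cases e : m = k
    · rw [e]; exact h0 k hk
    cases hf : far k m
    · have := hb.two_mul hm hk e (far_comm hk hm ▸ hf)
      rw [h0 m hm] at this
      exact (mul_eq_zero.mp this).resolve_left two_ne_zero
    · rw [hb.symm k hk k hk m hm]
      exact (hb.reduced k hk).far hk hm hf
  intro k hk l hl m hm
  by_cases ekl : k = l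
  · subst ekl; exact h1 k hk m hm
  by_cases ekm : k = m
  · subst ekm; rw [hb.symm k hk l hl k hk]; exact h1 k hk l hl
  by_cases elm : l = m
  · subst elm; exact hb.apply_self hk hl ekl
  have h := List.all_eq_true.mp (List.all_eq_true.mp distinct_test k (List.mem_range.mpr hk)) l
    (List.mem_range.mpr hl)
  simp only [Bool.or_eq_true, beq_iff_eq] at h
  rcases h with (h | h) | h
  · exact absurd h ekl
  · exact (hb.reduced m hm).far hk hl h
  have h2 := List.all_eq_true.mp h m (List.mem_range.mpr hm)
  simp only [Bool.or_eq_true, beq_iff_eq, List.any_eq_true, List.mem_filterMap] at h2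
  rcases h2 with ((h2 | h2) | h2) | ⟨⟨i, j⟩, ⟨n, hn, hm'⟩, h2⟩
  · exact absurd h2 ekm
  · exact absurd h2 elm
  · rw [hb.symm k hk l hl m hm]
    exact (hb.reduced l hl).far hk hm h2
  have hn := List.mem_range.mp hn
  have hi : n / 16 < 16 := by omega
  have hj : n % 16 < 16 := by omega
  cases hmt : mate k l (n / 16) (n % 16)
  · simp [hmt] at hm'
  simp only [hmt, cond_true, Option.some.injEq, Prod.mk.injEq] at hm'
  obtain ⟨rfl, rfl⟩ := hm'
  refine (hb.reduced m hm).mate hk hl hi hj hmt ?_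
  rcases h2 with (h2 | h2) | h2
  · rw [hb.symm _ hi _ hj m hm, ← h2]
    exact h1 _ hi _ hj
  · by_cases e : n / 16 = n % 16
    · rw [e]; exact h1 _ hj m hm
    · simp only at h2
      rw [← h2]; exact hb.apply_self hi hj e
  · rw [hb.symm _ hi _ hj m hm]
    exact (hb.reduced _ hj).far hi hm h2

end IsProlonged

/-- The second prolongation vanishes. -/
lemma second_prolongation_eq_zero {t : ℕ → ℕ → ℕ → ℕ → ℂ}
    (ht : ∀ n < 16, IsProlonged fun k l m => t k l m n)
    (hs : ∀ k < 16, ∀ l < 16, ∀ m < 16, ∀ n < 16, t k l m n = t k l n m) :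
    ∀ k < 16, ∀ l < 16, ∀ m < 16, ∀ n < 16, t k l m n = 0 := by
  intro k hk l hl m hm n hn
  refine (ht n hn).eq_zero (fun k hk => ?_) k hk l hl m hm
  -- the numbers `t k k k n`
  have hsymm : ∀ k < 16, ∀ l < 16, ∀ m < 16, ∀ n < 16, t k l m n = t k m l n :=
    fun k hk l hl m hm n hn => (ht n hn).symm k hk l hl m hm
  have hfar : ∀ k < 16, ∀ n < 16, far k n = true → t k k k n = 0 := fun k hk n hn h => by
    rw [hs k hk k hk k hk n hn, hsymm k hk k hk n hn k hk]
    exact ((ht k hk).reduced k hk).far hk hn h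
  by_cases e : n = k
  · subst e
    have h := List.all_eq_true.mp near_test n (List.mem_range.mpr hn)
    simp only [List.any_eq_true, Bool.and_eq_true, Bool.not_eq_true', List.mem_range,
      beq_eq_false_iff_ne] at h
    obtain ⟨l, hl, hne, hf⟩ := h
    rw [← (ht n hn).two_mul hn hl hne hf, hsymm l hl l hl n hn n hn,
      hs l hl n hn l hl n hn]
    have := (ht l hl).apply_self hl hn (Ne.symm hne)
    rw [this, mul_zero]
  cases hf : far k n
  · -- `2 t k k k n = t n n n k` and, by symmetry, `2 t n n n k = t k k k n`
    have h1 := (ht k hk).two_mul hn hk e (far_comm hk hn ▸ hf)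
    have h2 := (ht n hn).two_mul hk hn (Ne.symm e) hf
    rw [hs k hk k hk n hn k hk] at h1
    rw [hs n hn n hn k hk n hn] at h2
    linear_combination (1 / 3 : ℂ) * h2 + (2 / 3 : ℂ) * h1
  · exact hfar k hk n hn hf

end CREII

namespace CREII

/-! ### Symmetries are complex combinations of the generators -/

open Filter Topology

lemma fderiv_mem_of_eventually_mem {E F : Type*} [NormedAddCommGroup E] [NormedSpace ℂ E]
    [NormedAddCommGroup F] [NormedSpace ℂ F] [FiniteDimensional ℂ F] {f : E → F} {x : E}
    {S : Submodule ℂ F} (hf : DifferentiableAt ℂ f x) (h : ∀ᶠ y in 𝓝 x, f y ∈ S) (v : E) :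
    fderiv ℂ f x v ∈ S := by
  have hline : HasDerivAt (fun t : ℂ => x + t • v) v 0 := by
    simpa using ((hasDerivAt_id (0 : ℂ)).smul_const v).const_add x
  have hf' : HasFDerivAt f (fderiv ℂ f x) (x + (0 : ℂ) • v) := by simpa using hf.hasFDerivAt
  have hd : HasDerivAt (fun t : ℂ => f (x + t • v)) (fderiv ℂ f x v) 0 :=
    hf'.comp_hasDerivAt (0 : ℂ) hline
  have hmem : ∀ᶠ t in 𝓝 (0 : ℂ), f (x + t • v) ∈ S := by
    have := hline.continuousAt.tendsto
    simp only [zero_smul, add_zero] at this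
    exact this.eventually h
  have h0 : f (x + (0 : ℂ) • v) ∈ S := by simpa using h.self_of_nhds
  refine S.closed_of_finiteDimensional.mem_of_tendsto hd.tendsto_slope ?_
  filter_upwards [hmem.filter_mono nhdsWithin_le_nhds] with t ht
  rw [slope_def_module]
  exact S.smul_mem _ (S.sub_mem ht h0)

lemma eventually_eq_zero_of_fderiv {E F : Type*} [NormedAddCommGroup E] [NormedSpace ℂ E]
    [NormedAddCommGroup F] [NormedSpace ℂ F] {f : E → F} {x : E}
    (hf : ∀ᶠ y in 𝓝 x, DifferentiableAt ℂ f y) (h : ∀ᶠ y in 𝓝 x, fderiv ℂ f y = 0)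
    (h0 : f x = 0) : ∀ᶠ y in 𝓝 x, f y = 0 := by
  obtain ⟨r, hr, hball⟩ := Metric.eventually_nhds_iff_ball.mp (hf.and h)
  refine Metric.eventually_nhds_iff_ball.mpr ⟨r, hr, fun y hy => ?_⟩
  rw [← h0]
  have hc : IsPreconnected (Metric.ball x r) :=
    letI := NormedSpace.restrictScalars ℝ ℂ E
    (convex_ball x r).isPreconnected
  exact Metric.isOpen_ball.is_const_of_fderiv_eq_zero hc
    (fun z hz => (hball z hz).1.differentiableWithinAt) (fun z hz => (hball z hz).2) hy
    (Metric.mem_ball_self hr)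

lemma eq_zero_of_components {T : Space →L[ℂ] Space →L[ℂ] Space →L[ℂ] Space}
    (h : ∀ k < 16, ∀ l < 16, ∀ m < 16, ∀ n < 16, coframe k (T (frame n) (frame m) (frame l)) = 0) :
    T = 0 := by
  have h1 : ∀ n < 16, ∀ m < 16, (T (frame n) (frame m)).toLinearMap = 0 := fun n hn m hm =>
    eq_zero_of_frame fun l hl => coframe_separates fun k hk => h k hk l hl m hm n hn
  have h2 : ∀ n < 16, (T (frame n)).toLinearMap = 0 := fun n hn =>
    eq_zero_of_frame fun m hm => ContinuousLinearMap.ext fun x =>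
      congrArg (fun f : Space →ₗ[ℂ] Space => f x) (h1 n hn m hm)
  have h3 : T.toLinearMap = 0 := eq_zero_of_frame fun n hn => ContinuousLinearMap.ext fun x =>
    congrArg (fun f : Space →ₗ[ℂ] (Space →L[ℂ] Space) => f x) (h2 n hn)
  exact ContinuousLinearMap.ext fun x =>
    congrArg (fun f : Space →ₗ[ℂ] (Space →L[ℂ] Space →L[ℂ] Space) => f x) h3

section jets

variable {X : Space → Space} {p₀ : Space}

/-- If the derivative of a field stays in `crSpace`, its second derivative is a symmetric bilinear map
with all slices in `crSpace`. -/
lemma isProlonged_snd (hX : AnalyticAt ℂ X p₀) (h : ∀ᶠ p in 𝓝 p₀, fderiv ℂ X p ∈ crSpace) :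
    IsProlonged fun k l m => coframe k (fderiv ℂ (fderiv ℂ X) p₀ (frame m) (frame l)) where
  reduced m _ := isReduced_of_mem
    (fderiv_mem_of_eventually_mem hX.fderiv.differentiableAt h (frame m))
  symm k _ l _ m _ := by
    have hs : IsSymmSndFDerivAt ℂ X p₀ :=
      (hX.contDiffAt (n := 2)).isSymmSndFDerivAt (by simp)
    rw [hs.eq]

lemma eventually_snd_symm (hX : AnalyticAt ℂ X p₀) : ∀ᶠ p in 𝓝 p₀, ∀ v w,
    fderiv ℂ (fderiv ℂ X) p v w = fderiv ℂ (fderiv ℂ X) p w v := by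
  filter_upwards [hX.eventually_analyticAt] with p hp v w
  have hs : IsSymmSndFDerivAt ℂ X p :=
    (hp.contDiffAt (n := 2)).isSymmSndFDerivAt (by simp)
  exact hs.eq v w

lemma fderiv_clm_apply_const {E F G : Type*} [NormedAddCommGroup E] [NormedSpace ℂ E]
    [NormedAddCommGroup F] [NormedSpace ℂ F] [NormedAddCommGroup G] [NormedSpace ℂ G]
    {f : E → F →L[ℂ] G} {x : E} (hf : DifferentiableAt ℂ f x) (v : F) (u : E) :
    fderiv ℂ (fun y => f y v) x u = fderiv ℂ f x u v := by
  have := hf.hasFDerivAt.clm_apply (hasFDerivAt_const v x)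
  rw [this.fderiv]
  simp

/-- The third derivative is a second prolongation of `crSpace`, hence zero. -/
lemma third_fderiv_eq_zero (hX : AnalyticAt ℂ X p₀) (h : ∀ᶠ p in 𝓝 p₀, fderiv ℂ X p ∈ crSpace) :
    fderiv ℂ (fderiv ℂ (fderiv ℂ X)) p₀ = 0 := by
  have hd2 : DifferentiableAt ℂ (fderiv ℂ (fderiv ℂ X)) p₀ := hX.fderiv.fderiv.differentiableAt
  have hmem : ∀ u v, fderiv ℂ (fderiv ℂ (fderiv ℂ X)) p₀ u v ∈ crSpace := fun u v => by
    rw [← fderiv_clm_apply_const hd2]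
    refine fderiv_mem_of_eventually_mem (hd2.clm_apply (differentiableAt_const v)) ?_ u
    filter_upwards [h.eventually_nhds, hX.eventually_analyticAt] with p hp hpX
    exact fderiv_mem_of_eventually_mem hpX.fderiv.differentiableAt hp v
  have hs1 : ∀ u v, fderiv ℂ (fderiv ℂ (fderiv ℂ X)) p₀ u v =
      fderiv ℂ (fderiv ℂ (fderiv ℂ X)) p₀ v u := by
    have hs : IsSymmSndFDerivAt ℂ (fderiv ℂ X) p₀ :=
      (hX.fderiv.contDiffAt (n := 2)).isSymmSndFDerivAt (by simp)
    exact fun u v => hs.eq u v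
  have hs2 : ∀ u v w, fderiv ℂ (fderiv ℂ (fderiv ℂ X)) p₀ u v w =
      fderiv ℂ (fderiv ℂ (fderiv ℂ X)) p₀ u w v := fun u v w => by
    have hv : ∀ v, DifferentiableAt ℂ (fun p => fderiv ℂ (fderiv ℂ X) p v) p₀ := fun v =>
      hd2.clm_apply (differentiableAt_const v)
    rw [← fderiv_clm_apply_const hd2, ← fderiv_clm_apply_const hd2,
      ← fderiv_clm_apply_const (hv v), ← fderiv_clm_apply_const (hv w)]
    have : (fun p => fderiv ℂ (fderiv ℂ X) p v w) =ᶠ[𝓝 p₀]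
        fun p => fderiv ℂ (fderiv ℂ X) p w v := by
      filter_upwards [eventually_snd_symm hX] with p hp using hp v w
    rw [this.fderiv_eq]
  refine eq_zero_of_components (second_prolongation_eq_zero (t := fun k l m n =>
    coframe k (fderiv ℂ (fderiv ℂ (fderiv ℂ X)) p₀ (frame n) (frame m) (frame l)))
    (fun n _ => ⟨fun m _ => isReduced_of_mem (hmem _ _), fun k _ l _ m _ => ?_⟩)
    fun k _ l _ m _ n _ => ?_)
  · rw [hs2]
  · rw [hs1]

/-- A field satisfying the first-order condition is determined by part of its 2-jet. -/
lemma eventually_eq_zero_of_jet (hX : AnalyticAt ℂ X p₀)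
    (h : ∀ᶠ p in 𝓝 p₀, fderiv ℂ X p ∈ crSpace) (h0 : X p₀ = 0)
    (h1 : ∀ n ∈ crCoords, wtEntry (fderiv ℂ X p₀) n = 0)
    (h2 : ∀ k < 16, coframe k (fderiv ℂ (fderiv ℂ X) p₀ (frame k) (frame k)) = 0) :
    ∀ᶠ p in 𝓝 p₀, X p = 0 := by
  have hev := hX.eventually_analyticAt
  have e2 : fderiv ℂ (fderiv ℂ X) p₀ = 0 := by
    have hz := (isProlonged_snd hX h).eq_zero h2
    have h3 : ∀ m < 16, (fderiv ℂ (fderiv ℂ X) p₀ (frame m)).toLinearMap = 0 := fun m hm =>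
      eq_zero_of_frame fun l hl => coframe_separates fun k hk => hz k hk l hl m hm
    have h4 : (fderiv ℂ (fderiv ℂ X) p₀).toLinearMap = 0 := eq_zero_of_frame fun m hm =>
      ContinuousLinearMap.ext fun x => congrArg (fun f : Space →ₗ[ℂ] Space => f x) (h3 m hm)
    exact ContinuousLinearMap.ext fun x =>
      congrArg (fun f : Space →ₗ[ℂ] (Space →L[ℂ] Space) => f x) h4
  have d3 : ∀ᶠ p in 𝓝 p₀, fderiv ℂ (fderiv ℂ (fderiv ℂ X)) p = 0 := by
    filter_upwards [hev, h.eventually_nhds] with p hp hp' using third_fderiv_eq_zero hp hp'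
  have d2 : ∀ᶠ p in 𝓝 p₀, fderiv ℂ (fderiv ℂ X) p = 0 :=
    eventually_eq_zero_of_fderiv (hev.mono fun p hp => hp.fderiv.fderiv.differentiableAt) d3 e2
  have d1 : ∀ᶠ p in 𝓝 p₀, fderiv ℂ X p = 0 :=
    eventually_eq_zero_of_fderiv (hev.mono fun p hp => hp.fderiv.differentiableAt) d2
      (eq_zero_of_crCoords h.self_of_nhds h1)
  exact eventually_eq_zero_of_fderiv (hev.mono fun p hp => hp.differentiableAt) d1 h0

end jets

variable {U : TopologicalSpace.Opens Space} {p₀ : Space}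

lemma HolField.eventually_fderiv_add (hp : p₀ ∈ U) (X Y : HolField U) :
    fderiv ℂ ((X + Y : HolField U) : Space → Space) =ᶠ[𝓝 p₀]
      fderiv ℂ (X : Space → Space) + fderiv ℂ (Y : Space → Space) := by
  filter_upwards [U.isOpen.mem_nhds hp] with p hpU
  exact fderiv_add (HolField.analyticAt X hpU).differentiableAt
    (HolField.analyticAt Y hpU).differentiableAt

lemma HolField.eventually_fderiv_smul (hp : p₀ ∈ U) (c : ℂ) (X : HolField U) :
    fderiv ℂ ((c • X : HolField U) : Space → Space) =ᶠ[𝓝 p₀]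
      c • fderiv ℂ (X : Space → Space) := by
  filter_upwards [U.isOpen.mem_nhds hp] with p hpU
  exact fderiv_const_smul (HolField.analyticAt X hpU).differentiableAt c

/-- The complex vector space of the fields that satisfy the first-order condition near a point. -/
noncomputable def crFields (hp : p₀ ∈ U) : Submodule ℂ (HolField U) where
  carrier := {X | ∀ᶠ p in 𝓝 p₀, fderiv ℂ (X : Space → Space) p ∈ crSpace}
  add_mem' {X Y} hX hY := by
    filter_upwards [hX, hY, HolField.eventually_fderiv_add hp X Y] with p h1 h2 h3
    rw [h3]
    exact add_mem h1 h2
  zero_mem' := Eventually.of_forall fun p => by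
    have : fderiv ℂ ((0 : HolField U) : Space → Space) p = 0 := fderiv_const_apply 0
    rw [this]
    exact zero_mem _
  smul_mem' c X hX := by
    filter_upwards [hX, HolField.eventually_fderiv_smul hp c X] with p h1 h3
    rw [h3]
    exact crSpace.smul_mem c h1

/-- The part of the 2-jet of a field at a point that determines a field in `crFields`. -/
noncomputable def jetMap (hp : p₀ ∈ U) :
    HolField U →ₗ[ℂ] Space × (Fin crCoords.length → ℂ) × (Fin 16 → ℂ) where
  toFun X := ((X : Space → Space) p₀,
    fun n => wtEntry (fderiv ℂ (X : Space → Space) p₀) (crCoords.get n),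
    fun k => coframe k (fderiv ℂ (fderiv ℂ (X : Space → Space)) p₀ (frame k) (frame k)))
  map_add' X Y := by
    have h1 := HolField.eventually_fderiv_add hp X Y
    have hX := HolField.analyticAt X hp
    have hY := HolField.analyticAt Y hp
    have h2 : fderiv ℂ (fderiv ℂ ((X + Y : HolField U) : Space → Space)) p₀ =
        fderiv ℂ (fderiv ℂ (X : Space → Space)) p₀ + fderiv ℂ (fderiv ℂ (Y : Space → Space)) p₀ := by
      rw [h1.fderiv_eq, fderiv_add hX.fderiv.differentiableAt hY.fderiv.differentiableAt]
    refine Prod.ext rfl (Prod.ext (funext fun n => ?_) (funext fun k => ?_))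
    · simp only [wtEntry]
      rw [h1.eq_of_nhds]
      simp
    · simp only
      rw [h2]
      simp
  map_smul' c X := by
    have h1 := HolField.eventually_fderiv_smul hp c X
    have hX := HolField.analyticAt X hp
    have h2 : fderiv ℂ (fderiv ℂ ((c • X : HolField U) : Space → Space)) p₀ =
        c • fderiv ℂ (fderiv ℂ (X : Space → Space)) p₀ := by
      rw [h1.fderiv_eq, fderiv_const_smul hX.fderiv.differentiableAt]
    refine Prod.ext rfl (Prod.ext (funext fun n => ?_) (funext fun k => ?_))
    · simp only [wtEntry]
      rw [h1.eq_of_nhds]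
      simp
    · simp only
      rw [h2]
      simp

/-- The complex dimension of `crFields` is at most `16 + 46 + 16 = 78`. -/
lemma jetMap_injective (hU : IsConnected (U : Set Space)) (hp : p₀ ∈ U) :
    Function.Injective ((jetMap hp).comp (crFields hp).subtype) := by
  rw [injective_iff_map_eq_zero]
  intro X hX
  have h1 : ((X : HolField U) : Space → Space) p₀ = 0 := congrArg Prod.fst hX
  have h2 := congrArg (fun t => t.2.1) hX
  have h3 := congrArg (fun t => t.2.2) hX
  have h0 := eventually_eq_zero_of_jet (HolField.analyticAt (X : HolField U) hp) X.2 h1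
    (fun n hn => by
      obtain ⟨i, hi⟩ := List.get_of_mem hn
      rw [← hi]
      exact congrFun h2 i)
    (fun k hk => congrFun h3 ⟨k, hk⟩)
  exact Subtype.ext (HolField.eq_of_eventuallyEq hU hp h0)

/-- The restrictions of the generators are linearly independent over the complex numbers. -/
lemma linearIndependent_restrict_gen (hU : (U : Set Space).Nonempty) :
    LinearIndependent ℂ fun k : Fin 78 => PolyField.restrict U (gen k) :=
  linearIndependent_gen.map' _ (LinearMap.ker_eq_bot.mpr (PolyField.restrict_injective hU))

/-- Every infinitesimal CR symmetry is a complex combination of the generators. -/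
lemma mem_span_gen (hU : IsConnected (U : Set Space)) (hp : p₀ ∈ U) (hM : p₀ ∈ quadric)
    {X : HolField U} (hX : X ∈ hol U) :
    X ∈ Submodule.span ℂ (Set.range fun k : Fin 78 => PolyField.restrict U (gen k)) := by
  have hmem : ∀ {Y : HolField U}, Y ∈ hol U → Y ∈ crFields hp := fun hY =>
    eventually_fderiv_mem_crSpace hY hM hp
  have hinj := jetMap_injective hU hp
  have : FiniteDimensional ℂ (crFields hp) := Module.Finite.of_injective _ hinj
  have hle : finrank ℂ (crFields hp) ≤ 78 := by
    refine (LinearMap.finrank_le_finrank_of_injective hinj).trans (le_of_eq ?_)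
    have hlen : crCoords.length = 46 := rfl
    simp [Space, hlen]
  let G : Fin 78 → crFields hp := fun k =>
    ⟨PolyField.restrict U (gen k), hmem (restrict_gen_mem_hol U k.2)⟩
  have hG : LinearIndependent ℂ G := by
    have h := linearIndependent_restrict_gen (U := U) hU.nonempty
    exact LinearIndependent.of_comp (crFields hp).subtype h
  have hcard : Fintype.card (Fin 78) = finrank ℂ (crFields hp) :=
    le_antisymm hG.fintype_card_le_finrank (by simpa using hle)
  have htop := hG.span_eq_top_of_card_eq_finrank' hcard
  have h1 : (⟨X, hmem hX⟩ : crFields hp) ∈ Submodule.span ℂ (Set.range G) := htop ▸ trivial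
  have h2 := Submodule.mem_map_of_mem (f := (crFields hp).subtype) h1
  rw [Submodule.map_span, ← Set.range_comp] at h2
  exact h2

end CREII

namespace CREII

/-! ### Symmetries are real combinations of the generators -/

open Filter Topology

variable {U : TopologicalSpace.Opens Space} {p₀ : Space}

/-- There is no nonzero holomorphic field `X` such that both `X` and `i X` are tangent to the
quadric. -/
lemma eq_zero_of_I_smul_mem (hU : IsConnected (U : Set Space)) (hp : p₀ ∈ U) (hM : p₀ ∈ quadric)
    {X : HolField U} (h1 : X ∈ hol U) (h2 : Complex.I • X ∈ hol U) : X = 0 := by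
  -- on the quadric, `X` is a CR tangent vector
  have hcr : ∀ p ∈ quadric, p ∈ U → ∀ j, wPart ((X : Space → Space) p) j -
      segre (zPart ((X : Space → Space) p)) (star (zPart p)) j = 0 := by
    intro p hpM hpU j
    have e1 := mem_tangent_iff.mp (h1 p hpM hpU) j
    have e2 := mem_tangent_iff.mp (h2 p hpM hpU) j
    have f1 : zPart (((Complex.I • X : HolField U) : Space → Space) p) =
      Complex.I • zPart ((X : Space → Space) p) := rfl
    have f2 : wPart (((Complex.I • X : HolField U) : Space → Space) p) j =
      Complex.I * wPart ((X : Space → Space) p) j := rfl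
    have f3 : star (Complex.I • zPart ((X : Space → Space) p)) =
        -Complex.I • star (zPart ((X : Space → Space) p)) := by
      funext i; simp
    rw [complexDifferential] at e1 e2
    rw [f1, f2, f3] at e2
    simp only [segre_smul_left, segre_smul_right, Pi.smul_apply, smul_eq_mul, map_mul,
      Complex.conj_I] at e2
    linear_combination (1 / 2 : ℂ) * e1 - (Complex.I / 2) * e2 +
      (1 / 2) * (wPart ((X : Space → Space) p) j -
        conjSign j * starRingEnd ℂ (wPart ((X : Space → Space) p) j) -
        segre (zPart ((X : Space → Space) p)) (star (zPart p)) j +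
        segre (zPart p) (star (zPart ((X : Space → Space) p))) j) * Complex.I_sq
  have key : ∀ j, ∀ᶠ q in 𝓝 (p₀, star (zPart p₀)),
      wPart ((X : Space → Space) q.1) j - segre (zPart ((X : Space → Space) q.1)) q.2 j = 0 := by
    intro j
    refine eventually_eq_zero_of_quadric hM ?_ ?_
    · have hU : ∀ᶠ q in 𝓝 (p₀, star (zPart p₀)), q.1 ∈ U :=
        (continuous_fst.tendsto (p₀, star (zPart p₀))).eventually (U.isOpen.mem_nhds hp)
      filter_upwards [hU] with q hq
      have hd : DifferentiableAt ℂ (fun q : Space × (Fin 8 → ℂ) => (X : Space → Space) q.1) q :=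
        (HolField.analyticAt X hq).differentiableAt.comp q differentiableAt_fst
      exact (differentiableAt_pi.mp hd (.inr j)).sub
        (differentiable_segre (differentiableAt_pi.mpr fun i =>
          differentiableAt_pi.mp hd (.inl i)) differentiableAt_snd j)
    · filter_upwards [U.isOpen.mem_nhds hp] with p hpU hpM using hcr p hpM hpU j
  have hall := eventually_all.mpr key
  rw [nhds_prod_eq] at hall
  refine HolField.eq_of_eventuallyEq hU hp ?_
  filter_upwards [hall.curry] with p hev
  have hz : zPart ((X : Space → Space) p) = 0 := by
    funext m
    -- move `ζ` in the direction of the partner of `m` in the fourth form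
    have hline : Tendsto (fun s : ℂ => star (zPart p₀) + s • (Pi.single (segrePartner 4 m) 1 :
        Fin 8 → ℂ)) (𝓝[≠] 0) (𝓝 (star (zPart p₀))) := by
      have hc : Continuous fun s : ℂ => star (zPart p₀) + s • (Pi.single (segrePartner 4 m) 1 :
          Fin 8 → ℂ) := by fun_prop
      have := hc.tendsto 0
      simp only [zero_smul, add_zero] at this
      exact this.mono_left nhdsWithin_le_nhds
    obtain ⟨s, hs, hs0⟩ := ((hline.eventually hev).and self_mem_nhdsWithin).exists
    have e1 := hs 4
    have e2 := hev.self_of_nhds 4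
    simp only [segre_add_right, segre_smul_right, Pi.add_apply, Pi.smul_apply, smul_eq_mul] at e1
    have e3 : s * segre (zPart ((X : Space → Space) p)) (Pi.single (segrePartner 4 m) 1) 4 = 0 := by
      linear_combination e2 - e1
    have e4 := (mul_eq_zero.mp e3).resolve_left hs0
    have hcoef : ∀ m n, segreCoef 4 n (segrePartner 4 m) = if n = m then segreSign 4 m else 0 := by
      decide
    rw [segre_single_right, Finset.sum_eq_single m] at e4
    · have hne : ∀ m, segreSign 4 m ≠ 0 := by decide
      rw [hcoef, if_pos rfl] at e4
      exact (mul_eq_zero.mp e4).resolve_left (by exact_mod_cast hne m)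
    · intro n _ hn
      rw [hcoef, if_neg hn, Int.cast_zero, zero_mul]
    · simp
  funext i
  rcases i with i | i
  · exact congrFun hz i
  · have e2 := hev.self_of_nhds i
    have h0 : segre 0 (star (zPart p₀)) = 0 := by simpa using segre_smul_left 0 0 (star (zPart p₀))
    rw [hz, h0] at e2
    simpa using e2

/-- The restriction of a generator, as an infinitesimal CR symmetry. -/
noncomputable def holGen (U : TopologicalSpace.Opens Space) (k : ℕ) : hol U :=
  if h : k < 78 then ⟨PolyField.restrict U (gen k), restrict_gen_mem_hol U h⟩ else 0

lemma coe_holGen {k : ℕ} (hk : k < 78) : (holGen U k : HolField U) = PolyField.restrict U (gen k) := by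
  rw [holGen, dif_pos hk]

/-- If `X = A + i B` with `A`, `B` real combinations of the generators, then `B` and
`i B = X - A` are both tangent to the quadric, so `B = 0`. -/
lemma mem_real_span_gen (hU : IsConnected (U : Set Space)) (hp : p₀ ∈ U) (hM : p₀ ∈ quadric)
    {X : HolField U} (hX : X ∈ hol U) :
    X ∈ Submodule.span ℝ (Set.range fun k : Fin 78 => PolyField.restrict U (gen k)) := by
  obtain ⟨c, hc⟩ := (Submodule.mem_span_range_iff_exists_fun ℂ).mp (mem_span_gen hU hp hM hX)
  let A : HolField U := ∑ k : Fin 78, (c k).re • PolyField.restrict U (gen k)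
  let B : HolField U := ∑ k : Fin 78, (c k).im • PolyField.restrict U (gen k)
  have hmem : ∀ a : Fin 78 → ℝ, ∑ k : Fin 78, a k • PolyField.restrict U (gen k) ∈ hol U :=
    fun a => sum_mem fun k _ => (hol U).smul_mem (a k) (restrict_gen_mem_hol U k.2)
  have hXAB : X = A + Complex.I • B := by
    rw [← hc, Finset.smul_sum, ← Finset.sum_add_distrib]
    refine Finset.sum_congr rfl fun k _ => ?_
    change _ = ((c k).re : ℂ) • PolyField.restrict U (gen k) +
      Complex.I • ((c k).im : ℂ) • PolyField.restrict U (gen k)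
    rw [smul_smul, ← add_smul, mul_comm Complex.I, Complex.re_add_im]
  have hIB : Complex.I • B ∈ hol U := by
    have : Complex.I • B = X - A := by rw [hXAB]; abel
    rw [this]
    exact sub_mem hX (hmem _)
  have hB : B = 0 := eq_zero_of_I_smul_mem hU hp hM (hmem _) hIB
  rw [hXAB, hB, smul_zero, add_zero]
  exact Submodule.sum_mem _ fun k _ => Submodule.smul_mem _ _ (Submodule.subset_span ⟨k, rfl⟩)

lemma span_gen_eq_hol (hU : IsConnected (U : Set Space)) (hp : p₀ ∈ U) (hM : p₀ ∈ quadric) :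
    Submodule.span ℝ (Set.range fun k : Fin 78 => PolyField.restrict U (gen k)) =
      (hol U).toSubmodule := by
  refine le_antisymm (Submodule.span_le.mpr ?_) fun X hX => mem_real_span_gen hU hp hM hX
  rintro _ ⟨k, rfl⟩
  exact restrict_gen_mem_hol U k.2

lemma linearIndependent_real_gen (hU : (U : Set Space).Nonempty) :
    LinearIndependent ℝ fun k : Fin 78 => PolyField.restrict U (gen k) :=
  (linearIndependent_restrict_gen hU).restrict_scalars' ℝ

/-! ### The grading -/

/-- The projection of a polynomial field to its part of a given weight. -/
noncomputable def weightPart (k : ℤ) : PolyField →ₗ[ℂ] PolyField :=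
  LinearMap.pi fun i => (MvPolynomial.weightedHomogeneousComponent weight (k + weight i)) ∘ₗ
    LinearMap.proj i

lemma weightPart_same {k : ℤ} {F : PolyField} (hF : F ∈ PolyField.ofWeight k) :
    weightPart k F = F :=
  funext fun i => MvPolynomial.IsWeightedHomogeneous.weightedHomogeneousComponent_same
    (hF i trivial)

lemma weightPart_ne {k l : ℤ} (h : l ≠ k) {F : PolyField} (hF : F ∈ PolyField.ofWeight l) :
    weightPart k F = 0 :=
  funext fun i => MvPolynomial.IsWeightedHomogeneous.weightedHomogeneousComponent_ne _
    (hF i trivial) fun e => h (add_right_cancel e).symm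

lemma polyBracket_mem_ofWeight {k l : ℤ} {F G : PolyField} (hF : F ∈ PolyField.ofWeight k)
    (hG : G ∈ PolyField.ofWeight l) : polyBracket F G ∈ PolyField.ofWeight (k + l) := by
  have key : ∀ {k l : ℤ} {F G : PolyField}, F ∈ PolyField.ofWeight k → G ∈ PolyField.ofWeight l →
      ∀ i j, MvPolynomial.IsWeightedHomogeneous weight (F j * MvPolynomial.pderiv j (G i))
        (k + l + weight i) := by
    intro k l F G hF hG i j
    have h1 : MvPolynomial.IsWeightedHomogeneous weight (F j) (k + weight j) := hF j trivial
    have h2 : MvPolynomial.IsWeightedHomogeneous weight (G i) (l + weight i) := hG i trivial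
    have h3 := h1.mul (h2.pderiv (i := j) (n' := l + weight i - weight j) (by ring))
    have e : k + weight j + (l + weight i - weight j) = k + l + weight i := by ring
    rwa [e] at h3
  intro i _
  refine Submodule.sum_mem _ fun j _ => Submodule.sub_mem _ (key hF hG i j) ?_
  have := key hG hF i j
  rwa [add_comm l k] at this

/-- The pieces of the grading are spanned by the generators of the given weight. -/
lemma graded_eq_span (hU : IsConnected (U : Set Space)) (hp : p₀ ∈ U) (hM : p₀ ∈ quadric)
    (w : ℤ) : graded U w = Submodule.span ℝ
      ((fun k : Fin 78 => PolyField.restrict U (gen k)) '' {k | genWeight k = w}) := by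
  apply le_antisymm
  · rintro X ⟨hX, F, hF, hFX⟩
    obtain ⟨a, ha⟩ := (Submodule.mem_span_range_iff_exists_fun ℝ).mp
      (mem_real_span_gen hU hp hM hX)
    have hFa : F = ∑ k : Fin 78, (a k : ℂ) • gen k := by
      refine PolyField.restrict_injective hU.nonempty ?_
      rw [hFX, ← ha, map_sum]
      exact Finset.sum_congr rfl fun k _ => by rw [map_smul]; rfl
    have h1 : F = ∑ k : Fin 78, (if genWeight k = w then (a k : ℂ) else 0) • gen k := by
      rw [← weightPart_same hF]
      conv_lhs => rw [hFa]
      rw [map_sum]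
      refine Finset.sum_congr rfl fun k _ => ?_
      rw [map_smul]
      split_ifs with h
      · rw [weightPart_same (h ▸ gen_mem_ofWeight k.2)]
      · rw [weightPart_ne h (gen_mem_ofWeight k.2), smul_zero, zero_smul]
    change PolyField.restrict U F = X at hFX
    rw [← hFX, h1, map_sum]
    refine Submodule.sum_mem _ fun k _ => ?_
    rw [map_smul]
    split_ifs with h
    · exact Submodule.smul_mem _ (a k) (Submodule.subset_span ⟨k, h, rfl⟩)
    · rw [zero_smul]
      exact zero_mem _
  · refine Submodule.span_le.mpr ?_
    rintro _ ⟨k, hk, rfl⟩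
    have hk' : genWeight k = w := hk
    exact ⟨restrict_gen_mem_hol U k.2, gen k, hk' ▸ gen_mem_ofWeight k.2, rfl⟩

lemma iSupIndep_graded (hU : IsConnected (U : Set Space)) (hp : p₀ ∈ U) (hM : p₀ ∈ quadric) :
    iSupIndep (graded U) := by
  intro w
  have hle : ⨆ v, ⨆ (_ : v ≠ w), graded U v ≤ Submodule.span ℝ
      ((fun k : Fin 78 => PolyField.restrict U (gen k)) '' {k | genWeight k ≠ w}) := by
    refine iSup₂_le fun v hv => ?_
    rw [graded_eq_span hU hp hM]
    refine Submodule.span_mono (Set.image_mono fun k hk => ?_)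
    have hk' : genWeight k = v := hk
    change genWeight k ≠ w
    rwa [hk']
  refine Disjoint.mono_right hle ?_
  rw [graded_eq_span hU hp hM]
  refine (linearIndependent_real_gen hU.nonempty).disjoint_span_image ?_
  exact Set.disjoint_left.mpr fun k hk hk' => hk' hk

lemma iSup_graded (hU : IsConnected (U : Set Space)) (hp : p₀ ∈ U) (hM : p₀ ∈ quadric) :
    ⨆ w, graded U w = (hol U).toSubmodule := by
  refine le_antisymm (iSup_le fun w => inf_le_left) ?_
  rw [← span_gen_eq_hol hU hp hM]
  refine Submodule.span_le.mpr ?_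
  rintro _ ⟨k, rfl⟩
  refine Submodule.mem_iSup_of_mem (genWeight k) ?_
  rw [graded_eq_span hU hp hM]
  exact Submodule.subset_span ⟨k, rfl, rfl⟩

lemma lie_mem_graded {k l : ℤ} {X Y : HolField U} (hX : X ∈ graded U k) (hY : Y ∈ graded U l) :
    ⁅X, Y⁆ ∈ graded U (k + l) := by
  obtain ⟨hX, F, hF, rfl⟩ := hX
  obtain ⟨hY, G, hG, rfl⟩ := hY
  refine ⟨(hol U).lie_mem hX hY, polyBracket F G, polyBracket_mem_ofWeight hF hG, ?_⟩
  exact PolyField.restrict_bracket F G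

lemma graded_eq_bot (hU : IsConnected (U : Set Space)) (hp : p₀ ∈ U) (hM : p₀ ∈ quadric)
    {w : ℤ} (hw : 3 ≤ |w|) : graded U w = ⊥ := by
  rw [graded_eq_span hU hp hM, Submodule.span_eq_bot]
  rintro _ ⟨k, hk, rfl⟩
  have hk' : genWeight k = w := hk
  exfalso
  rw [← hk'] at hw
  unfold genWeight at hw
  split_ifs at hw <;> norm_num at hw

/-- A sublist of the generators that contains exactly those of weight `w` is a basis of the graded
piece of weight `w`. -/
lemma graded_basis (hU : IsConnected (U : Set Space)) (hp : p₀ ∈ U) (hM : p₀ ∈ quadric)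
    {n : ℕ} {F : Fin n → PolyField} {w : ℤ} {s : ℕ}
    (hF : ∀ i : Fin n, F i = gen (s + i)) (hs : ∀ k < 78, genWeight k = w ↔ s ≤ k ∧ k < s + n)
    (hn : s + n ≤ 78) :
    Submodule.span ℝ (Set.range fun i => PolyField.restrict U (F i)) = graded U w ∧
      finrank ℝ (graded U w) = n := by
  let e : Fin n → Fin 78 := fun i => ⟨s + i, by omega⟩
  have he : (fun i => PolyField.restrict U (F i)) =
      (fun k : Fin 78 => PolyField.restrict U (gen k)) ∘ e := funext fun i => by
    simp only [hF]
    rfl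
  have h1 : Submodule.span ℝ (Set.range fun i => PolyField.restrict U (F i)) = graded U w := by
    rw [graded_eq_span hU hp hM, he, Set.range_comp]
    congr 2
    ext k
    constructor
    · rintro ⟨i, rfl⟩
      exact (hs _ (e i).2).mpr ⟨Nat.le_add_right _ _, Nat.add_lt_add_left i.2 s⟩
    · intro hk
      obtain ⟨h1, h2⟩ := (hs _ k.2).mp hk
      exact ⟨⟨k - s, by omega⟩, Fin.ext (by simp only [e]; omega)⟩
  refine ⟨h1, ?_⟩
  rw [← h1, finrank_span_eq_card]
  · simp
  · rw [he]
    refine (linearIndependent_real_gen hU.nonempty).comp e fun i j hij => Fin.ext ?_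
    have := congrArg Fin.val hij
    simpa [e] using this

/-! ### The structure of the Lie algebra -/

section complexify

variable {𝔤 L : Type*} [LieRing 𝔤] [LieAlgebra ℝ 𝔤] [LieRing L] [LieAlgebra ℂ L] [Module ℝ L]
  [IsScalarTower ℝ ℂ L] {φ : 𝔤 →ₗ[ℝ] L}

/-- The complex linear extension of a bracket-preserving real linear map preserves brackets. -/
lemma liftBaseChange_lie (hφ : ∀ x y, φ ⁅x, y⁆ = ⁅φ x, φ y⁆) (x y : ℂ ⊗[ℝ] 𝔤) :
    φ.liftBaseChange ℂ ⁅x, y⁆ = ⁅φ.liftBaseChange ℂ x, φ.liftBaseChange ℂ y⁆ := by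
  induction x using TensorProduct.induction_on with
  | zero => simp
  | add x x' hx hx' => rw [add_lie, map_add, map_add, add_lie, hx, hx']
  | tmul c X =>
    induction y using TensorProduct.induction_on with
    | zero =>
      have h : ⁅(c ⊗ₜ[ℝ] X : ℂ ⊗[ℝ] 𝔤), (0 : ℂ ⊗[ℝ] 𝔤)⁆ = 0 := lie_zero (c ⊗ₜ[ℝ] X : ℂ ⊗[ℝ] 𝔤)
      rw [h, map_zero, lie_zero]
    | add y y' hy hy' =>
      have h : ⁅(c ⊗ₜ[ℝ] X : ℂ ⊗[ℝ] 𝔤), y + y'⁆ = ⁅(c ⊗ₜ[ℝ] X : ℂ ⊗[ℝ] 𝔤), y⁆ +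
        ⁅(c ⊗ₜ[ℝ] X : ℂ ⊗[ℝ] 𝔤), y'⁆ := lie_add (c ⊗ₜ[ℝ] X : ℂ ⊗[ℝ] 𝔤) y y'
      rw [h, map_add, map_add, lie_add, hy, hy']
    | tmul d Y =>
      simp only [LieAlgebra.ExtendScalars.bracket_tmul, LinearMap.liftBaseChange_tmul, hφ,
        smul_lie, lie_smul, smul_smul, mul_comm]

/-- A real Lie algebra spanned by `G` inside a complex Lie algebra in which the members of `G` are
independent and satisfy the bracket relations of the generators. -/
lemma realRealizes_of_complex (hφ : ∀ x y, φ ⁅x, y⁆ = ⁅φ x, φ y⁆) {G : ℕ → 𝔤}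
    (hli : LinearIndependent ℂ fun k : Fin 78 => φ (G k))
    (hspan : Submodule.span ℝ (Set.range fun k : Fin 78 => G k) = ⊤)
    (hlie : ∀ a b c : Lin ℕ, polyBracket (Lin.eval gen a) (Lin.eval gen b) = Lin.eval gen c →
      ⁅Lin.eval (fun k => φ (G k)) a, Lin.eval (fun k => φ (G k)) b⁆ =
        Lin.eval (fun k => φ (G k)) c) : RealRealizes G := by
  have hliR : LinearIndependent ℝ fun k : Fin 78 => G k :=
    LinearIndependent.of_comp φ (hli.restrict_scalars' ℝ)
  let b : Basis (Fin 78) ℝ 𝔤 := Basis.mk hliR hspan.ge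
  have hb : ∀ k, b.baseChange ℂ k = (1 : ℂ) ⊗ₜ[ℝ] G k := fun k => by
    rw [Basis.baseChange_apply, Basis.mk_apply]
  have hb' : (b.baseChange ℂ : Fin 78 → ℂ ⊗[ℝ] 𝔤) = fun k : Fin 78 => (1 : ℂ) ⊗ₜ[ℝ] G k :=
    funext hb
  have hφG : ∀ k, φ.liftBaseChange ℂ ((1 : ℂ) ⊗ₜ[ℝ] G k) = φ (G k) := fun k => by simp
  have hinj : Function.Injective (φ.liftBaseChange ℂ) := by
    rw [injective_iff_map_eq_zero]
    intro x hx
    rw [← (b.baseChange ℂ).sum_repr x, map_sum] at hx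
    simp only [map_smul, hb, hφG] at hx
    have h0 := Fintype.linearIndependent_iff.mp hli _ hx
    refine (b.baseChange ℂ).ext_elem fun k => ?_
    rw [h0 k, map_zero]
    rfl
  have heval : ∀ a : Lin ℕ, φ.liftBaseChange ℂ (Lin.eval (fun k => (1 : ℂ) ⊗ₜ[ℝ] G k) a) =
      Lin.eval (fun k => φ (G k)) a := fun a => by
    rw [Lin.map_eval]
    simp only [hφG]
  refine ⟨⟨fun a c d h => ?_, ?_, ?_⟩, hliR, hspan⟩
  · refine hinj ?_
    rw [liftBaseChange_lie hφ, heval, heval, heval, hlie a c d h]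
  · rw [← hb']
    exact (b.baseChange ℂ).linearIndependent
  · rw [← hb']
    exact (b.baseChange ℂ).span_eq

end complexify

/-- The symmetry algebra has the generators as a basis and satisfies their bracket relations. -/
lemma realRealizes_holGen (hU : IsConnected (U : Set Space)) (hp : p₀ ∈ U) (hM : p₀ ∈ quadric) :
    RealRealizes (holGen U) := by
  have hcoe : ∀ k, ((holGen U k : hol U) : HolField U) = PolyField.restrict U (gen k) := by
    intro k
    by_cases hk : k < 78
    · exact coe_holGen hk
    · have hlen : genData.length ≤ k := by
        simp only [genData, List.length_append, length_familyData]
        omega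
      have hgen : gen k = 0 := by
        rw [gen, List.getD_eq_default _ _ hlen]
        rfl
      rw [holGen, dif_neg hk, hgen, map_zero]
      rfl
  have hsub : ∀ k, (hol U).toSubmodule.subtype (holGen U k) = PolyField.restrict U (gen k) := hcoe
  have hspan : Submodule.span ℝ (Set.range fun k : Fin 78 => holGen U k) = ⊤ := by
    rw [eq_top_iff]
    rintro ⟨X, hX⟩ -
    obtain ⟨a, ha⟩ := (Submodule.mem_span_range_iff_exists_fun ℝ).mp
      (mem_real_span_gen hU hp hM hX)
    refine (Submodule.mem_span_range_iff_exists_fun ℝ).mpr ⟨a, ?_⟩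
    refine (hol U).toSubmodule.injective_subtype ?_
    rw [map_sum]
    simp only [map_smul, hsub]
    exact ha
  refine realRealizes_of_complex (φ := (hol U).toSubmodule.subtype) (fun _ _ => rfl) ?_ hspan ?_
  · simp only [hsub]
    exact linearIndependent_restrict_gen hU.nonempty
  · intro a b c h
    simp only [hsub, ← Lin.map_eval (PolyField.restrict U)]
    rw [← PolyField.restrict_bracket, h]

end CREII

theorem mainTheorem1 :
    -- `M` is a generic submanifold of dimension 24 and CR dimension 8
    (∀ p ∈ CREII.quadric,
      Function.Surjective (fderiv ℝ CREII.defining p) ∧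
      Module.finrank ℝ (CREII.tangent p) = 24 ∧
      CREII.tangent p ⊔ (CREII.tangent p).map CREII.J = ⊤ ∧
      Module.finrank ℝ ↥(CREII.tangent p ⊓ (CREII.tangent p).map CREII.J) = 16) ∧
    -- the statement about `hol(M)`, on an arbitrary connected open set that meets `M`
    ∀ U : TopologicalSpace.Opens CREII.Space, IsConnected (U : Set CREII.Space) →
      ((U : Set CREII.Space) ∩ CREII.quadric).Nonempty →
      -- the grading
      (iSupIndep (CREII.graded U) ∧ ⨆ k, CREII.graded U k = (CREII.hol U).toSubmodule) ∧
      (∀ k l : ℤ, ∀ X ∈ CREII.graded U k, ∀ Y ∈ CREII.graded U l,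
        ⁅X, Y⁆ ∈ CREII.graded U (k + l)) ∧
      (∀ k : ℤ, 3 ≤ |k| → CREII.graded U k = ⊥) ∧
      Module.finrank ℝ (CREII.graded U (-2)) = 8 ∧
      Module.finrank ℝ (CREII.graded U (-1)) = 16 ∧
      Module.finrank ℝ (CREII.graded U 0) = 30 ∧
      Module.finrank ℝ (CREII.graded U 1) = 16 ∧
      Module.finrank ℝ (CREII.graded U 2) = 8 ∧
      -- the 78 listed fields form bases
      LinearIndependent ℝ (fun i => CREII.PolyField.restrict U (CREII.generator i)) ∧
      Submodule.span ℝ (Set.range fun i => CREII.PolyField.restrict U (CREII.generator i)) =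
        (CREII.hol U).toSubmodule ∧
      Submodule.span ℝ (Set.range fun i => CREII.PolyField.restrict U (CREII.genNegTwo i)) =
        CREII.graded U (-2) ∧
      Submodule.span ℝ (Set.range fun i => CREII.PolyField.restrict U (CREII.genNegOne i)) =
        CREII.graded U (-1) ∧
      Submodule.span ℝ (Set.range fun i => CREII.PolyField.restrict U (CREII.genZero i)) =
        CREII.graded U 0 ∧
      Submodule.span ℝ (Set.range fun i => CREII.PolyField.restrict U (CREII.genOne i)) =
        CREII.graded U 1 ∧
      Submodule.span ℝ (Set.range fun i => CREII.PolyField.restrict U (CREII.genTwo i)) =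
        CREII.graded U 2 ∧
      -- `hol(M)` is the real simple Lie algebra `E_II`
      CREII.IsEII (CREII.hol U) := by
  refine ⟨fun p _ => ⟨CREII.surjective_fderiv_defining p, CREII.finrank_tangent p,
    CREII.tangent_sup_J p, CREII.finrank_tangent_inf_J p⟩, ?_⟩
  rintro U hU ⟨p₀, hp, hM⟩
  obtain ⟨s1, f1⟩ := CREII.graded_basis hU hp hM (F := CREII.genNegTwo) (w := -2) (s := 0)
    (fun i => by rw [Nat.zero_add]; exact (CREII.gen_genNum (.inl i)).symm)
    (fun k _ => by unfold CREII.genWeight; split_ifs <;> simp <;> omega) (by norm_num)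
  obtain ⟨s2, f2⟩ := CREII.graded_basis hU hp hM (F := CREII.genNegOne) (w := -1) (s := 8)
    (fun i => (CREII.gen_genNum (.inr (.inl i))).symm)
    (fun k _ => by unfold CREII.genWeight; split_ifs <;> simp <;> omega) (by norm_num)
  obtain ⟨s3, f3⟩ := CREII.graded_basis hU hp hM (F := CREII.genZero) (w := 0) (s := 24)
    (fun i => (CREII.gen_genNum (.inr (.inr (.inl i)))).symm)
    (fun k _ => by unfold CREII.genWeight; split_ifs <;> simp <;> omega) (by norm_num)
  obtain ⟨s4, f4⟩ := CREII.graded_basis hU hp hM (F := CREII.genOne) (w := 1) (s := 54)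
    (fun i => (CREII.gen_genNum (.inr (.inr (.inr (.inl i))))).symm)
    (fun k _ => by unfold CREII.genWeight; split_ifs <;> simp <;> omega) (by norm_num)
  obtain ⟨s5, f5⟩ := CREII.graded_basis hU hp hM (F := CREII.genTwo) (w := 2) (s := 70)
    (fun i => (CREII.gen_genNum (.inr (.inr (.inr (.inr i))))).symm)
    (fun k _ => by unfold CREII.genWeight; split_ifs <;> simp <;> omega) (by norm_num)
  -- the generators in the order of the list
  have hgen : (fun i => CREII.PolyField.restrict U (CREII.generator i)) =
      (fun k : Fin 78 => CREII.PolyField.restrict U (CREII.gen k)) ∘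
        fun i => ⟨CREII.genNum i, CREII.genNum_lt i⟩ := funext fun i => by
    rw [← CREII.gen_genNum]
    rfl
  have hsurj : Function.Surjective fun i => (⟨CREII.genNum i, CREII.genNum_lt i⟩ : Fin 78) :=
    fun k => by
      obtain ⟨i, hi⟩ := CREII.exists_genNum k.2
      exact ⟨i, Fin.ext hi⟩
  refine ⟨⟨CREII.iSupIndep_graded hU hp hM, CREII.iSup_graded hU hp hM⟩,
    fun k l X hX Y hY => CREII.lie_mem_graded hX hY,
    fun k hk => CREII.graded_eq_bot hU hp hM hk, f1, f2, f3, f4, f5, ?_, ?_, s1, s2, s3, s4, s5,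
    (CREII.realRealizes_holGen hU hp hM).isEII⟩
  · rw [hgen]
    exact (CREII.linearIndependent_real_gen hU.nonempty).comp _ fun i j hij =>
      CREII.genNum_injective (congrArg Fin.val hij)
  · rw [hgen, hsurj.range_comp]
    exact CREII.span_gen_eq_hol hU hp hM
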